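/- Let $M$ be a (finite-dimensional, Hausdorff, boundaryless) real-analytic manifold, let $\nabla$ be a real-analytic connection on $TM$, with torsion tensor $T(X,Y)=\nabla_XY-\nabla_YX-[X,Y]$ and curvature tensor $R(X,Y)Z=\nabla_X\nabla_YZ-\nabla_Y\nabla_XZ-\nabla_{[X,Y]}Z$, and let $x_0\in M$. For a tensor field $\tau$ on $M$, let $\nabla^{(r)}\tau$ denote its $r$-th covariant derivative, with $\nabla^{(0)}\tau=\tau$. For an open set $U\subset M$, a smooth map $f:U\to M$ is called affine if $\mathrm df_x(\nabla_vX)=\nabla_v(\mathrm df\circ X)$ for every $x\in U$, every $v\in T_xM$ and every smooth vector field $X$ on $U$, where $\mathrm df\circ X$ is regarded as a vector field along $f$ and the right-hand side is its covariant derivative with respect to the connection $f^*\nabla$ on $f^*TM$. An affine symmetry around $x_0$ is an affine map $f:U\to M$, defined on an open neighborhood $U$ of $x_0$, with $f(x_0)=x_0$ and $\mathrm df(x_0)=-\mathrm{Id}$. Then there exists an affine symmetry around $x_0$ if and only if $$\nabla^{(2r)}T_{x_0}=0\quad\text{and}\quad\nabla^{(2r+1)}R_{x_0}=0\qquad\text{for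 all } r\ge 0.\tag{$*$}$$ Moreover, if $M$ is (connected and) simply connected and $\nabla$ is geodesically complete, i.e., every tangent vector of $M$ is the initial velocity of a geodesic defined on all of $\mathbb R$, then $(*)$ is equivalent to the existence of a globally defined affine symmetry $f:M\to M$ around $x_0$. -/

import Mathlib

open scoped Manifold ContDiff

noncomputable section

namespace AffineSymmetry

variable {E : Type*} [NormedAddCommGroup E] [NormedSpace ℝ E]
  {M : Type*} [TopologicalSpace M] [ChartedSpace E M]

/-- Vector fields on `M` (as set-theoretic sections of `TM`; smoothness is required separately). -/
abbrev VField (E : Type*) [NormedAddCommGroup E] [NormedSpace ℝ E]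
    (M : Type*) [TopologicalSpace M] [ChartedSpace E M] :=
  Π x : M, TangentSpace 𝓘(ℝ, E) x

/-- The vector field `X` is of class `C^n` on the set `U`. -/
def VField.ContDiffOn [IsManifold 𝓘(ℝ, E) 1 M] (n : ℕ∞ω) (X : VField E M) (U : Set M) : Prop :=
  ContMDiffOn 𝓘(ℝ, E) (𝓘(ℝ, E).prod 𝓘(ℝ, E)) n
    (fun x ↦ (⟨x, X x⟩ : TangentBundle 𝓘(ℝ, E) M)) U

/-- Connections (covariant derivatives) on the tangent bundle of `M`. Mathlib's argument order is
`cov Y x (X x) = (∇_X Y)(x)`. -/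
abbrev Connection (E : Type*) [NormedAddCommGroup E] [NormedSpace ℝ E]
    (M : Type*) [TopologicalSpace M] [ChartedSpace E M] [IsManifold 𝓘(ℝ, E) 1 M] :=
  CovariantDerivative 𝓘(ℝ, E) E (TangentSpace 𝓘(ℝ, E) : M → Type _)

/-- The connection is real-analytic: it maps local real-analytic vector fields (defined on an
arbitrary open set) to real-analytic sections of `Hom(TM, TM)`. -/
def IsRealAnalytic [IsManifold 𝓘(ℝ, E) 1 M] (cov : Connection E M) : Prop :=
  ∀ U : Set M, IsOpen U → ContMDiffCovariantDerivativeOn E ω cov.toFun U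

section Tensors

variable [IsManifold 𝓘(ℝ, E) 1 M]

/-- `TM`-valued covariant tensor fields of order `k`, regarded as operations taking `k` vector
fields to a vector field. (Tensoriality holds for the operations used below.) -/
abbrev TensorOp (E : Type*) [NormedAddCommGroup E] [NormedSpace ℝ E]
    (M : Type*) [TopologicalSpace M] [ChartedSpace E M] (k : ℕ) :=
  (Fin k → VField E M) → VField E M

/-- `nabla cov X Y = ∇_X Y`. -/
def nabla (cov : Connection E M) (X Y : VField E M) : VField E M :=
  fun x ↦ cov Y x (X x)

/-- The torsion tensor field `T(X, Y) = ∇_X Y - ∇_Y X - [X, Y]` (Mathlib's torsion tensor). -/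
def torsionOp [FiniteDimensional ℝ E] [IsManifold 𝓘(ℝ, E) 2 M] (cov : Connection E M) :
    TensorOp E M 2 :=
  haveI : CompleteSpace E := FiniteDimensional.complete ℝ E
  fun X x ↦ cov.torsion x (X 0 x) (X 1 x)

/-- The curvature tensor field
`R(X, Y) Z = ∇_X ∇_Y Z - ∇_Y ∇_X Z - ∇_{[X, Y]} Z`. -/
def curvatureOp (cov : Connection E M) : TensorOp E M 3 :=
  fun X ↦ nabla cov (X 0) (nabla cov (X 1) (X 2)) - nabla cov (X 1) (nabla cov (X 0) (X 2))
    - nabla cov (VectorField.mlieBracket 𝓘(ℝ, E) (X 0) (X 1)) (X 2)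

/-- The covariant derivative of a tensor field:
`(∇τ)(X₀, X₁, …, X_k) = ∇_{X₀}(τ(X₁, …, X_k)) - ∑ᵢ τ(X₁, …, ∇_{X₀} Xᵢ, …, X_k)`. -/
def covDerivOp (cov : Connection E M) {k : ℕ} (τ : TensorOp E M k) : TensorOp E M (k + 1) :=
  fun X ↦ nabla cov (X 0) (τ (Fin.tail X))
    - ∑ i : Fin k, τ (Function.update (Fin.tail X) i (nabla cov (X 0) (Fin.tail X i)))

/-- The iterated covariant derivative `∇^{(r)} τ`, with `∇^{(0)} τ = τ`. -/
def iterCovDerivOp (cov : Connection E M) {k : ℕ} (τ : TensorOp E M k) :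
    (r : ℕ) → TensorOp E M (k + r)
  | 0 => τ
  | r + 1 => covDerivOp cov (iterCovDerivOp cov τ r)

/-- The tensor field `τ` vanishes at `x₀`: its value at `x₀` on any vector fields that are smooth
near `x₀` is zero. -/
def VanishesAt {k : ℕ} (τ : TensorOp E M k) (x₀ : M) : Prop :=
  ∀ U : Set M, IsOpen U → x₀ ∈ U → ∀ X : Fin k → VField E M,
    (∀ i, (X i).ContDiffOn ∞ U) → τ X x₀ = 0

end Tensors

section Along

variable [IsManifold 𝓘(ℝ, E) 1 M]
  {F : Type*} [NormedAddCommGroup F] [NormedSpace ℝ F]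
  {N : Type*} [TopologicalSpace N] [ChartedSpace F N]

/-- The covariant derivative `(f^*∇)_v Z` of a vector field `Z` along a map `f : N → M`, i.e. of a
section of `f^* TM`. In a local trivialization of `TM` around `f t`, with frame `(e_i)`, write
`Z = ∑ ζ^i (e_i ∘ f)`; then
`(f^*∇)_v Z = ∑ dζ^i(v) e_i(f t) + ∇_{df(v)} (∑ ζ^i(t) e_i)`.
`FiberBundle.extend E (Z t)` is the vector field `∑ ζ^i(t) e_i` near `f t`. -/
def covDerivAlong (cov : Connection E M) (f : N → M) (Z : Π t : N, TangentSpace 𝓘(ℝ, E) (f t))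
    (t : N) (v : TangentSpace 𝓘(ℝ, F) t) : TangentSpace 𝓘(ℝ, E) (f t) :=
  let e := trivializationAt E (TangentSpace 𝓘(ℝ, E) : M → Type _) (f t)
  let ζ : N → E := fun s ↦ (e (⟨f s, Z s⟩ : TangentBundle 𝓘(ℝ, E) M)).2
  e.symm (f t) (mvfderiv 𝓘(ℝ, F) ζ t v)
    + cov (FiberBundle.extend E (x := f t) (Z t)) (f t) (mfderiv 𝓘(ℝ, F) 𝓘(ℝ, E) f t v)

/-- The curve `γ : ℝ → M` is a geodesic: it is smooth and `D/dt γ' = 0`. -/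
def IsGeodesic (cov : Connection E M) (γ : ℝ → M) : Prop :=
  ContMDiff 𝓘(ℝ, ℝ) 𝓘(ℝ, E) ∞ γ ∧
    ∀ t : ℝ, covDerivAlong cov γ (fun s ↦ mfderiv 𝓘(ℝ, ℝ) 𝓘(ℝ, E) γ s (1 : ℝ)) t (1 : ℝ) = 0

/-- Geodesic completeness: every tangent vector `v` at `y` is the initial velocity of a geodesic
defined on the whole real line (equivalently, `exp_y` is defined on all of `T_y M`). -/
def IsGeodesicallyComplete (cov : Connection E M) : Prop :=
  ∀ (y : M) (v : TangentSpace 𝓘(ℝ, E) y), ∃ γ : ℝ → M, IsGeodesic cov γ ∧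
    (⟨γ 0, mfderiv 𝓘(ℝ, ℝ) 𝓘(ℝ, E) γ 0 (1 : ℝ)⟩ : TangentBundle 𝓘(ℝ, E) M) = ⟨y, v⟩

/-- The restriction of `f` to the open set `U ⊆ N` is an affine map `U → M`: it is smooth on `U`
and `df_x(∇_v X) = ∇_v (df ∘ X)` for all `x ∈ U`, `v ∈ T_x N` and all vector fields `X` smooth on
`U`, where `df ∘ X` is a vector field along `f`. Values of `f` and `X` outside `U` are
irrelevant. -/
def IsAffineOn [IsManifold 𝓘(ℝ, F) 1 N] (covN : Connection F N) (covM : Connection E M)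
    (f : N → M) (U : Set N) : Prop :=
  ContMDiffOn 𝓘(ℝ, F) 𝓘(ℝ, E) ∞ f U ∧
    ∀ X : VField F N, X.ContDiffOn ∞ U → ∀ x ∈ U, ∀ v : TangentSpace 𝓘(ℝ, F) x,
      mfderiv 𝓘(ℝ, F) 𝓘(ℝ, E) f x (covN X x v) =
        covDerivAlong covM f (fun y ↦ mfderiv 𝓘(ℝ, F) 𝓘(ℝ, E) f y (X y)) x v

/-- `f : U → M` is an affine symmetry around `x₀`: `U` is an open neighbourhood of `x₀`, `f` is
affine on `U`, `f x₀ = x₀` and `df_{x₀} = -Id`. -/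
structure IsAffineSymmetryOn (cov : Connection E M) (x₀ : M) (U : Set M) (f : M → M) : Prop where
  isOpen : IsOpen U
  mem : x₀ ∈ U
  affine : IsAffineOn cov cov f U
  map_and_deriv : ∀ v : TangentSpace 𝓘(ℝ, E) x₀,
    tangentMap 𝓘(ℝ, E) 𝓘(ℝ, E) f ⟨x₀, v⟩ = ⟨x₀, -v⟩

end Along

/-- `∇^{(2r)} T` and `∇^{(2r+1)} R` vanish at `x₀` for all `r ≥ 0`. -/
def ParityCondition [FiniteDimensional ℝ E] [IsManifold 𝓘(ℝ, E) ω M] (cov : Connection E M)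
    (x₀ : M) : Prop :=
  ∀ r : ℕ, VanishesAt (iterCovDerivOp cov (torsionOp cov) (2 * r)) x₀ ∧
    VanishesAt (iterCovDerivOp cov (curvatureOp cov) (2 * r + 1)) x₀

end AffineSymmetry

end

noncomputable section

open scoped Topology
open Filter Set Asymptotics

set_option maxSynthPendingDepth 3
set_option linter.unusedSectionVars false

namespace AffineSymmetry

/-! ### Analytic flows of analytic vector fields on Banach spaces. -/

section Flow
variable {X : Type*} [NormedAddCommGroup X] [NormedSpace ℝ X]
local notation "𝕀" => (Set.Icc (0:ℝ) 1)

/-! In coordinates a map f is affine when its second derivative satisfies `AffineEq`. Along each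
line x + t v this says that df is parallel as a section of Hom(TM, f^*TM): the pair (f, df) solves
the system recorded in `HorizontalAt`. Consequently df intertwines torsion, curvature and all their
covariant derivatives (`AffineEq.defect_torsion`, `AffineEq.defect_curvature`,
`AffineEq.defect_iterCovDeriv`).

Parity enters through -Id. For a TM-valued covariant tensor τ of order k, intertwining τ with itself
under -Id means (1 + (-1)^k) τ = 0, which is automatic for odd k and forces τ = 0 for even k
(`defect_neg_id`). The r-th derivatives of T and R have orders r + 2 and r + 3, so (*) says exactly
that -Id intertwines every derivative of T and R at the point. This gives necessity
(`CoordParity.of_affineEq`) and prepares sufficiency (`CoordParity.defect_eq_zero`).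

Local existence is `exists_affineEq`, valid for any linear map A₀ that intertwines all derivatives
of T and R at two points. Solve the horizontal system with initial value A₀ along all rays from the
centre. The derivative of the defect of a tensor is controlled by the defects of the tensor and of
its covariant derivative (`HorizontalAt.hasDerivAt_defect`), so the defects of T and R vanish to
infinite order at the centre and, by analyticity, along each ray. Differentiating the solution
across the rays, the failure of Q to be the derivative of the endpoint map, together with the
failure of Q to be parallel in transverse directions, satisfies a linear ODE whose inhomogeneous
terms are precisely these defects. With zero initial values, it vanishes (`fderiv_radial_eq`), and
the time-one endpoint map is affine.

For the global statement, completeness lets a germ of an affine map f at q be extended by exp ∘ df ∘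
exp⁻¹ over a neighbourhood that does not depend on the germ (`exists_affine_extension`). Hence the
étalé space of affine germs is a covering of M. Over a simply connected M the covering has a section
through any prescribed germ (`exists_global_extension`), in particular through the germ of a local
symmetry. -/

/-- Pointwise application of a continuous multilinear map to continuous functions. -/
def compCurves {Y : Type*} [NormedAddCommGroup Y] [NormedSpace ℝ Y] {n : ℕ}
    (m : ContinuousMultilinearMap ℝ (fun _ : Fin n ↦ X) Y) :
    ContinuousMultilinearMap ℝ (fun _ : Fin n ↦ C(𝕀, X)) C(𝕀, Y) :=
  MultilinearMap.mkContinuous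
    { toFun := fun γ ↦ ⟨fun t ↦ m (fun i ↦ γ i t), by fun_prop⟩
      map_update_add' := by
        intro _ γ i a b
        ext t
        have h : ∀ c : C(𝕀, X), (fun j ↦ (Function.update γ i c) j t)
            = Function.update (fun j ↦ γ j t) i (c t) := fun c ↦ by
          ext j; by_cases hj : j = i
          · subst hj; simp
          · simp [hj]
        have e : ‹DecidableEq (Fin n)› = instDecidableEqFin n := Subsingleton.elim _ _
        subst e
        simp [h]
      map_update_smul' := by
        intro _ γ i a b
        ext t
        have h : ∀ c : C(𝕀, X), (fun j ↦ (Function.update γ i c) j t)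
            = Function.update (fun j ↦ γ j t) i (c t) := fun c ↦ by
          ext j; by_cases hj : j = i
          · subst hj; simp
          · simp [hj]
        have e : ‹DecidableEq (Fin n)› = instDecidableEqFin n := Subsingleton.elim _ _
        subst e
        simp [h] } ‖m‖ (by
      intro γ
      refine (ContinuousMap.norm_le _ (by positivity)).2 fun t ↦ ?_
      refine (m.le_opNorm _).trans ?_
      gcongr with i
      exact (γ i).norm_coe_le_norm t)

lemma norm_compCurves_le {Y : Type*} [NormedAddCommGroup Y] [NormedSpace ℝ Y] {n : ℕ}
    (m : ContinuousMultilinearMap ℝ (fun _ : Fin n ↦ X) Y) : ‖compCurves m‖ ≤ ‖m‖ :=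
  MultilinearMap.mkContinuous_norm_le _ (norm_nonneg _) _

/-- Superposition with an analytic map is analytic on continuous curves. -/
lemma exists_analyticAt_superposition {Y : Type*} [NormedAddCommGroup Y] [NormedSpace ℝ Y] [CompleteSpace Y]
    {V : X → Y} {p : X} (hV : AnalyticAt ℝ V p) :
    ∃ N : C(𝕀, X) → C(𝕀, Y), AnalyticAt ℝ N (.const _ p) ∧
      ∀ᶠ γ in 𝓝 (ContinuousMap.const 𝕀 p), ∀ t, N γ t = V (γ t) := by
  obtain ⟨P, r, hP⟩ := hV
  let Q : FormalMultilinearSeries ℝ C(𝕀, X) C(𝕀, Y) := fun n ↦ compCurves (P n)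
  have hQr : r ≤ Q.radius := by
    refine hP.r_le.trans ?_
    refine FormalMultilinearSeries.radius_le_of_le fun n ↦ norm_compCurves_le _
  have hr := hP.r_pos
  have hQ := (Q.hasFPowerSeriesOnBall (hr.trans_le hQr)).mono hr hQr
  refine ⟨fun γ ↦ Q.sum (γ - .const _ p), ?_, ?_⟩
  · refine ⟨Q, r, ?_⟩
    simpa using hQ.comp_sub (.const _ p)
  · have := Metric.eball_mem_nhds (ContinuousMap.const 𝕀 p) hr
    filter_upwards [this] with γ hγ t
    have hγ' : γ - .const _ p ∈ Metric.eball (0 : C(𝕀, X)) r := by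
      simpa [edist_eq_enorm_sub] using hγ
    have h1 := hQ.hasSum hγ'
    have h2 := h1.map (ContinuousMap.evalCLM ℝ t) (ContinuousMap.evalCLM ℝ t).continuous
    have hγt : (γ t - p) ∈ Metric.eball (0 : X) r := by
      simp only [Metric.mem_eball, edist_zero_right] at hγ' ⊢
      refine lt_of_le_of_lt ?_ hγ'
      have := (γ - .const _ p).norm_coe_le_norm t
      simpa [enorm_eq_nnnorm, ← NNReal.coe_le_coe] using this
    have h3 := hP.hasSum hγt
    rw [add_sub_cancel] at h3
    rw [zero_add] at h2
    exact h2.unique h3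

/-- The integral operator on curves. -/
def integrateCurve [CompleteSpace X] : C(𝕀, X) →L[ℝ] C(𝕀, X) :=
  LinearMap.mkContinuous
    { toFun := fun γ ↦ ⟨fun t ↦ ∫ s in (0:ℝ)..t, γ (projIcc 0 1 zero_le_one s), by
        have : Continuous fun t : ℝ ↦ ∫ s in (0:ℝ)..t, γ (projIcc 0 1 zero_le_one s) :=
          intervalIntegral.continuous_primitive (fun a b ↦
            (γ.continuous.comp continuous_projIcc).intervalIntegrable _ _) 0
        exact this.comp continuous_subtype_val⟩
      map_add' := fun a b ↦ by
        ext t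
        exact intervalIntegral.integral_add
            ((a.continuous.comp continuous_projIcc).intervalIntegrable _ _)
            ((b.continuous.comp continuous_projIcc).intervalIntegrable _ _)
      map_smul' := fun c a ↦ by
        ext t
        exact intervalIntegral.integral_smul c _ } 1 (by
      intro γ
      refine (ContinuousMap.norm_le _ (by positivity)).2 fun t ↦ ?_
      have := intervalIntegral.norm_integral_le_of_norm_le_const (a := (0:ℝ)) (b := t) (C := ‖γ‖)
        (f := fun s ↦ γ (projIcc 0 1 zero_le_one s)) (fun s _ ↦ γ.norm_coe_le_norm _)
      refine this.trans ?_
      rw [sub_zero, abs_of_nonneg t.2.1, one_mul]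
      exact mul_le_of_le_one_right (norm_nonneg _) t.2.2)

/-- Restriction of a curve to `[0, s]`, rescaled to the unit interval. -/
def rescaleCurve (s : 𝕀) (γ : C(𝕀, X)) : C(𝕀, X) :=
  ⟨fun t ↦ γ (⟨s * t, mul_nonneg s.2.1 t.2.1, mul_le_one₀ s.2.2 t.2.1 t.2.2⟩), by fun_prop⟩

/-- Substitution in the integral. It turns a solution of the integral equation with time scale l
into one with time scale s * l. -/
lemma integrateCurve_rescale [CompleteSpace X] (s t : 𝕀) (γ : C(𝕀, X)) :
    (s : ℝ) • integrateCurve (rescaleCurve s γ) t = rescaleCurve s (integrateCurve γ) t := by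
  change (s : ℝ) • (∫ r in (0:ℝ)..t, _) = ∫ r in (0:ℝ)..(s * t : ℝ), _
  have h := intervalIntegral.smul_integral_comp_mul_left (a := (0:ℝ)) (b := t)
    (fun r ↦ γ (projIcc 0 1 zero_le_one r)) (s : ℝ)
  rw [mul_zero] at h
  rw [← h]
  congr 1
  refine intervalIntegral.integral_congr fun r hr ↦ ?_
  rw [uIcc_of_le t.2.1] at hr
  have hr1 : r ∈ 𝕀 := ⟨hr.1, hr.2.trans t.2.2⟩
  have hr2 : (s * r : ℝ) ∈ 𝕀 := ⟨mul_nonneg s.2.1 hr1.1, mul_le_one₀ s.2.2 hr1.1 hr1.2⟩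
  simp only [projIcc_of_mem zero_le_one hr1, projIcc_of_mem zero_le_one hr2, rescaleCurve]
  rfl

lemma norm_rescaleCurve_sub_const_le (s : 𝕀) (γ : C(𝕀, X)) (p : X) :
    ‖rescaleCurve s γ - .const _ p‖ ≤ ‖γ - .const _ p‖ :=
  (ContinuousMap.norm_le _ (norm_nonneg _)).2 fun t ↦
    (γ - .const _ p).norm_coe_le_norm ⟨s * t, mul_nonneg s.2.1 t.2.1, mul_le_one₀ s.2.2 t.2.1 t.2.2⟩

lemma hasDerivAt_integrateCurve [CompleteSpace X] (γ : C(𝕀, X)) (t : 𝕀) :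
    HasDerivAt (fun s : ℝ ↦ ∫ r in (0:ℝ)..s, γ (projIcc 0 1 zero_le_one r)) (γ t) t := by
  have hc : Continuous fun r ↦ γ (projIcc 0 1 zero_le_one r) := γ.continuous.comp continuous_projIcc
  have := intervalIntegral.integral_hasDerivAt_right (hc.intervalIntegrable 0 t)
    (hc.stronglyMeasurableAtFilter _ _) hc.continuousAt
  simpa using this

/-- An analytic vector field has a local flow which is jointly analytic in time and in the initial
condition. -/
theorem exists_analytic_flow [CompleteSpace X] {V : X → X} {p₀ : X} (hV : AnalyticAt ℝ V p₀) :
    ∃ Φ : ℝ × X → X, AnalyticAt ℝ Φ (0, p₀) ∧ (∀ᶠ p in 𝓝 p₀, Φ (0, p) = p) ∧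
      ∀ᶠ z in 𝓝 ((0 : ℝ), p₀), HasDerivAt (fun t ↦ Φ (t, z.2)) (V (Φ z)) z.1 := by
  obtain ⟨N, hN, hNV⟩ := exists_analyticAt_superposition hV
  let con : X →L[ℝ] C(𝕀, X) := ContinuousLinearMap.const ℝ 𝕀
  -- Picard's equation with time rescaled to the unit interval: a zero is the curve t ↦ (flow at
  -- time l t of p), with l = `v.1.1` and p = `v.1.2`. Time has become a parameter, so the implicit
  -- function theorem gives joint analyticity.
  let f : (ℝ × X) × C(𝕀, X) → C(𝕀, X) := fun v ↦ v.2 - con v.1.2 - v.1.1 • integrateCurve (N v.2)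
  let u : (ℝ × X) × C(𝕀, X) := ((0, p₀), con p₀)
  have hcon : ∀ p, con p = .const _ p := fun p ↦ rfl
  have hfu : f u = 0 := by simp [f, u]
  have hfa : AnalyticAt ℝ f u := by
    have h1 : AnalyticAt ℝ (fun v : (ℝ × X) × C(𝕀, X) ↦ N v.2) u :=
      AnalyticAt.fun_comp (g := N) (f := fun v : (ℝ × X) × C(𝕀, X) ↦ v.2) hN analyticAt_snd
    have h2 : AnalyticAt ℝ (fun v : (ℝ × X) × C(𝕀, X) ↦ integrateCurve (N v.2)) u :=
      AnalyticAt.fun_comp ((integrateCurve (X := X)).analyticAt (N u.2)) h1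
    have h3 : AnalyticAt ℝ (fun v : (ℝ × X) × C(𝕀, X) ↦ con v.1.2) u :=
      AnalyticAt.fun_comp (con.analyticAt _)
        (((ContinuousLinearMap.snd ℝ ℝ X).comp (.fst ℝ (ℝ × X) C(𝕀, X))).analyticAt u)
    exact (((ContinuousLinearMap.snd ℝ (ℝ × X) C(𝕀, X)).analyticAt u).sub h3).sub
      ((((ContinuousLinearMap.fst ℝ ℝ X).comp (.fst ℝ (ℝ × X) C(𝕀, X))).analyticAt u).smul h2)
  have cdf : ContDiffAt ℝ ω f u := hfa.contDiffAt
  -- At l = 0 the integral term disappears and the equation is a translate of the identity in the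
  -- curve variable.
  have hinv : fderiv ℝ f u ∘L .inr ℝ (ℝ × X) C(𝕀, X) = .id ℝ _ := by
    have h1 : HasFDerivAt (f ∘ fun γ ↦ ((0, p₀), γ))
        (fderiv ℝ f u ∘L .inr ℝ (ℝ × X) C(𝕀, X)) (con p₀) :=
      HasFDerivAt.comp (f := fun γ : C(𝕀, X) ↦ (((0 : ℝ), p₀), γ)) (con p₀)
        hfa.differentiableAt.hasFDerivAt (hasFDerivAt_prodMk_right _ _)
    have h2 : HasFDerivAt (f ∘ fun γ ↦ ((0, p₀), γ)) (.id ℝ C(𝕀, X)) (con p₀) := by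
      have : (f ∘ fun γ ↦ ((0, p₀), γ)) = fun γ ↦ γ - con p₀ := by
        funext γ; simp [f]
      rw [this]
      exact (hasFDerivAt_id _).sub_const _
    exact h1.unique h2
  have if₂ : (fderiv ℝ f u ∘L .inr ℝ (ℝ × X) C(𝕀, X)).IsInvertible := by
    rw [hinv]; exact ⟨.refl ℝ _, rfl⟩
  have pn : (ω : ℕ∞ω) ≠ 0 := by simp
  let a := cdf.implicitFunction pn if₂
  have ha0 : a (0, p₀) = con p₀ := cdf.implicitFunction_apply_self pn if₂
  have haa : AnalyticAt ℝ a (0, p₀) := (cdf.contDiffAt_implicitFunction pn if₂).analyticAt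
  have e1 : ∀ᶠ z in 𝓝 ((0 : ℝ), p₀), f (z, a z) = 0 := by
    simpa [hfu] using cdf.eventually_apply_implicitFunction pn if₂
  have e3 : ∀ᶠ v in 𝓝 u, f v = 0 → a v.1 = v.2 := by
    filter_upwards [cdf.eventually_apply_eq_iff_implicitFunction pn if₂] with v hv h
    exact hv.1 (h.trans hfu.symm)
  have e3' : ∀ᶠ v in 𝓝 u, (f v = 0 → a v.1 = v.2) ∧ ∀ t, N v.2 t = V (v.2 t) := by
    refine e3.and ?_
    exact (continuous_snd.tendsto u).eventually hNV
  obtain ⟨δ, hδ, hball⟩ := Metric.eventually_nhds_iff.1 e3'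
  have e4 : ∀ᶠ z in 𝓝 ((0 : ℝ), p₀), dist (a z) (con p₀) < δ := by
    have := haa.continuousAt.tendsto
    rw [ha0] at this
    exact this.eventually (Metric.ball_mem_nhds _ hδ)
  obtain ⟨ε, hε, hgood⟩ := Metric.eventually_nhds_iff.1 (e1.and e4)
  have key : ∀ l p, |l| < min ε δ → dist p p₀ < min ε δ →
      f ((l, p), a (l, p)) = 0 ∧ dist (a (l, p)) (con p₀) < δ := by
    intro l p hl hp
    exact hgood (by
      rw [Prod.dist_eq]
      refine max_lt ?_ (hp.trans_le (min_le_left _ _))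
      simpa using hl.trans_le (min_le_left _ _))
  have key2 : ∀ l p γ, |l| < min ε δ → dist p p₀ < min ε δ → dist γ (con p₀) < δ →
      (f ((l, p), γ) = 0 → a (l, p) = γ) ∧ ∀ t, N γ t = V (γ t) := by
    intro l p γ hl hp hγ
    refine hball (y := ((l, p), γ)) ?_
    rw [Prod.dist_eq, Prod.dist_eq]
    refine max_lt (max_lt ?_ (hp.trans_le (min_le_right _ _))) hγ
    simpa [u] using! hl.trans_le (min_le_right _ _)
  have solves : ∀ l p, |l| < min ε δ → dist p p₀ < min ε δ → ∀ t,
      a (l, p) t = p + l • integrateCurve (N (a (l, p))) t := by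
    intro l p hl hp t
    have h := DFunLike.congr_fun (key l p hl hp).1 t
    simp only [f, ContinuousMap.sub_apply, ContinuousMap.smul_apply, ContinuousMap.zero_apply,
      hcon, ContinuousMap.const_apply] at h
    rw [sub_sub, sub_eq_zero] at h
    exact h
  -- The rescaled curve solves the equation with parameter s * l and stays close to the constant
  -- curve, so the uniqueness in the implicit function theorem identifies it.
  have scale : ∀ l p (s : 𝕀), |l| < min ε δ → dist p p₀ < min ε δ →
      a (s * l, p) 1 = a (l, p) s := by
    intro l p s hl hp
    have hsl : |s * l| < min ε δ := by
      rw [abs_mul, abs_of_nonneg s.2.1]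
      exact (mul_le_of_le_one_left (abs_nonneg _) s.2.2).trans_lt hl
    have hd : dist (rescaleCurve s (a (l, p))) (con p₀) < δ := by
      rw [dist_eq_norm]
      refine (norm_rescaleCurve_sub_const_le s _ p₀).trans_lt ?_
      have := (key l p hl hp).2
      rwa [dist_eq_norm] at this
    have hNr : N (rescaleCurve s (a (l, p))) = rescaleCurve s (N (a (l, p))) := by
      ext t
      rw [(key2 l p _ hl hp hd).2 t]
      exact ((key2 l p _ hl hp (key l p hl hp).2).2 _).symm
    have h := (key2 (s * l) p (rescaleCurve s (a (l, p))) hsl hp hd).1 ?_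
    · rw [h]
      simp [rescaleCurve]
    · ext t
      simp only [f, ContinuousMap.sub_apply, ContinuousMap.smul_apply, ContinuousMap.zero_apply,
        hcon, ContinuousMap.const_apply]
      rw [hNr, mul_comm, mul_smul, integrateCurve_rescale]
      have := solves l p hl hp ⟨s * t, mul_nonneg s.2.1 t.2.1, mul_le_one₀ s.2.2 t.2.1 t.2.2⟩
      simp only [rescaleCurve, ContinuousMap.coe_mk]
      rw [this]; abel
  let Φ : ℝ × X → X := fun z ↦ a z 1
  have hΦ : AnalyticAt ℝ Φ (0, p₀) :=
    AnalyticAt.fun_comp ((ContinuousMap.evalCLM ℝ (1 : 𝕀)).analyticAt _) haa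
  have hm : 0 < min ε δ := lt_min hε hδ
  have hnear : ∀ᶠ z in 𝓝 ((0 : ℝ), p₀), |z.1| < min ε δ / 2 ∧ dist z.2 p₀ < min ε δ := by
    have h1 : ∀ᶠ t in 𝓝 (0 : ℝ), |t| < min ε δ / 2 :=
      (continuous_abs.tendsto' 0 0 abs_zero).eventually (gt_mem_nhds (half_pos hm))
    have h2 : ∀ᶠ p in 𝓝 p₀, dist p p₀ < min ε δ := Metric.ball_mem_nhds _ hm
    rw [nhds_prod_eq]
    exact h1.prod_mk h2
  have hΦ0 : ∀ p, dist p p₀ < min ε δ → Φ (0, p) = p := by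
    intro p hp
    have := solves 0 p (by simpa using hm) hp 1
    simpa using this
  refine ⟨Φ, hΦ, Filter.mem_of_superset (Metric.ball_mem_nhds p₀ hm) fun p hp ↦ hΦ0 p hp, ?_⟩
  have hΦe := hΦ.eventually_analyticAt
  have hVe : ∀ᶠ z in 𝓝 ((0 : ℝ), p₀), AnalyticAt ℝ V (Φ z) := by
    have h : Φ (0, p₀) = p₀ := hΦ0 _ (by simpa using hm)
    refine hΦ.continuousAt.eventually (p := fun x ↦ AnalyticAt ℝ V x) ?_
    rw [h]; exact hV.eventually_analyticAt
  -- The solution with parameter 2 l passes through time l at its midpoint 1/2, which is interior to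
  -- the unit interval; with parameter l it would be the endpoint, giving only a one-sided
  -- derivative. This is why |l| is bounded by half the radius.
  have hne : ∀ l p, |l| < min ε δ / 2 → dist p p₀ < min ε δ → l ≠ 0 →
      HasDerivAt (fun t ↦ Φ (t, p)) (V (Φ (l, p))) l := by
    intro l p hl hp hl0
    have h2l : |2 * l| < min ε δ := by
      rw [abs_mul, abs_two]; linarith
    let half : 𝕀 := ⟨1 / 2, by norm_num, by norm_num⟩
    have hd := (hasDerivAt_integrateCurve (N (a (2 * l, p))) half)
    have hd2 : HasDerivAt (fun t : ℝ ↦ t / (2 * l)) (1 / (2 * l)) l :=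
      (hasDerivAt_id l).div_const _
    have hhalf : l / (2 * l) = (half : ℝ) := by
      simp only [half]; field_simp
    rw [← hhalf] at hd
    have hd3 := ((hd.scomp l hd2).const_smul (2 * l)).const_add p
    have hval : (2 * l) • (1 / (2 * l)) • (N (a (2 * l, p))) half = V (Φ (l, p)) := by
      rw [smul_smul, mul_one_div_cancel (by simpa using hl0), one_smul,
        (key2 (2 * l) p _ h2l hp (key _ p h2l hp).2).2, ← scale (2 * l) p half h2l hp]
      simp [Φ, half]
    rw [hval] at hd3
    refine hd3.congr_of_eventuallyEq ?_
    have hq : Tendsto (fun t : ℝ ↦ t / (2 * l)) (𝓝 l) (𝓝 (1 / 2)) := by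
      have := hd2.continuousAt.tendsto
      rwa [hhalf] at this
    have : ∀ᶠ t : ℝ in 𝓝 l, t / (2 * l) ∈ 𝕀 := hq.eventually (Icc_mem_nhds (by norm_num) (by norm_num))
    filter_upwards [this] with t ht
    have h1 := scale (2 * l) p ⟨_, ht⟩ h2l hp
    have h2 := solves (2 * l) p h2l hp ⟨_, ht⟩
    have h3 : t / (2 * l) * (2 * l) = t := div_mul_cancel₀ _ (by simpa using hl0)
    simp only [h3] at h1
    simp only [Φ, h1, h2]
    rfl
  filter_upwards [hnear, hΦe, hVe] with z hz hz1 hz2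
  obtain ⟨l, p⟩ := z
  -- At l = 0 the derivative is found by continuity: Φ is analytic in time, and its derivative
  -- agrees with the vector field at nonzero times.
  by_cases hl0 : l = 0
  · subst hl0
    have hc : ContinuousAt (fun t : ℝ ↦ Φ (t, p)) 0 :=
      ContinuousAt.comp (f := fun t : ℝ ↦ (t, p)) (g := Φ) hz1.continuousAt (by fun_prop)
    have hφ : AnalyticAt ℝ (fun t : ℝ ↦ Φ (t, p)) 0 :=
      AnalyticAt.fun_comp (g := Φ) (f := fun t : ℝ ↦ (t, p)) hz1 (by fun_prop)
    have hVc : ContinuousAt (fun t : ℝ ↦ V (Φ (t, p))) 0 :=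
      ContinuousAt.comp (f := fun t : ℝ ↦ Φ (t, p)) (g := V) hz2.continuousAt hc
    have heq : (fun t : ℝ ↦ V (Φ (t, p))) =ᶠ[𝓝[≠] 0] deriv fun t : ℝ ↦ Φ (t, p) := by
      have h1 : ∀ᶠ t in 𝓝 (0 : ℝ), |t| < min ε δ / 2 :=
        (continuous_abs.tendsto' 0 0 abs_zero).eventually (gt_mem_nhds (half_pos hm))
      filter_upwards [nhdsWithin_le_nhds h1, self_mem_nhdsWithin] with t ht ht0
      exact (hne t p ht hz.2 ht0).deriv.symm
    have := tendsto_nhds_unique (hVc.tendsto.mono_left nhdsWithin_le_nhds)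
      ((hφ.deriv.continuousAt.tendsto.mono_left nhdsWithin_le_nhds).congr' heq.symm)
    change HasDerivAt _ (V (Φ (0, p))) 0
    rw [this]
    exact hφ.differentiableAt.hasDerivAt
  · exact hne l p hz.1 hz.2 hl0
end Flow

/-! ### Tensor calculus in coordinates and the defect of a linear map. -/

section Coordinates
variable {E : Type*} [NormedAddCommGroup E] [NormedSpace ℝ E] [CompleteSpace E]

/-- Obtained by reading analyticity as `ContDiffAt` of order ω, where evaluation of operator-valued
maps is available. -/
lemma _root_.AnalyticAt.clm_apply_of_complete {W F G : Type*} [NormedAddCommGroup W] [NormedSpace ℝ W]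
    [NormedAddCommGroup F] [NormedSpace ℝ F] [CompleteSpace F]
    [NormedAddCommGroup G] [NormedSpace ℝ G] [CompleteSpace G] {f : W → F →L[ℝ] G} {g : W → F} {w : W}
    (hf : AnalyticAt ℝ f w) (hg : AnalyticAt ℝ g w) : AnalyticAt ℝ (fun y ↦ f y (g y)) w :=
  ((hf.contDiffAt (n := ω)).clm_apply (hg.contDiffAt (n := ω))).analyticAt

/-- The equation of an affine map in coordinates, for the Christoffel symbols `G` on the source
and `G'` on the target. -/
def AffineEq (G G' : E → E →L[ℝ] E →L[ℝ] E) (f : E → E) (x : E) : Prop :=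
  ∀ u v, fderiv ℝ (fderiv ℝ f) x u v + G' (f x) (fderiv ℝ f x u) (fderiv ℝ f x v)
    = fderiv ℝ f x (G x u v)

/-- Covariant derivative of a tensor field in coordinates. -/
def coordCovDeriv (G : E → E →L[ℝ] E →L[ℝ] E) {k : ℕ} (τ : E × (Fin k → E) → E) :
    E × (Fin (k + 1) → E) → E := fun p ↦
  fderiv ℝ τ (p.1, Fin.tail p.2) (p.2 0, fun i ↦ -G p.1 (p.2 0) (Fin.tail p.2 i))
    + G p.1 (p.2 0) (τ (p.1, Fin.tail p.2))

/-- Iterated covariant derivative of a tensor field in coordinates. -/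
def iterCoordCovDeriv (G : E → E →L[ℝ] E →L[ℝ] E) {k : ℕ} (τ : E × (Fin k → E) → E) :
    (r : ℕ) → E × (Fin (k + r) → E) → E
  | 0 => τ
  | r + 1 => coordCovDeriv G (iterCoordCovDeriv G τ r)

/-- The torsion tensor in coordinates. -/
def coordTorsion (G : E → E →L[ℝ] E →L[ℝ] E) : E × (Fin 2 → E) → E := fun p ↦
  G p.1 (p.2 0) (p.2 1) - G p.1 (p.2 1) (p.2 0)

/-- The curvature tensor in coordinates. -/
def coordCurvature (G : E → E →L[ℝ] E →L[ℝ] E) : E × (Fin 3 → E) → E := fun p ↦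
  fderiv ℝ G p.1 (p.2 0) (p.2 1) (p.2 2) - fderiv ℝ G p.1 (p.2 1) (p.2 0) (p.2 2)
    + G p.1 (p.2 0) (G p.1 (p.2 1) (p.2 2)) - G p.1 (p.2 1) (G p.1 (p.2 0) (p.2 2))

/-- `A` is parallel along the pair of curves `x`, `F`, and `F' = A x'`. -/
structure HorizontalAt (G G' : E → E →L[ℝ] E →L[ℝ] E) (x F : ℝ → E) (A : ℝ → E →L[ℝ] E) (v : E)
    (t : ℝ) : Prop where
  hx : HasDerivAt x v t
  hF : HasDerivAt F (A t v) t
  hA : HasDerivAt A ((A t) ∘L (G (x t) v) - (G' (F t) (A t v)) ∘L (A t)) t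

/-- The failure of `A` to intertwine the tensor fields `τ` and `τ'`. -/
def defect {k : ℕ} (τ τ' : E × (Fin k → E) → E) (x F : E) (A : E →L[ℝ] E) (u : Fin k → E) : E :=
  A (τ (x, u)) - τ' (F, fun i ↦ A (u i))

/-- The covariant derivative of τ is its derivative along the lift that moves the arguments
parallelly. Writing u' as its parallel part plus u' + G v u splits the derivative into the defect of
the covariant derivatives, a connection term acting on the defect itself, and a correction from the
non-parallel part of u. Every term is again a defect once the fibre derivatives are expanded by
multilinearity, which permits induction on the order of vanishing. -/
lemma HorizontalAt.hasDerivAt_defect {G G' : E → E →L[ℝ] E →L[ℝ] E} {x F : ℝ → E}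
    {A : ℝ → E →L[ℝ] E} {v : E} {t : ℝ} (h : HorizontalAt G G' x F A v t) {k : ℕ}
    {τ τ' : E × (Fin k → E) → E} {u : ℝ → Fin k → E} {u' : Fin k → E} (hu : HasDerivAt u u' t)
    (hτ : DifferentiableAt ℝ τ (x t, u t)) (hτ' : DifferentiableAt ℝ τ' (F t, fun i ↦ A t (u t i))) :
    HasDerivAt (fun s ↦ defect τ τ' (x s) (F s) (A s) (u s))
      (defect (coordCovDeriv G τ) (coordCovDeriv G' τ') (x t) (F t) (A t)
          (Fin.cons v (u t) : Fin (k + 1) → E)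
        - G' (F t) (A t v) (defect τ τ' (x t) (F t) (A t) (u t))
        + (A t (fderiv ℝ τ (x t, u t) (0, fun i ↦ u' i + G (x t) v (u t i)))
          - fderiv ℝ τ' (F t, fun i ↦ A t (u t i))
              (0, fun i ↦ A t (u' i + G (x t) v (u t i))))) t := by
  have h1 : HasDerivAt (fun s ↦ τ (x s, u s)) (fderiv ℝ τ (x t, u t) (v, u')) t :=
    hτ.hasFDerivAt.comp_hasDerivAt_of_eq t (h.hx.prodMk hu) rfl
  have h2 := h.hA.clm_apply h1
  have hAu : HasDerivAt (fun s ↦ fun i ↦ A s (u s i)) (fun i ↦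
      ((A t) ∘L (G (x t) v) - (G' (F t) (A t v)) ∘L (A t)) (u t i) + A t (u' i)) t :=
    hasDerivAt_pi.2 fun i ↦ h.hA.clm_apply (hasDerivAt_pi.1 hu i)
  have h3 := hτ'.hasFDerivAt.comp_hasDerivAt_of_eq t (h.hF.prodMk hAu) rfl
  refine (h2.sub h3).congr_deriv ?_
  have e1 : ((v, u') : E × (Fin k → E)) = (v, fun i ↦ -G (x t) v (u t i))
      + (0, fun i ↦ u' i + G (x t) v (u t i)) := by
    ext <;> simp
  have e2 : ((A t v, fun i ↦
      ((A t) ∘L (G (x t) v) - (G' (F t) (A t v)) ∘L (A t)) (u t i) + A t (u' i)) : E × (Fin k → E))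
      = (A t v, fun i ↦ -G' (F t) (A t v) (A t (u t i)))
      + (0, fun i ↦ A t (u' i + G (x t) v (u t i))) := by
    ext
    · simp
    · simp; abel
  rw [e1, e2, map_add, map_add]
  have e3 : (Fin.tail fun i ↦ A t ((Fin.cons v (u t) : Fin (k + 1) → E) i))
      = fun i ↦ A t (u t i) := rfl
  simp only [defect, coordCovDeriv, e3, Fin.cons_zero, Fin.tail_cons, map_add, map_sub,
    sub_apply, ContinuousLinearMap.comp_apply]
  abel

/-- Real-analytic tensor fields on `Ω`, in coordinates. -/
structure IsTensorOn {k : ℕ} (τ : E × (Fin k → E) → E) (Ω : Set E) : Prop where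
  analytic : AnalyticOnNhd ℝ τ (Ω ×ˢ univ)
  map_lin : ∀ x ∈ Ω, ∀ (u : Fin k → E) (i : Fin k) (c : ℝ) (a b : E),
    τ (x, Function.update u i (c • a + b))
      = c • τ (x, Function.update u i a) + τ (x, Function.update u i b)

namespace IsTensorOn

variable {k : ℕ} {τ : E × (Fin k → E) → E} {Ω : Set E}

/-- The value of a tensor field at a point, as a multilinear map. -/
def toMultilinear (h : IsTensorOn τ Ω) {x : E} (hx : x ∈ Ω) :
    ContinuousMultilinearMap ℝ (fun _ : Fin k ↦ E) E where
  toFun u := τ (x, u)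
  map_update_add' := by
    intro inst u i a b
    rw [Subsingleton.elim inst (instDecidableEqFin k)]
    simpa using h.map_lin x hx u i 1 a b
  map_update_smul' := by
    intro inst u i a b
    rw [Subsingleton.elim inst (instDecidableEqFin k)]
    have h0 := h.map_lin x hx u i 1 0 0
    simp only [smul_zero, add_zero, one_smul, right_eq_add] at h0
    simpa [h0] using h.map_lin x hx u i a b 0
  cont := continuous_iff_continuousAt.2 fun u ↦
    ContinuousAt.comp (g := τ) (f := fun u ↦ (x, u)) (h.analytic (x, u) ⟨hx, mem_univ _⟩).continuousAt
      (by fun_prop)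

/-- Along the fibre τ is multilinear, so its derivative is the sum over the slots. -/
lemma fderiv_apply_zero (h : IsTensorOn τ Ω) {x : E} (hx : x ∈ Ω) (u w : Fin k → E) :
    fderiv ℝ τ (x, u) (0, w) = ∑ i, τ (x, Function.update u i (w i)) := by
  have h1 : HasFDerivAt (fun u ↦ τ (x, u)) _ u :=
    (h.analytic (x, u) ⟨hx, mem_univ _⟩).differentiableAt.hasFDerivAt.comp u
      (hasFDerivAt_prodMk_right x u)
  have h2 := (h.toMultilinear hx).hasFDerivAt u
  have h3 := DFunLike.congr_fun (h1.unique h2) w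
  rw [ContinuousMultilinearMap.linearDeriv_apply] at h3
  exact h3

/-- The source of the parity distinction between torsion and curvature. -/
lemma map_neg (h : IsTensorOn τ Ω) {x : E} (hx : x ∈ Ω) (u : Fin k → E) :
    τ (x, fun i ↦ - u i) = (-1 : ℝ) ^ k • τ (x, u) := by
  have := (h.toMultilinear hx).map_smul_univ (fun _ ↦ (-1 : ℝ)) u
  simp only [neg_smul, one_smul, Finset.prod_const, Finset.card_univ, Fintype.card_fin] at this
  exact this

lemma covDeriv {G : E → E →L[ℝ] E →L[ℝ] E} (hΩ : IsOpen Ω) (hG : AnalyticOnNhd ℝ G Ω)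
    (h : IsTensorOn τ Ω) : IsTensorOn (coordCovDeriv G τ) Ω := by
  have hsp : ∀ x ∈ Ω, ∀ (v : E) (u w : Fin k → E), fderiv ℝ τ (x, u) (v, w)
      = fderiv ℝ τ (x, u) (v, 0) + ∑ i, τ (x, Function.update u i (w i)) := by
    intro x hx v u w
    rw [← h.fderiv_apply_zero hx, ← _root_.map_add]
    simp
  have hformula : ∀ x ∈ Ω, ∀ (u : Fin (k + 1) → E), coordCovDeriv G τ (x, u) =
      fderiv ℝ τ (x, Fin.tail u) (u 0, 0)
      + (∑ i, τ (x, Function.update (Fin.tail u) i (-G x (u 0) (Fin.tail u i)))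
      + G x (u 0) (τ (x, Fin.tail u))) := by
    intro x hx u
    simp only [coordCovDeriv]
    rw [hsp x hx, add_assoc]
  -- Linearity in the slots passes to the base derivative by differentiating the multilinearity
  -- identity along a line in the base with the arguments frozen.
  have hdir : ∀ x ∈ Ω, ∀ (v : E) (u : Fin k → E),
      HasDerivAt (fun t : ℝ ↦ τ (x + t • v, u)) (fderiv ℝ τ (x, u) (v, 0)) 0 := by
    intro x hx v u
    have h1 : HasDerivAt (fun t : ℝ ↦ (x + t • v, u)) (v, 0) (0 : ℝ) := by
      refine HasDerivAt.prodMk ?_ (hasDerivAt_const _ _)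
      simpa using ((hasDerivAt_id (0 : ℝ)).smul_const v).const_add x
    exact (h.analytic (x, u) ⟨hx, mem_univ _⟩).differentiableAt.hasFDerivAt.comp_hasDerivAt_of_eq
      0 h1 (by simp)
  have hnear : ∀ x ∈ Ω, ∀ v : E, ∀ᶠ t : ℝ in 𝓝 0, x + t • v ∈ Ω := by
    intro x hx v
    have : ContinuousAt (fun t : ℝ ↦ x + t • v) 0 := by fun_prop
    exact this.eventually (p := fun y ↦ y ∈ Ω) (by simpa using hΩ.mem_nhds hx)
  have hfd : ∀ x ∈ Ω, ∀ (v : E) (u : Fin k → E) (j : Fin k) (c : ℝ) (a b : E),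
      fderiv ℝ τ (x, Function.update u j (c • a + b)) (v, 0)
        = c • fderiv ℝ τ (x, Function.update u j a) (v, 0)
          + fderiv ℝ τ (x, Function.update u j b) (v, 0) := by
    intro x hx v u j c a b
    refine (hdir x hx v _).unique ((((hdir x hx v _).const_smul c).add
      (hdir x hx v _)).congr_of_eventuallyEq ?_)
    filter_upwards [hnear x hx v] with t ht
    exact h.map_lin _ ht u j c a b
  have hsum : ∀ x ∈ Ω, ∀ (B : E →L[ℝ] E) (u : Fin k → E) (j : Fin k) (c : ℝ) (a b : E) (i : Fin k),
      τ (x, Function.update (Function.update u j (c • a + b)) i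
          (B (Function.update u j (c • a + b) i)))
        = c • τ (x, Function.update (Function.update u j a) i (B (Function.update u j a i)))
          + τ (x, Function.update (Function.update u j b) i (B (Function.update u j b i))) := by
    intro x hx B u j c a b i
    by_cases hij : i = j
    · subst hij
      simp only [Function.update_self, Function.update_idem, _root_.map_add, map_smul]
      exact h.map_lin x hx u i c _ _
    · simp only [Function.update_of_ne hij]
      rw [Function.update_comm (Ne.symm hij), Function.update_comm (Ne.symm hij),
        Function.update_comm (Ne.symm hij)]
      exact h.map_lin x hx _ j c a b
  refine ⟨?_, ?_⟩
  · rintro ⟨x, u⟩ ⟨hx, -⟩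
    let T : (Fin (k + 1) → E) →L[ℝ] (Fin k → E) :=
      ContinuousLinearMap.pi fun i ↦ ContinuousLinearMap.proj i.succ
    have hT : ∀ u : Fin (k + 1) → E, T u = Fin.tail u := fun u ↦ rfl
    have hp1 : AnalyticAt ℝ (fun p : E × (Fin (k + 1) → E) ↦ p.1) (x, u) := analyticAt_fst
    have hp2 : AnalyticAt ℝ (fun p : E × (Fin (k + 1) → E) ↦ Fin.tail p.2) (x, u) :=
      AnalyticAt.fun_comp (T.analyticAt u) analyticAt_snd
    have hp3 : ∀ i, AnalyticAt ℝ (fun p : E × (Fin (k + 1) → E) ↦ p.2 i) (x, u) := fun i ↦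
      ((ContinuousLinearMap.proj (R := ℝ) (φ := fun _ : Fin (k + 1) ↦ E) i).comp
        (.snd ℝ E (Fin (k + 1) → E))).analyticAt (x, u)
    have htail := hp1.prod hp2
    have hmem : ((x, Fin.tail u) : E × (Fin k → E)) ∈ Ω ×ˢ univ := ⟨hx, mem_univ _⟩
    have hG1 : AnalyticAt ℝ (fun p : E × (Fin (k + 1) → E) ↦ G p.1 (p.2 0)) (x, u) :=
      (AnalyticAt.fun_comp (g := G) (hG x hx) hp1).clm_apply_of_complete (hp3 0)
    have h1 : AnalyticAt ℝ (fun p : E × (Fin (k + 1) → E) ↦ fderiv ℝ τ (p.1, Fin.tail p.2)) (x, u) :=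
      AnalyticAt.fun_comp (g := fderiv ℝ τ) (h.analytic _ hmem).fderiv htail
    have h2 : AnalyticAt ℝ (fun p : E × (Fin (k + 1) → E) ↦ τ (p.1, Fin.tail p.2)) (x, u) :=
      AnalyticAt.fun_comp (g := τ) (h.analytic _ hmem) htail
    have h3 : AnalyticAt ℝ (fun p : E × (Fin (k + 1) → E) ↦
        ((p.2 0, fun i ↦ -G p.1 (p.2 0) (Fin.tail p.2 i)) : E × (Fin k → E))) (x, u) := by
      refine (hp3 0).prod ?_
      refine AnalyticAt.pi fun i ↦ ?_
      exact (hG1.clm_apply_of_complete (hp3 i.succ)).neg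
    exact (h1.clm_apply_of_complete h3).add (hG1.clm_apply_of_complete h2)
  · intro x hx u i c a b
    rw [hformula x hx, hformula x hx, hformula x hx]
    refine Fin.cases ?_ (fun j ↦ ?_) i
    · simp only [Fin.tail_update_zero, Function.update_self]
      have e1 : fderiv ℝ τ (x, Fin.tail u) (c • a + b, 0) = c • fderiv ℝ τ (x, Fin.tail u) (a, 0)
          + fderiv ℝ τ (x, Fin.tail u) (b, 0) := by
        rw [← map_smul, ← _root_.map_add]; simp
      have e2 : ∀ i, τ (x, Function.update (Fin.tail u) i (-G x (c • a + b) (Fin.tail u i)))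
          = c • τ (x, Function.update (Fin.tail u) i (-G x a (Fin.tail u i)))
            + τ (x, Function.update (Fin.tail u) i (-G x b (Fin.tail u i))) := by
        intro i
        rw [← h.map_lin x hx]
        congr 3
        simp only [_root_.map_add, map_smul, add_apply, smul_apply, neg_add, smul_neg]
      rw [Finset.sum_congr rfl fun i _ ↦ e2 i]
      simp only [e1, Finset.sum_add_distrib, ← Finset.smul_sum, _root_.map_add, map_smul,
        add_apply, smul_apply, smul_add]
      abel
    · have e0 : ∀ d : E, (Function.update u j.succ d) 0 = u 0 := fun d ↦ by
        rw [Function.update_of_ne (Fin.succ_ne_zero j).symm]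
      simp only [Fin.tail_update_succ, e0]
      have e2 := hsum x hx (-G x (u 0)) (Fin.tail u) j c a b
      simp only [neg_apply] at e2
      rw [hfd x hx, Finset.sum_congr rfl fun i _ ↦ e2 i, h.map_lin x hx]
      simp only [Finset.sum_add_distrib, ← Finset.smul_sum, _root_.map_add, map_smul, smul_add]
      abel

lemma iterCovDeriv {G : E → E →L[ℝ] E →L[ℝ] E} (hΩ : IsOpen Ω) (hG : AnalyticOnNhd ℝ G Ω)
    (h : IsTensorOn τ Ω) (r : ℕ) : IsTensorOn (iterCoordCovDeriv G τ r) Ω := by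
  induction r with
  | zero => exact h
  | succ r ih => exact ih.covDeriv hΩ hG

end IsTensorOn

lemma isTensorOn_coordTorsion {G : E → E →L[ℝ] E →L[ℝ] E} {Ω : Set E} (hG : AnalyticOnNhd ℝ G Ω) :
    IsTensorOn (coordTorsion G) Ω := by
  refine ⟨?_, ?_⟩
  · rintro ⟨x, u⟩ ⟨hx, -⟩
    have hp1 : AnalyticAt ℝ (fun p : E × (Fin 2 → E) ↦ G p.1) (x, u) :=
      AnalyticAt.fun_comp (g := G) (hG x hx) analyticAt_fst
    have hp3 : ∀ i, AnalyticAt ℝ (fun p : E × (Fin 2 → E) ↦ p.2 i) (x, u) := fun i ↦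
      ((ContinuousLinearMap.proj (R := ℝ) (φ := fun _ : Fin 2 ↦ E) i).comp
        (.snd ℝ E (Fin 2 → E))).analyticAt (x, u)
    exact ((hp1.clm_apply_of_complete (hp3 0)).clm_apply_of_complete (hp3 1)).sub
      ((hp1.clm_apply_of_complete (hp3 1)).clm_apply_of_complete (hp3 0))
  · intro x hx u i c a b
    fin_cases i
    · simp [coordTorsion, smul_sub]; abel
    · simp [coordTorsion, smul_sub]; abel

lemma isTensorOn_coordCurvature {G : E → E →L[ℝ] E →L[ℝ] E} {Ω : Set E} (hG : AnalyticOnNhd ℝ G Ω) :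
    IsTensorOn (coordCurvature G) Ω := by
  refine ⟨?_, ?_⟩
  · rintro ⟨x, u⟩ ⟨hx, -⟩
    have hp1 : AnalyticAt ℝ (fun p : E × (Fin 3 → E) ↦ G p.1) (x, u) :=
      AnalyticAt.fun_comp (g := G) (hG x hx) analyticAt_fst
    have hp2 : AnalyticAt ℝ (fun p : E × (Fin 3 → E) ↦ fderiv ℝ G p.1) (x, u) :=
      AnalyticAt.fun_comp (g := fderiv ℝ G) (hG x hx).fderiv analyticAt_fst
    have hp3 : ∀ i, AnalyticAt ℝ (fun p : E × (Fin 3 → E) ↦ p.2 i) (x, u) := fun i ↦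
      ((ContinuousLinearMap.proj (R := ℝ) (φ := fun _ : Fin 3 ↦ E) i).comp
        (.snd ℝ E (Fin 3 → E))).analyticAt (x, u)
    have hG2 : ∀ i j k, AnalyticAt ℝ
        (fun p : E × (Fin 3 → E) ↦ G p.1 (p.2 i) (G p.1 (p.2 j) (p.2 k))) (x, u) := fun i j k ↦
      (hp1.clm_apply_of_complete (hp3 i)).clm_apply_of_complete
        ((hp1.clm_apply_of_complete (hp3 j)).clm_apply_of_complete (hp3 k))
    have hD : ∀ i j k, AnalyticAt ℝ
        (fun p : E × (Fin 3 → E) ↦ fderiv ℝ G p.1 (p.2 i) (p.2 j) (p.2 k)) (x, u) := fun i j k ↦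
      ((hp2.clm_apply_of_complete (hp3 i)).clm_apply_of_complete (hp3 j)).clm_apply_of_complete (hp3 k)
    exact (((hD 0 1 2).sub (hD 1 0 2)).add (hG2 0 1 2)).sub (hG2 1 0 2)
  · intro x hx u i c a b
    fin_cases i
    · simp [coordCurvature, smul_sub]; abel
    · simp [coordCurvature, smul_sub]; abel
    · simp [coordCurvature, smul_sub]; abel
end Coordinates

/-! ### Vanishing to infinite order along horizontal curves. -/

section Vanishing
variable {E : Type*} [NormedAddCommGroup E] [NormedSpace ℝ E]

/-- The mean value inequality on the segment from 0 to t gains one power. -/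
lemma isBigO_pow_succ_of_hasDerivAt {φ φ' : ℝ → E} {n : ℕ}
    (hd : ∀ᶠ t in 𝓝 (0 : ℝ), HasDerivAt φ (φ' t) t) (h0 : φ 0 = 0)
    (hO : φ' =O[𝓝 0] fun t ↦ t ^ n) : φ =O[𝓝 0] fun t ↦ t ^ (n + 1) := by
  obtain ⟨C, hC⟩ := hO.bound
  obtain ⟨ε, hε, hball⟩ := Metric.eventually_nhds_iff.1 (hd.and hC)
  refine IsBigO.of_bound C ?_
  filter_upwards [Metric.ball_mem_nhds (0 : ℝ) hε] with t ht
  have hmem : ∀ s ∈ uIcc 0 t, |s| ≤ |t| := by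
    intro s hs
    have := abs_sub_left_of_mem_uIcc hs
    simpa using this
  have ht' : |t| < ε := by simpa using ht
  have hd' : ∀ s ∈ uIcc 0 t, HasDerivWithinAt φ (φ' s) (uIcc 0 t) s := fun s hs ↦
    (hball (by simpa using (hmem s hs).trans_lt ht')).1.hasDerivWithinAt
  have hb : ∀ s ∈ uIcc 0 t, ‖φ' s‖ ≤ C * |t| ^ n := by
    intro s hs
    have h1 := (hball (y := s) (by simpa using (hmem s hs).trans_lt ht')).2
    rw [norm_pow, Real.norm_eq_abs] at h1
    by_cases hC0 : 0 ≤ C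
    · exact h1.trans (mul_le_mul_of_nonneg_left (pow_le_pow_left₀ (abs_nonneg _) (hmem s hs) n) hC0)
    -- The bounding constant may be negative; the estimate then forces s = 0 and n ≠ 0, where the
    -- derivative vanishes.
    · have h2 : 0 ≤ C * |s| ^ n := (norm_nonneg _).trans h1
      have h3 : |s| ^ n = 0 := by
        by_contra h
        have : 0 < |s| ^ n := lt_of_le_of_ne (by positivity) (Ne.symm h)
        nlinarith
      have hn : n ≠ 0 := by rintro rfl; simp at h3
      have hs0 : s = 0 := by simpa [hn] using h3
      have h4 := (hball (y := t) (by simpa using ht')).2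
      rw [norm_pow, Real.norm_eq_abs] at h4
      rw [h3, mul_zero] at h1
      exact h1.trans ((norm_nonneg _).trans h4)
  have := (convex_uIcc 0 t).norm_image_sub_le_of_norm_hasDerivWithin_le hd' hb
    left_mem_uIcc right_mem_uIcc
  rw [h0, sub_zero, sub_zero] at this
  rw [norm_pow, pow_succ, Real.norm_eq_abs, ← mul_assoc]
  simpa using this

/-- A nonzero analytic germ is t ^ n times a germ not vanishing at 0, which contradicts the bound of
order n + 1. -/
lemma eventually_eq_zero_of_isBigO_pow {φ : ℝ → E} (hφ : AnalyticAt ℝ φ 0)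
    (hO : ∀ n : ℕ, φ =O[𝓝 0] fun t ↦ t ^ n) : ∀ᶠ t in 𝓝 0, φ t = 0 := by
  by_contra hne
  obtain ⟨n, g, hg, hg0, hgφ⟩ := hφ.exists_eventuallyEq_pow_smul_nonzero_iff.2 hne
  obtain ⟨C, hC⟩ := (hO (n + 1)).bound
  refine hg0 ?_
  have h1 : ∀ᶠ t in 𝓝[≠] (0 : ℝ), ‖g t‖ ≤ C * ‖t‖ := by
    filter_upwards [nhdsWithin_le_nhds hC, nhdsWithin_le_nhds hgφ, self_mem_nhdsWithin]
      with t h1 h2 h3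
    rw [h2, sub_zero, norm_smul, pow_succ, norm_mul, norm_pow] at h1
    have : 0 < ‖t‖ ^ n := pow_pos (norm_pos_iff.2 h3) n
    refine le_of_mul_le_mul_left ?_ this
    linarith
  have h2 : Tendsto g (𝓝[≠] 0) (𝓝 (g 0)) := hg.continuousAt.tendsto.mono_left nhdsWithin_le_nhds
  have h3 : Tendsto g (𝓝[≠] (0 : ℝ)) (𝓝 0) := by
    refine squeeze_zero_norm' h1 ?_
    have : Tendsto (fun t : ℝ ↦ C * ‖t‖) (𝓝 0) (𝓝 0) :=
      Continuous.tendsto' (by fun_prop) _ _ (by simp)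
    exact this.mono_left nhdsWithin_le_nhds
  exact tendsto_nhds_unique h2 h3

variable [CompleteSpace E]

lemma AnalyticAt.defect {k : ℕ} {τ τ' : E × (Fin k → E) → E} {x F : ℝ → E} {A : ℝ → E →L[ℝ] E}
    {u : ℝ → Fin k → E} {t : ℝ} (hx : AnalyticAt ℝ x t) (hF : AnalyticAt ℝ F t)
    (hA : AnalyticAt ℝ A t) (hu : AnalyticAt ℝ u t) (hτ : AnalyticAt ℝ τ (x t, u t))
    (hτ' : AnalyticAt ℝ τ' (F t, fun i ↦ A t (u t i))) :
    AnalyticAt ℝ (fun s ↦ defect τ τ' (x s) (F s) (A s) (u s)) t := by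
  have hui : ∀ i, AnalyticAt ℝ (fun s ↦ u s i) t := fun i ↦
    AnalyticAt.fun_comp ((ContinuousLinearMap.proj (R := ℝ) (φ := fun _ : Fin k ↦ E) i).analyticAt _) hu
  refine AnalyticAt.sub ?_ ?_
  · exact hA.clm_apply_of_complete (AnalyticAt.fun_comp hτ (hx.prod hu))
  · exact AnalyticAt.fun_comp (f := fun s ↦ (F s, fun i ↦ A s (u s i))) hτ'
      (hF.prod (AnalyticAt.pi fun i ↦ hA.clm_apply_of_complete (hui i)))

/-- If `A` intertwines all iterated covariant derivatives of `τ` and `τ'` at time `0`, then along a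
horizontal analytic curve its defect vanishes to all orders. -/
lemma isBigO_defect {G G' : E → E →L[ℝ] E →L[ℝ] E} {Ω Ω' : Set E} (hΩ : IsOpen Ω)
    (hΩ' : IsOpen Ω') (hG : AnalyticOnNhd ℝ G Ω) (hG' : AnalyticOnNhd ℝ G' Ω')
    {x F : ℝ → E} {A : ℝ → E →L[ℝ] E} {v : E} (hx : AnalyticAt ℝ x 0) (hF : AnalyticAt ℝ F 0)
    (hA : AnalyticAt ℝ A 0) (hxΩ : x 0 ∈ Ω) (hFΩ : F 0 ∈ Ω')
    (hor : ∀ᶠ t in 𝓝 (0 : ℝ), HorizontalAt G G' x F A v t) {k : ℕ}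
    {τ τ' : E × (Fin k → E) → E} (hτ : IsTensorOn τ Ω) (hτ' : IsTensorOn τ' Ω')
    (h0 : ∀ r u, defect (iterCoordCovDeriv G τ r) (iterCoordCovDeriv G' τ' r) (x 0) (F 0) (A 0) u = 0)
    (n : ℕ) : ∀ (r : ℕ) (u : ℝ → Fin (k + r) → E), AnalyticAt ℝ u 0 →
      (fun t ↦ defect (iterCoordCovDeriv G τ r) (iterCoordCovDeriv G' τ' r)
        (x t) (F t) (A t) (u t)) =O[𝓝 0] fun t ↦ t ^ n := by
  -- The order n grows while the number r of covariant derivatives and the arguments u stay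
  -- arbitrary: the step for (n + 1, r) uses order n for r + 1 and for r with altered arguments.
  induction n with
  | zero =>
    intro r u hu
    simp only [pow_zero]
    have h := AnalyticAt.defect hx hF hA hu ((hτ.iterCovDeriv hΩ hG r).analytic (x 0, u 0) ⟨hxΩ, mem_univ _⟩)
      ((hτ'.iterCovDeriv hΩ' hG' r).analytic (F 0, fun i ↦ A 0 (u 0 i)) ⟨hFΩ, mem_univ _⟩)
    exact h.continuousAt.isBigO_one ℝ
  | succ n ih =>
    intro r u hu
    have hT := hτ.iterCovDeriv hΩ hG r
    have hT' := hτ'.iterCovDeriv hΩ' hG' r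
    have hxe : ∀ᶠ t in 𝓝 (0 : ℝ), x t ∈ Ω := hx.continuousAt.eventually (hΩ.mem_nhds hxΩ)
    have hFe : ∀ᶠ t in 𝓝 (0 : ℝ), F t ∈ Ω' := hF.continuousAt.eventually (hΩ'.mem_nhds hFΩ)
    have hd : ∀ᶠ t in 𝓝 (0 : ℝ), HasDerivAt u (deriv u t) t := by
      filter_upwards [hu.eventually_analyticAt] with t ht
      exact ht.differentiableAt.hasDerivAt
    -- The covariant derivative of the arguments along the curve, measuring how far they are from
    -- parallel.
    let w : ℝ → Fin (k + r) → E := fun t i ↦ deriv u t i + G (x t) v (u t i)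
    have hui : ∀ i, AnalyticAt ℝ (fun s ↦ u s i) 0 := fun i ↦
      AnalyticAt.fun_comp
        ((ContinuousLinearMap.proj (R := ℝ) (φ := fun _ : Fin (k + r) ↦ E) i).analyticAt _) hu
    have hwi : ∀ i, AnalyticAt ℝ (fun s ↦ w s i) 0 := fun i ↦ by
      have h1 : AnalyticAt ℝ (fun s ↦ deriv u s i) 0 :=
        AnalyticAt.fun_comp
        ((ContinuousLinearMap.proj (R := ℝ) (φ := fun _ : Fin (k + r) ↦ E) i).analyticAt _) hu.deriv
      have h2 : AnalyticAt ℝ (fun s ↦ G (x s)) 0 := AnalyticAt.fun_comp (hG _ hxΩ) hx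
      exact h1.add ((h2.clm_apply_of_complete analyticAt_const).clm_apply_of_complete (hui i))
    refine isBigO_pow_succ_of_hasDerivAt (φ' := fun t ↦
        defect (iterCoordCovDeriv G τ (r + 1)) (iterCoordCovDeriv G' τ' (r + 1)) (x t) (F t) (A t)
          (Fin.cons v (u t) : Fin (k + r + 1) → E)
        - G' (F t) (A t v) (defect (iterCoordCovDeriv G τ r) (iterCoordCovDeriv G' τ' r)
          (x t) (F t) (A t) (u t))
        + ∑ i, defect (iterCoordCovDeriv G τ r) (iterCoordCovDeriv G' τ' r)
          (x t) (F t) (A t) (Function.update (u t) i (w t i))) ?_ (h0 r _) ?_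
    · filter_upwards [hxe, hFe, hd, hor] with t h1 h2 h3 h4
      refine (h4.hasDerivAt_defect h3 (hT.analytic (x t, u t) ⟨h1, mem_univ _⟩).differentiableAt
        (hT'.analytic (F t, fun i ↦ A t (u t i)) ⟨h2, mem_univ _⟩).differentiableAt).congr_deriv ?_
      rw [hT.fderiv_apply_zero h1, hT'.fderiv_apply_zero h2, map_sum, ← Finset.sum_sub_distrib]
      congr 1
      refine Finset.sum_congr rfl fun i _ ↦ ?_
      simp only [defect]
      congr 3
      ext j
      by_cases hj : j = i
      · subst hj; simp [w]
      · simp [hj]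
    · refine IsBigO.add (IsBigO.sub ?_ ?_) (IsBigO.fun_sum fun i _ ↦ ?_)
      · refine ih (r + 1) (fun t ↦ (Fin.cons v (u t) : Fin (k + r + 1) → E)) ?_
        refine AnalyticAt.pi fun i ↦ ?_
        refine Fin.cases ?_ (fun j ↦ ?_) i
        · exact analyticAt_const
        · exact hui j
      · have hc : ContinuousAt (fun t ↦ G' (F t) (A t v)) 0 := by
          have h1 : ContinuousAt (fun t ↦ G' (F t)) 0 :=
            ContinuousAt.comp (g := G') (hG' _ hFΩ).continuousAt hF.continuousAt
          exact h1.clm_apply (hA.continuousAt.clm_apply continuousAt_const)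
        have h1 := hc.isBigO_one ℝ
        have h2 := ih r u hu
        refine (isBigO_of_le' (c := 1) _ fun t ↦ ?_ : _ =O[𝓝 0] fun t ↦ ‖G' (F t) (A t v)‖ *
          ‖defect (iterCoordCovDeriv G τ r) (iterCoordCovDeriv G' τ' r)
          (x t) (F t) (A t) (u t)‖).trans ?_
        · rw [one_mul, norm_mul, norm_norm, norm_norm]
          exact ContinuousLinearMap.le_opNorm _ _
        · simpa using h1.norm_left.mul h2.norm_left
      · refine ih r (fun t ↦ Function.update (u t) i (w t i)) ?_
        refine AnalyticAt.pi fun j ↦ ?_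
        by_cases hj : j = i
        · subst hj; simpa using hwi j
        · simpa [hj] using hui j

/-- A horizontal analytic curve along which the defects of all covariant derivatives vanish at one
point has vanishing defect. -/
lemma eventually_defect_eq_zero {G G' : E → E →L[ℝ] E →L[ℝ] E} {Ω Ω' : Set E} (hΩ : IsOpen Ω)
    (hΩ' : IsOpen Ω') (hG : AnalyticOnNhd ℝ G Ω) (hG' : AnalyticOnNhd ℝ G' Ω')
    {x F : ℝ → E} {A : ℝ → E →L[ℝ] E} {v : E} (hx : AnalyticAt ℝ x 0) (hF : AnalyticAt ℝ F 0)
    (hA : AnalyticAt ℝ A 0) (hxΩ : x 0 ∈ Ω) (hFΩ : F 0 ∈ Ω')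
    (hor : ∀ᶠ t in 𝓝 (0 : ℝ), HorizontalAt G G' x F A v t) {k : ℕ}
    {τ τ' : E × (Fin k → E) → E} (hτ : IsTensorOn τ Ω) (hτ' : IsTensorOn τ' Ω')
    (h0 : ∀ r u, defect (iterCoordCovDeriv G τ r) (iterCoordCovDeriv G' τ' r) (x 0) (F 0) (A 0) u = 0)
    (u : Fin k → E) : ∀ᶠ t in 𝓝 (0 : ℝ), defect τ τ' (x t) (F t) (A t) u = 0 := by
  refine eventually_eq_zero_of_isBigO_pow ?_ fun n ↦
    isBigO_defect hΩ hΩ' hG hG' hx hF hA hxΩ hFΩ hor hτ hτ' h0 n 0 (fun _ ↦ u) analyticAt_const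
  exact AnalyticAt.defect hx hF hA analyticAt_const (hτ.analytic (x 0, u) ⟨hxΩ, mem_univ _⟩)
    (hτ'.analytic (F 0, fun i ↦ A 0 (u i)) ⟨hFΩ, mem_univ _⟩)
end Vanishing

/-! ### Affine maps preserve torsion and curvature; the parity condition. -/

section Naturality
variable {E : Type*} [NormedAddCommGroup E] [NormedSpace ℝ E] [CompleteSpace E]
  {G G' : E → E →L[ℝ] E →L[ℝ] E} {f : E → E} {U Ω Ω' : Set E}

/-- The chain rule turns the affine equation into the horizontal system along a line. Only time 0 is
needed, since lines start at every point. -/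
lemma AffineEq.horizontalAt {x : E} (hf : ContDiffAt ℝ 2 f x) (h : AffineEq G G' f x) (v : E) :
    HorizontalAt G G' (fun t ↦ x + t • v) (fun t ↦ f (x + t • v)) (fun t ↦ fderiv ℝ f (x + t • v))
      v 0 := by
  have h1 : HasDerivAt (fun t : ℝ ↦ x + t • v) v 0 := by
    simpa using ((hasDerivAt_id (0 : ℝ)).smul_const v).const_add x
  have h2 : HasFDerivAt f (fderiv ℝ f x) x := (hf.differentiableAt (by norm_num)).hasFDerivAt
  have h3 : HasFDerivAt (fderiv ℝ f) (fderiv ℝ (fderiv ℝ f) x) x :=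
    ((hf.fderiv_right (m := 1) (by norm_num)).differentiableAt (by norm_num)).hasFDerivAt
  refine ⟨h1, ?_, ?_⟩
  · refine (h2.comp_hasDerivAt_of_eq 0 h1 (by simp)).congr_deriv (by simp)
  · refine (h3.comp_hasDerivAt_of_eq 0 h1 (by simp)).congr_deriv ?_
    ext u
    have := h v u
    simp only [zero_smul, add_zero, sub_apply, ContinuousLinearMap.comp_apply]
    rw [← this]; abel

/-- A defect vanishing on an open set has zero derivative along the horizontal curve above a line.
With arguments parallel to first order, that derivative is the defect of the covariant derivatives.
-/
lemma AffineEq.defect_covDeriv (hU : IsOpen U) (hf : ContDiffOn ℝ 2 f U) (hUΩ : U ⊆ Ω)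
    (hfΩ : MapsTo f U Ω') (haff : ∀ x ∈ U, AffineEq G G' f x)
    {k : ℕ} {τ τ' : E × (Fin k → E) → E} (hτ : IsTensorOn τ Ω) (hτ' : IsTensorOn τ' Ω')
    (h : ∀ x ∈ U, ∀ u, defect τ τ' x (f x) (fderiv ℝ f x) u = 0) :
    ∀ x ∈ U, ∀ u, defect (coordCovDeriv G τ) (coordCovDeriv G' τ') x (f x) (fderiv ℝ f x) u = 0 := by
  intro x hx u
  have hor := (haff x hx).horizontalAt (hf.contDiffAt (hU.mem_nhds hx)) (u 0)
  -- Arguments chosen so that u' + G v u = 0 at time 0, which removes the correction term.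
  have hu : HasDerivAt (fun t : ℝ ↦ Fin.tail u + t • fun i ↦ -G x (u 0) (Fin.tail u i))
      (fun i ↦ -G x (u 0) (Fin.tail u i)) 0 := by
    simpa using ((hasDerivAt_id (0 : ℝ)).smul_const
      (fun i ↦ -G x (u 0) (Fin.tail u i))).const_add (Fin.tail u)
  have hd := hor.hasDerivAt_defect hu (hτ.analytic (_, _) ⟨by simpa using hUΩ hx, mem_univ _⟩).differentiableAt
    (hτ'.analytic (_, _) ⟨by simpa using hfΩ hx, mem_univ _⟩).differentiableAt
  have h0 : HasDerivAt (fun s : ℝ ↦ defect τ τ' (x + s • u 0) (f (x + s • u 0)) (fderiv ℝ f (x + s • u 0))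
      (Fin.tail u + s • fun i ↦ -G x (u 0) (Fin.tail u i))) 0 0 := by
    refine (hasDerivAt_const (0 : ℝ) (0 : E)).congr_of_eventuallyEq ?_
    have : ContinuousAt (fun s : ℝ ↦ x + s • u 0) 0 := by fun_prop
    filter_upwards [this.eventually (p := fun y ↦ y ∈ U) (by simpa using hU.mem_nhds hx)] with s hs
    exact h _ hs _
  have h1 := hd.unique h0
  simp only [zero_smul, add_zero, h x hx, map_zero, sub_zero, neg_add_cancel, Fin.cons_self_tail] at h1
  have z : ((0, fun _ ↦ 0) : E × (Fin k → E)) = 0 := rfl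
  simpa only [z, map_zero, sub_zero, add_zero] using h1

lemma AffineEq.defect_iterCovDeriv (hU : IsOpen U) (hf : ContDiffOn ℝ 2 f U) (hUΩ : U ⊆ Ω)
    (hfΩ : MapsTo f U Ω') (haff : ∀ x ∈ U, AffineEq G G' f x) (hΩ : IsOpen Ω) (hΩ' : IsOpen Ω')
    (hG : AnalyticOnNhd ℝ G Ω) (hG' : AnalyticOnNhd ℝ G' Ω')
    {k : ℕ} {τ τ' : E × (Fin k → E) → E} (hτ : IsTensorOn τ Ω) (hτ' : IsTensorOn τ' Ω')
    (h : ∀ x ∈ U, ∀ u, defect τ τ' x (f x) (fderiv ℝ f x) u = 0) (r : ℕ) :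
    ∀ x ∈ U, ∀ u, defect (iterCoordCovDeriv G τ r) (iterCoordCovDeriv G' τ' r)
      x (f x) (fderiv ℝ f x) u = 0 := by
  induction r with
  | zero => exact h
  | succ r ih =>
    exact AffineEq.defect_covDeriv hU hf hUΩ hfΩ haff (hτ.iterCovDeriv hΩ hG r)
      (hτ'.iterCovDeriv hΩ' hG' r) ih

/-- Antisymmetrize the affine equation: the second derivative of f is symmetric and drops out. -/
lemma AffineEq.defect_torsion {x : E} (hf : ContDiffAt ℝ 2 f x) (h : AffineEq G G' f x)
    (u : Fin 2 → E) : defect (coordTorsion G) (coordTorsion G') x (f x) (fderiv ℝ f x) u = 0 := by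
  have hs := hf.isSymmSndFDerivAt (by simp) (u 0) (u 1)
  have h1 := h (u 0) (u 1)
  have h2 := h (u 1) (u 0)
  simp only [defect, coordTorsion, map_sub]
  rw [← h1, ← h2, hs]
  abel

/-- The integrability condition of the affine equation. Differentiating it once more expresses the
third derivative of f; symmetry in the first two slots, after replacing second derivatives by the
equation itself, leaves the curvature identity. -/
lemma AffineEq.defect_curvature {x : E} (hf : ContDiffAt ℝ 3 f x) (hG : DifferentiableAt ℝ G x)
    (hG' : DifferentiableAt ℝ G' (f x)) (h : ∀ᶠ y in 𝓝 x, AffineEq G G' f y) (u : Fin 3 → E) :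
    defect (coordCurvature G) (coordCurvature G') x (f x) (fderiv ℝ f x) u = 0 := by
  have hf1 : ContDiffAt ℝ 2 (fderiv ℝ f) x := hf.fderiv_right (by norm_num)
  have hf2 : ContDiffAt ℝ 1 (fderiv ℝ (fderiv ℝ f)) x := hf1.fderiv_right (by norm_num)
  have hx := h.self_of_nhds
  have key : ∀ c a b, fderiv ℝ (fderiv ℝ (fderiv ℝ f)) x c a b =
      fderiv ℝ (fderiv ℝ f) x c (G x a b) + fderiv ℝ f x (fderiv ℝ G x c a b)
      - fderiv ℝ G' (f x) (fderiv ℝ f x c) (fderiv ℝ f x a) (fderiv ℝ f x b)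
      - G' (f x) (fderiv ℝ (fderiv ℝ f) x c a) (fderiv ℝ f x b)
      - G' (f x) (fderiv ℝ f x a) (fderiv ℝ (fderiv ℝ f) x c b) := by
    intro c a b
    have hl : HasDerivAt (fun t : ℝ ↦ x + t • c) c 0 := by
      simpa using ((hasDerivAt_id (0 : ℝ)).smul_const c).const_add x
    have d0 : HasDerivAt (fun t : ℝ ↦ f (x + t • c)) (fderiv ℝ f x c) 0 :=
      (hf.differentiableAt (by norm_num)).hasFDerivAt.comp_hasDerivAt_of_eq 0 hl (by simp)
    have d1 : HasDerivAt (fun t : ℝ ↦ fderiv ℝ f (x + t • c)) (fderiv ℝ (fderiv ℝ f) x c) 0 :=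
      (hf1.differentiableAt (by norm_num)).hasFDerivAt.comp_hasDerivAt_of_eq 0 hl (by simp)
    have d2 : HasDerivAt (fun t : ℝ ↦ fderiv ℝ (fderiv ℝ f) (x + t • c))
        (fderiv ℝ (fderiv ℝ (fderiv ℝ f)) x c) 0 :=
      (hf2.differentiableAt (by norm_num)).hasFDerivAt.comp_hasDerivAt_of_eq 0 hl (by simp)
    have dG : HasDerivAt (fun t : ℝ ↦ G (x + t • c)) (fderiv ℝ G x c) 0 :=
      hG.hasFDerivAt.comp_hasDerivAt_of_eq 0 hl (by simp)
    have dG' : HasDerivAt (fun t : ℝ ↦ G' (f (x + t • c))) (fderiv ℝ G' (f x) (fderiv ℝ f x c)) 0 :=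
      hG'.hasFDerivAt.comp_hasDerivAt_of_eq 0 d0 (by simp)
    have ca := hasDerivAt_const (0 : ℝ) a
    have cb := hasDerivAt_const (0 : ℝ) b
    have hL := (d2.clm_apply ca).clm_apply cb
    have hR := (d1.clm_apply ((dG.clm_apply ca).clm_apply cb)).sub
      ((dG'.clm_apply (d1.clm_apply ca)).clm_apply (d1.clm_apply cb))
    have heq : (fun t : ℝ ↦ fderiv ℝ (fderiv ℝ f) (x + t • c) a b) =ᶠ[𝓝 0]
        fun t ↦ fderiv ℝ f (x + t • c) (G (x + t • c) a b)
          - G' (f (x + t • c)) (fderiv ℝ f (x + t • c) a) (fderiv ℝ f (x + t • c) b) := by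
      have hc : Tendsto (fun s : ℝ ↦ x + s • c) (𝓝 0) (𝓝 x) :=
        Continuous.tendsto' (by fun_prop) _ _ (by simp)
      filter_upwards [hc.eventually h] with t ht
      rw [← ht a b]; abel
    have := hL.unique (hR.congr_of_eventuallyEq heq)
    simp only [zero_smul, add_zero, map_zero, add_apply] at this
    rw [this]; abel
  have hs3 := hf1.isSymmSndFDerivAt (by simp) (u 0) (u 1)
  have hs2 := hf.isSymmSndFDerivAt (by simp; norm_num) (u 0) (u 1)
  have e : ∀ a b, fderiv ℝ (fderiv ℝ f) x a b =
      fderiv ℝ f x (G x a b) - G' (f x) (fderiv ℝ f x a) (fderiv ℝ f x b) := by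
    intro a b; rw [← hx a b]; abel
  have k1 := key (u 0) (u 1) (u 2)
  have k2 := key (u 1) (u 0) (u 2)
  rw [hs3, k2, ← hs2] at k1
  rw [e (u 1) (G x (u 0) (u 2)), e (u 0) (G x (u 1) (u 2)), e (u 1) (u 2), e (u 0) (u 2)] at k1
  simp only [defect, coordCurvature, map_sub, map_add] at k1 ⊢
  rw [← sub_eq_zero] at k1
  rw [← neg_eq_zero, ← k1]
  abel

/-- The factor is -2 for even k and 0 for odd k, so -Id imposes a condition only on tensors with an
even number of arguments. -/
lemma defect_neg_id {k : ℕ} {τ : E × (Fin k → E) → E} (hτ : IsTensorOn τ Ω) {x : E} (hx : x ∈ Ω)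
    (u : Fin k → E) :
    defect τ τ x x (-ContinuousLinearMap.id ℝ E) u = -(1 + (-1 : ℝ) ^ k) • τ (x, u) := by
  have h1 : (fun i ↦ (-ContinuousLinearMap.id ℝ E) (u i)) = fun i ↦ - u i := by ext; simp
  simp only [defect, h1, hτ.map_neg hx]
  simp only [neg_apply, ContinuousLinearMap.id_apply, neg_smul, add_smul, one_smul]
  abel

/-- The parity condition in coordinates. -/
def CoordParity (G : E → E →L[ℝ] E →L[ℝ] E) (x : E) : Prop :=
  ∀ r : ℕ, (∀ u, iterCoordCovDeriv G (coordTorsion G) (2 * r) (x, u) = 0) ∧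
    ∀ u, iterCoordCovDeriv G (coordCurvature G) (2 * r + 1) (x, u) = 0

/-- At the fixed point the derivative is -Id. The derivatives named in the condition are those with
an even number of arguments, 2 r + 2 for torsion and 2 r + 4 for curvature, so vanishing defect
means vanishing tensor. -/
lemma CoordParity.of_affineEq (hΩ : IsOpen Ω) (hG : AnalyticOnNhd ℝ G Ω) {x : E} (hx : x ∈ Ω)
    (hf : ContDiffAt ℝ 3 f x) (haff : ∀ᶠ y in 𝓝 x, AffineEq G G f y) (hfx : f x = x)
    (hdf : fderiv ℝ f x = -ContinuousLinearMap.id ℝ E) : CoordParity G x := by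
  have e1 : ∀ᶠ y in 𝓝 x, ContDiffAt ℝ 3 f y := hf.eventually (by simp)
  have e2 : ∀ᶠ y in 𝓝 x, f y ∈ Ω :=
    hf.continuousAt.eventually (p := fun y ↦ y ∈ Ω) (by rw [hfx]; exact hΩ.mem_nhds hx)
  obtain ⟨U, hU, hUo, hxU⟩ := eventually_nhds_iff.1 (((e1.and e2).and haff).and (hΩ.mem_nhds hx))
  have hfU : ContDiffOn ℝ 2 f U := fun y hy ↦ ((hU y hy).1.1.1.of_le (by norm_num)).contDiffWithinAt
  have hT := AffineEq.defect_iterCovDeriv hUo hfU (fun y hy ↦ (hU y hy).2)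
    (fun y hy ↦ (hU y hy).1.1.2) (fun y hy ↦ (hU y hy).1.2) hΩ hΩ hG hG
    (isTensorOn_coordTorsion hG) (isTensorOn_coordTorsion hG) (fun y hy u ↦
      AffineEq.defect_torsion ((hU y hy).1.1.1.of_le (by norm_num)) (hU y hy).1.2 u)
  have hR := AffineEq.defect_iterCovDeriv hUo hfU (fun y hy ↦ (hU y hy).2)
    (fun y hy ↦ (hU y hy).1.1.2) (fun y hy ↦ (hU y hy).1.2) hΩ hΩ hG hG
    (isTensorOn_coordCurvature hG) (isTensorOn_coordCurvature hG) (fun y hy u ↦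
      AffineEq.defect_curvature (hU y hy).1.1.1 (hG y (hU y hy).2).differentiableAt
        (hG _ (hU y hy).1.1.2).differentiableAt
        (Filter.mem_of_superset (hUo.mem_nhds hy) fun z hz ↦ (hU z hz).1.2) u)
  intro r
  constructor
  · intro u
    have h := hT (2 * r) x hxU u
    rw [hdf, hfx, defect_neg_id ((isTensorOn_coordTorsion hG).iterCovDeriv hΩ hG _) hx,
      Even.neg_one_pow (by rw [Nat.even_iff]; omega)] at h
    simpa using h
  · intro u
    have h := hR (2 * r + 1) x hxU u
    rw [hdf, hfx, defect_neg_id ((isTensorOn_coordCurvature hG).iterCovDeriv hΩ hG _) hx,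
      Even.neg_one_pow (by rw [Nat.even_iff]; omega)] at h
    simpa using h

/-- Split on the parity of r: one class vanishes by hypothesis, the other has an odd number of
arguments, where -Id intertwines any tensor with itself. -/
lemma CoordParity.defect_eq_zero (hΩ : IsOpen Ω) (hG : AnalyticOnNhd ℝ G Ω) {x : E} (hx : x ∈ Ω)
    (h : CoordParity G x) (r : ℕ) :
    (∀ u, defect (iterCoordCovDeriv G (coordTorsion G) r) (iterCoordCovDeriv G (coordTorsion G) r)
      x x (-ContinuousLinearMap.id ℝ E) u = 0) ∧
    (∀ u, defect (iterCoordCovDeriv G (coordCurvature G) r)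
      (iterCoordCovDeriv G (coordCurvature G) r) x x (-ContinuousLinearMap.id ℝ E) u = 0) := by
  constructor
  · intro u
    rw [defect_neg_id ((isTensorOn_coordTorsion hG).iterCovDeriv hΩ hG _) hx]
    obtain ⟨s, rfl | rfl⟩ := Nat.even_or_odd' r
    · rw [(h s).1, smul_zero]
    · rw [Odd.neg_one_pow (by rw [Nat.odd_iff]; omega)]; simp
  · intro u
    rw [defect_neg_id ((isTensorOn_coordCurvature hG).iterCovDeriv hΩ hG _) hx]
    obtain ⟨s, rfl | rfl⟩ := Nat.even_or_odd' r
    · rw [Odd.neg_one_pow (by rw [Nat.odd_iff]; omega)]; simp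
    · rw [(h s).2, smul_zero]
end Naturality

/-! ### The horizontal system along rays. -/

section Radial
variable {E : Type*} [NormedAddCommGroup E] [NormedSpace ℝ E]

lemma eqOn_Ioo_of_hasDerivAt_eq {W : Type*} [NormedAddCommGroup W] [NormedSpace ℝ W] {a b : ℝ}
    {f g f' : ℝ → W} (hf : ∀ t ∈ Ioo a b, HasDerivAt f (f' t) t)
    (hg : ∀ t ∈ Ioo a b, HasDerivAt g (f' t) t) {t₀ : ℝ} (h0 : t₀ ∈ Ioo a b) (h : f t₀ = g t₀) :
    ∀ t ∈ Ioo a b, f t = g t := by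
  refine isOpen_Ioo.eqOn_of_deriv_eq isPreconnected_Ioo
    (fun t ht ↦ (hf t ht).differentiableAt.differentiableWithinAt)
    (fun t ht ↦ (hg t ht).differentiableAt.differentiableWithinAt)
    (fun t ht ↦ (hf t ht).deriv.trans (hg t ht).deriv.symm) h0 h

/-- An analytic vector field vanishing along a family of initial values `(0, y)` has a flow which,
after rescaling, is defined up to time `2`. The parameter `w` is the velocity. -/
lemma exists_rescaled_flow {Y : Type*} [NormedAddCommGroup Y] [NormedSpace ℝ Y] [CompleteSpace Y]
    [CompleteSpace E] {B : Y → E →L[ℝ] Y} {y₀ : Y} (hB : AnalyticAt ℝ B y₀)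
    {S : Set Y} (hS : S ∈ 𝓝 y₀) :
    ∃ Ψ : (ℝ × E) × Y → Y, ∃ ρ > 0, ∀ t ∈ Ioo (-2 : ℝ) 2, ∀ w ∈ Metric.ball (0 : E) ρ,
      ∀ y ∈ Metric.ball y₀ ρ, AnalyticAt ℝ Ψ ((t, w), y) ∧ Ψ ((t, w), y) ∈ S ∧ Ψ ((0, w), y) = y ∧
        HasDerivAt (fun s ↦ Ψ ((s, w), y)) (B (Ψ ((t, w), y)) w) t := by
  -- Adjoining w as a constant component makes the system autonomous, and analytic dependence on w
  -- becomes dependence on the initial condition.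
  have hV : AnalyticAt ℝ (fun z : E × Y ↦ ((0 : E), B z.2 z.1)) (0, y₀) := by
    refine analyticAt_const.prod ?_
    exact (AnalyticAt.fun_comp (f := fun z : E × Y ↦ z.2) hB analyticAt_snd).clm_apply_of_complete
      analyticAt_fst
  obtain ⟨Φ, hΦ, hΦ0, hΦd⟩ := exists_analytic_flow hV
  have hΦ00 : Φ (0, (0, y₀)) = (0, y₀) := hΦ0.self_of_nhds
  have hSe : ∀ᶠ z in 𝓝 ((0 : ℝ), ((0 : E), y₀)), (Φ z).2 ∈ S := by
    have : ContinuousAt (fun z ↦ (Φ z).2) ((0 : ℝ), ((0 : E), y₀)) := hΦ.continuousAt.snd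
    exact this.eventually (p := fun y ↦ y ∈ S) (by simpa [hΦ00] using hS)
  have hΦ0' : ∀ᶠ z in 𝓝 ((0 : ℝ), ((0 : E), y₀)), Φ (0, z.2) = z.2 :=
    (continuous_snd.tendsto ((0 : ℝ), ((0 : E), y₀))).eventually hΦ0
  obtain ⟨δ, hδ, hball⟩ := Metric.eventually_nhds_iff.1
    (((hΦ.eventually_analyticAt.and hSe).and hΦ0').and hΦd)
  have hc : 0 < δ / 2 := half_pos hδ
  -- The right-hand side is linear in w, so time c t with velocity w / c equals time t with velocity
  -- w. With c = δ / 2, times |t| < 2 stay within δ, and the radius c * δ keeps w / c within δ.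
  set c := δ / 2 with hcdef
  have hmem : ∀ t ∈ Ioo (-2 : ℝ) 2, ∀ w ∈ Metric.ball (0 : E) (min δ (c * δ)),
      ∀ y ∈ Metric.ball y₀ (min δ (c * δ)),
      dist (c * t, (c⁻¹ • w, y)) ((0 : ℝ), ((0 : E), y₀)) < δ := by
    intro t ht w hw y hy
    rw [Prod.dist_eq, Prod.dist_eq]
    refine max_lt ?_ (max_lt ?_ (hy.trans_le (min_le_left _ _)))
    · simp only [dist_zero_right, Real.norm_eq_abs, abs_mul, abs_of_pos hc]
      have : |t| < 2 := abs_lt.2 ht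
      calc c * |t| < c * 2 := by gcongr
        _ = δ := by rw [hcdef]; ring
    · simp only [dist_zero_right, norm_smul, norm_inv, Real.norm_eq_abs, abs_of_pos hc]
      have hw' : ‖w‖ < c * δ := by simpa using (Metric.mem_ball.1 hw).trans_le (min_le_right _ _)
      rwa [inv_mul_lt_iff₀ hc]
  have hfst : ∀ t ∈ Ioo (-2 : ℝ) 2, ∀ w ∈ Metric.ball (0 : E) (min δ (c * δ)),
      ∀ y ∈ Metric.ball y₀ (min δ (c * δ)), (Φ (c * t, (c⁻¹ • w, y))).1 = c⁻¹ • w := by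
    intro t ht w hw y hy
    refine eqOn_Ioo_of_hasDerivAt_eq (f := fun t ↦ (Φ (c * t, (c⁻¹ • w, y))).1) (f' := fun _ ↦ 0)
      (t₀ := 0) (fun s hs ↦ ?_) (fun s _ ↦ hasDerivAt_const _ _) (by simp) ?_ t ht
    · have h1 := (hball (hmem s hs w hw y hy)).2
      have h2 : HasDerivAt (fun s : ℝ ↦ c * s) c s := by simpa using (hasDerivAt_id s).const_mul c
      exact ((h1.scomp s h2).hasFDerivAt.fst).hasDerivAt.congr_deriv (by simp)
    · have := (hball (hmem 0 (by simp) w hw y hy)).1.2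
      simp only at this
      simp [this]
  refine ⟨fun z ↦ (Φ (c * z.1.1, (c⁻¹ • z.1.2, z.2))).2, min δ (c * δ), lt_min hδ (mul_pos hc hδ), ?_⟩
  intro t ht w hw y hy
  have hg := hball (hmem t ht w hw y hy)
  refine ⟨?_, hg.1.1.2, ?_, ?_⟩
  · have h1 : AnalyticAt ℝ (fun z : (ℝ × E) × Y ↦ (c * z.1.1, (c⁻¹ • z.1.2, z.2))) ((t, w), y) := by
      let L : (ℝ × E) × Y →L[ℝ] ℝ × (E × Y) :=
        (c • (ContinuousLinearMap.fst ℝ ℝ E).comp (.fst ℝ (ℝ × E) Y)).prod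
          ((c⁻¹ • (ContinuousLinearMap.snd ℝ ℝ E).comp (.fst ℝ (ℝ × E) Y)).prod (.snd ℝ (ℝ × E) Y))
      exact L.analyticAt _
    exact ((ContinuousLinearMap.snd ℝ E Y).analyticAt _).fun_comp (AnalyticAt.fun_comp hg.1.1.1 h1)
  · have := hg.1.2
    simp only [mul_zero] at this ⊢
    rw [this]
  · have h2 : HasDerivAt (fun s : ℝ ↦ c * s) c t := by simpa using (hasDerivAt_id t).const_mul c
    have h3 := ((hg.2.scomp t h2).hasFDerivAt.snd).hasDerivAt
    have h4 := hfst t ht w hw y hy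
    simp only [ContinuousLinearMap.comp_apply, ContinuousLinearMap.toSpanSingleton_apply, one_smul,
      ContinuousLinearMap.coe_snd', Prod.smul_snd, h4] at h3
    refine h3.congr_deriv ?_
    rw [map_smul, smul_smul, mul_inv_cancel₀ hc.ne', one_smul]

variable [CompleteSpace E]

/-- The solution of the radial system: parallel transport along the rays through `x₀`. -/
lemma exists_radial_solution {G G' : E → E →L[ℝ] E →L[ℝ] E} {Ω Ω' : Set E} (hΩ : IsOpen Ω)
    (hΩ' : IsOpen Ω') (hG : AnalyticOnNhd ℝ G Ω) (hG' : AnalyticOnNhd ℝ G' Ω') {x₀ y₀ : E}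
    (hx₀ : x₀ ∈ Ω) (hy₀ : y₀ ∈ Ω') (A₀ : E →L[ℝ] E) :
    ∃ (P : ℝ × E → E) (Q : ℝ × E → E →L[ℝ] E), ∃ ρ > 0,
      ∀ t ∈ Ioo (-2 : ℝ) 2, ∀ w ∈ Metric.ball (0 : E) ρ,
        AnalyticAt ℝ P (t, w) ∧ AnalyticAt ℝ Q (t, w) ∧ x₀ + t • w ∈ Ω ∧ P (t, w) ∈ Ω' ∧
        P (0, w) = y₀ ∧ Q (0, w) = A₀ ∧
        HorizontalAt G G' (fun s ↦ x₀ + s • w) (fun s ↦ P (s, w)) (fun s ↦ Q (s, w)) w t := by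
  -- The unknown is (x, F, A), and the value at w is (w, A w, A ∘ G(x) w - G'(F)(A w) ∘ A): the
  -- horizontal system, linear in the direction w.
  let B : E × (E × (E →L[ℝ] E)) → E →L[ℝ] E × (E × (E →L[ℝ] E)) := fun y ↦
    ContinuousLinearMap.inl ℝ E (E × (E →L[ℝ] E)) +
    (ContinuousLinearMap.inr ℝ E (E × (E →L[ℝ] E))).comp
      ((ContinuousLinearMap.inl ℝ E (E →L[ℝ] E)).comp y.2.2
      + (ContinuousLinearMap.inr ℝ E (E →L[ℝ] E)).comp
        ((ContinuousLinearMap.compL ℝ E E E y.2.2).comp (G y.1)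
        - ((ContinuousLinearMap.compL ℝ E E E).flip y.2.2).comp ((G' y.2.1).comp y.2.2)))
  have hB : AnalyticAt ℝ B (x₀, (y₀, A₀)) := by
    have h1 : ContDiffAt ℝ ω (fun y : E × (E × (E →L[ℝ] E)) ↦ G y.1) (x₀, (y₀, A₀)) :=
      ContDiffAt.comp (g := G) _ (hG x₀ hx₀).contDiffAt contDiffAt_fst
    have h2 : ContDiffAt ℝ ω (fun y : E × (E × (E →L[ℝ] E)) ↦ G' y.2.1) (x₀, (y₀, A₀)) :=
      ContDiffAt.comp (g := G') (f := fun y : E × (E × (E →L[ℝ] E)) ↦ y.2.1) _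
        (hG' y₀ hy₀).contDiffAt (by fun_prop)
    have h3 : ContDiffAt ℝ ω (fun y : E × (E × (E →L[ℝ] E)) ↦
        ContinuousLinearMap.compL ℝ E E E y.2.2) (x₀, (y₀, A₀)) :=
      (ContinuousLinearMap.contDiff _).contDiffAt.comp _ (by fun_prop)
    have h4 : ContDiffAt ℝ ω (fun y : E × (E × (E →L[ℝ] E)) ↦
        (ContinuousLinearMap.compL ℝ E E E).flip y.2.2) (x₀, (y₀, A₀)) :=
      (ContinuousLinearMap.contDiff _).contDiffAt.comp _ (by fun_prop)
    refine ContDiffAt.analyticAt ?_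
    have h5 : ContDiffAt ℝ ω (fun y : E × (E × (E →L[ℝ] E)) ↦ y.2.2) (x₀, (y₀, A₀)) := by fun_prop
    exact contDiffAt_const.add (contDiffAt_const.clm_comp ((contDiffAt_const.clm_comp h5).add
      (contDiffAt_const.clm_comp ((h3.clm_comp h1).sub (h4.clm_comp (h2.clm_comp h5))))))
  obtain ⟨Ψ, ρ, hρ, hΨ⟩ := exists_rescaled_flow hB (S := Ω ×ˢ (Ω' ×ˢ univ))
    ((hΩ.prod (hΩ'.prod isOpen_univ)).mem_nhds ⟨hx₀, hy₀, mem_univ _⟩)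
  have h0 : (x₀, (y₀, A₀)) ∈ Metric.ball (x₀, (y₀, A₀)) ρ := Metric.mem_ball_self hρ
  have hx : ∀ t ∈ Ioo (-2 : ℝ) 2, ∀ w ∈ Metric.ball (0 : E) ρ,
      (Ψ ((t, w), (x₀, (y₀, A₀)))).1 = x₀ + t • w := by
    intro t ht w hw
    refine eqOn_Ioo_of_hasDerivAt_eq (f := fun t ↦ (Ψ ((t, w), (x₀, (y₀, A₀)))).1)
      (g := fun t ↦ x₀ + t • w) (f' := fun _ ↦ w)
      (t₀ := 0) (fun s hs ↦ ?_) (fun s _ ↦ ?_) (by simp) ?_ t ht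
    · simpa [B] using ((hΨ s hs w hw _ h0).2.2.2.hasFDerivAt.fst).hasDerivAt
    · simpa using ((hasDerivAt_id s).smul_const w).const_add x₀
    · simp [(hΨ 0 (by simp) w hw _ h0).2.2.1]
  refine ⟨fun z ↦ (Ψ (z, (x₀, (y₀, A₀)))).2.1, fun z ↦ (Ψ (z, (x₀, (y₀, A₀)))).2.2, ρ, hρ, ?_⟩
  intro t ht w hw
  obtain ⟨h1, h2, h3, h4⟩ := hΨ t ht w hw _ h0
  have ha : AnalyticAt ℝ (fun z ↦ Ψ (z, (x₀, (y₀, A₀)))) (t, w) :=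
    AnalyticAt.fun_comp (f := fun z ↦ (z, (x₀, (y₀, A₀)))) h1 (analyticAt_id.prod analyticAt_const)
  have ha2 : AnalyticAt ℝ (fun z ↦ (Ψ (z, (x₀, (y₀, A₀)))).2) (t, w) :=
    ((ContinuousLinearMap.snd ℝ E (E × (E →L[ℝ] E))).analyticAt _).fun_comp ha
  refine ⟨((ContinuousLinearMap.fst ℝ E (E →L[ℝ] E)).analyticAt _).fun_comp ha2,
    ((ContinuousLinearMap.snd ℝ E (E →L[ℝ] E)).analyticAt _).fun_comp ha2, ?_, h2.2.1, ?_, ?_, ?_⟩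
  · rw [← hx t ht w hw]; exact h2.1
  · simp [h3]
  · simp [h3]
  · have hd := (h4.hasFDerivAt.snd).hasDerivAt
    refine ⟨?_, ?_, ?_⟩
    · simpa using ((hasDerivAt_id t).smul_const w).const_add x₀
    · simpa [B] using hd.hasFDerivAt.fst.hasDerivAt
    · refine hd.hasFDerivAt.snd.hasDerivAt.congr_deriv ?_
      ext u
      simp [B, hx t ht w hw]
end Radial

/-! ### Integrability of the radial solution and local existence of affine maps. -/

section Existence
variable {E : Type*} [NormedAddCommGroup E] [NormedSpace ℝ E] [CompleteSpace E]

/-- The variational equation of a family of curves. -/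
lemma hasDerivAt_fderiv_snd {W : Type*} [NormedAddCommGroup W] [NormedSpace ℝ W] [CompleteSpace W]
    {f g : ℝ × E → W} {t : ℝ} {w : E} (hf : AnalyticAt ℝ f (t, w))
    (hd : ∀ᶠ z in 𝓝 (t, w), HasDerivAt (fun s ↦ f (s, z.2)) (g z) z.1) (h : E) :
    HasDerivAt (fun s ↦ fderiv ℝ f (s, w) (0, h)) (fderiv ℝ g (t, w) (0, h)) t := by
  have hg : g =ᶠ[𝓝 (t, w)] fun z ↦ fderiv ℝ f z (1, 0) := by
    filter_upwards [hd, hf.eventually_analyticAt] with z hz hfz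
    have h1 : HasDerivAt (fun s : ℝ ↦ (s, z.2)) ((1 : ℝ), (0 : E)) z.1 :=
      (hasDerivAt_id z.1).prodMk (hasDerivAt_const z.1 z.2)
    exact hz.unique (hfz.differentiableAt.hasFDerivAt.comp_hasDerivAt_of_eq z.1 h1 rfl)
  have hff : HasFDerivAt (fderiv ℝ f) (fderiv ℝ (fderiv ℝ f) (t, w)) (t, w) :=
    hf.fderiv.differentiableAt.hasFDerivAt
  have h1 : HasDerivAt (fun s : ℝ ↦ (s, w)) ((1 : ℝ), (0 : E)) t :=
    (hasDerivAt_id t).prodMk (hasDerivAt_const t w)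
  have h2 := (hff.comp_hasDerivAt_of_eq t h1 rfl).clm_apply (hasDerivAt_const t ((0 : ℝ), h))
  refine h2.congr_deriv ?_
  have h3 : HasFDerivAt (fun z ↦ fderiv ℝ f z (1, 0)) _ (t, w) :=
    hff.clm_apply (hasFDerivAt_const ((1 : ℝ), (0 : E)) (t, w))
  rw [hg.fderiv_eq, h3.fderiv]
  -- Time and transverse derivatives commute.
  have hs := (hf.contDiffAt (n := ω)).isSymmSndFDerivAt (by simp) ((1 : ℝ), (0 : E)) ((0 : ℝ), h)
  simpa using hs

variable {G G' : E → E →L[ℝ] E →L[ℝ] E} {Ω Ω' : Set E}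

/-- The derivative in the direction `h` of the right-hand side of the radial system. -/
lemma fderiv_radial_rhs {x₀ : E} {P : ℝ × E → E} {Q : ℝ × E → E →L[ℝ] E} {t : ℝ} {w : E}
    (hP : DifferentiableAt ℝ P (t, w)) (hQ : DifferentiableAt ℝ Q (t, w))
    (hG : DifferentiableAt ℝ G (x₀ + t • w)) (hG' : DifferentiableAt ℝ G' (P (t, w))) (h u : E) :
    fderiv ℝ (fun z : ℝ × E ↦ (Q z) ∘L (G (x₀ + z.1 • z.2) z.2) - (G' (P z) (Q z z.2)) ∘L (Q z))
        (t, w) (0, h) u =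
      fderiv ℝ Q (t, w) (0, h) (G (x₀ + t • w) w u)
      + Q (t, w) (fderiv ℝ G (x₀ + t • w) (t • h) w u) + Q (t, w) (G (x₀ + t • w) h u)
      - fderiv ℝ G' (P (t, w)) (fderiv ℝ P (t, w) (0, h)) (Q (t, w) w) (Q (t, w) u)
      - G' (P (t, w)) (fderiv ℝ Q (t, w) (0, h) w) (Q (t, w) u)
      - G' (P (t, w)) (Q (t, w) h) (Q (t, w) u)
      - G' (P (t, w)) (Q (t, w) w) (fderiv ℝ Q (t, w) (0, h) u) := by
  have l1 : HasDerivAt (fun s : ℝ ↦ (t, w + s • h)) ((0 : ℝ), h) 0 :=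
    (hasDerivAt_const 0 t).prodMk
      ((((hasDerivAt_id (0 : ℝ)).smul_const h).const_add w).congr_deriv (by simp))
  have l2 : HasDerivAt (fun s : ℝ ↦ w + s • h) h 0 :=
    (((hasDerivAt_id (0 : ℝ)).smul_const h).const_add w).congr_deriv (by simp)
  have l3 : HasDerivAt (fun s : ℝ ↦ x₀ + t • (w + s • h)) (t • h) 0 :=
    (l2.const_smul t).const_add x₀
  have dP := hP.hasFDerivAt.comp_hasDerivAt_of_eq 0 l1 (by simp)
  have dQ := hQ.hasFDerivAt.comp_hasDerivAt_of_eq 0 l1 (by simp)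
  have dG := hG.hasFDerivAt.comp_hasDerivAt_of_eq 0 l3 (by simp)
  have dG' := hG'.hasFDerivAt.comp_hasDerivAt_of_eq 0 dP (by simp)
  have d1 := (dQ.clm_comp (dG.clm_apply l2)).sub ((dG'.clm_apply (dQ.clm_apply l2)).clm_comp dQ)
  have dd : DifferentiableAt ℝ
      (fun z : ℝ × E ↦ (Q z) ∘L (G (x₀ + z.1 • z.2) z.2) - (G' (P z) (Q z z.2)) ∘L (Q z)) (t, w) := by
    have e1 : DifferentiableAt ℝ (fun z : ℝ × E ↦ G (x₀ + z.1 • z.2)) (t, w) :=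
      DifferentiableAt.fun_comp' (f := fun z : ℝ × E ↦ x₀ + z.1 • z.2) (t, w) hG (by fun_prop)
    have e2 : DifferentiableAt ℝ (fun z : ℝ × E ↦ G' (P z)) (t, w) :=
      DifferentiableAt.fun_comp' (f := P) (t, w) hG' hP
    exact (hQ.clm_comp (e1.clm_apply differentiableAt_snd)).sub
      ((e2.clm_apply (hQ.clm_apply differentiableAt_snd)).clm_comp hQ)
  have d2 := dd.hasFDerivAt.comp_hasDerivAt_of_eq 0 l1 (by simp)
  have key := DFunLike.congr_fun (d2.unique d1) u
  rw [key]
  simp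
  abel

/-- Grönwall's inequality, with the coefficient bounded by compactness of the interval. -/
lemma eq_zero_of_hasDerivAt_of_norm_le {W : Type*} [NormedAddCommGroup W] [NormedSpace ℝ W]
    {z z' : ℝ → W} {κ : ℝ → ℝ} (hd : ∀ t ∈ Icc (0 : ℝ) 1, HasDerivAt z (z' t) t)
    (hκ : ContinuousOn κ (Icc 0 1)) (hb : ∀ t ∈ Icc (0 : ℝ) 1, ‖z' t‖ ≤ κ t * ‖z t‖) (h0 : z 0 = 0) :
    ∀ t ∈ Icc (0 : ℝ) 1, z t = 0 := by
  obtain ⟨K, hK⟩ := isCompact_Icc.bddAbove_image hκ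
  refine eq_zero_of_abs_deriv_le_mul_abs_self_of_eq_zero_right (K := K) (f' := z')
    (fun t ht ↦ (hd t ht).continuousAt.continuousWithinAt)
    (fun t ht ↦ (hd t ⟨ht.1, ht.2.le⟩).hasDerivWithinAt) h0 fun t ht ↦ ?_
  refine (hb t ⟨ht.1, ht.2.le⟩).trans ?_
  exact mul_le_mul_of_nonneg_right (hK ⟨t, ⟨ht.1, ht.2.le⟩, rfl⟩) (norm_nonneg _)

/-- A radial family of horizontal curves along which torsion and curvature are intertwined is
integrable: `A` is the derivative of the map it covers. -/
lemma fderiv_radial_eq (hG : AnalyticOnNhd ℝ G Ω) (hG' : AnalyticOnNhd ℝ G' Ω') {x₀ y₀ : E}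
    {A₀ : E →L[ℝ] E} {P : ℝ × E → E} {Q : ℝ × E → E →L[ℝ] E} {ρ : ℝ}
    (H : ∀ t ∈ Ioo (-2 : ℝ) 2, ∀ w ∈ Metric.ball (0 : E) ρ,
        AnalyticAt ℝ P (t, w) ∧ AnalyticAt ℝ Q (t, w) ∧ x₀ + t • w ∈ Ω ∧ P (t, w) ∈ Ω' ∧
        P (0, w) = y₀ ∧ Q (0, w) = A₀ ∧
        HorizontalAt G G' (fun s ↦ x₀ + s • w) (fun s ↦ P (s, w)) (fun s ↦ Q (s, w)) w t)
    {w : E} (hw : w ∈ Metric.ball (0 : E) ρ)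
    (hT : ∀ t ∈ Icc (0 : ℝ) 1, ∀ u,
      defect (coordTorsion G) (coordTorsion G') (x₀ + t • w) (P (t, w)) (Q (t, w)) u = 0)
    (hR : ∀ t ∈ Icc (0 : ℝ) 1, ∀ u,
      defect (coordCurvature G) (coordCurvature G') (x₀ + t • w) (P (t, w)) (Q (t, w)) u = 0)
    (h : E) {t : ℝ} (ht : t ∈ Icc (0 : ℝ) 1) :
    fderiv ℝ P (t, w) (0, h) = Q (t, w) (t • h) ∧
    fderiv ℝ Q (t, w) (0, h) = (Q (t, w)) ∘L (G (x₀ + t • w) (t • h))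
      - (G' (P (t, w)) (Q (t, w) (t • h))) ∘L (Q (t, w)) := by
  have hsub : ∀ {s}, s ∈ Icc (0 : ℝ) 1 → s ∈ Ioo (-2 : ℝ) 2 := fun hs ↦
    ⟨by linarith [hs.1], by linarith [hs.2]⟩
  have hnhds : ∀ {s}, s ∈ Icc (0 : ℝ) 1 → ∀ᶠ z in 𝓝 (s, w),
      z.1 ∈ Ioo (-2 : ℝ) 2 ∧ z.2 ∈ Metric.ball (0 : E) ρ := fun hs ↦
    (isOpen_Ioo.prod Metric.isOpen_ball).mem_nhds ⟨hsub hs, hw⟩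
  -- In the direction h the ray moves by s • h at time s. Then ξ is the failure of Q to be the
  -- derivative of the endpoint map, and η is the failure of Q to be parallel in this transverse
  -- direction.
  let ξ : ℝ → E := fun s ↦ fderiv ℝ P (s, w) (0, h) - Q (s, w) (s • h)
  let η : ℝ → E →L[ℝ] E := fun s ↦ fderiv ℝ Q (s, w) (0, h)
    - ((Q (s, w)) ∘L (G (x₀ + s • w) (s • h)) - (G' (P (s, w)) (Q (s, w) (s • h))) ∘L (Q (s, w)))
  let η' : ℝ → E →L[ℝ] E := fun s ↦ (η s) ∘L (G (x₀ + s • w) w)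
    - (G' (P (s, w)) (Q (s, w) w)) ∘L (η s)
    - (fderiv ℝ G' (P (s, w)) (ξ s) (Q (s, w) w)) ∘L (Q (s, w))
    - (G' (P (s, w)) (η s w)) ∘L (Q (s, w))
  have hξ : ∀ s ∈ Icc (0 : ℝ) 1, HasDerivAt ξ (η s w) s := by
    intro s hs
    obtain ⟨aP, aQ, hxΩ, hPΩ, -, -, hor⟩ := H s (hsub hs) w hw
    have dP := hasDerivAt_fderiv_snd (g := fun z ↦ Q z z.2) aP
      ((hnhds hs).mono fun z hz ↦ (H z.1 hz.1 z.2 hz.2).2.2.2.2.2.2.hF) h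
    have dj : HasDerivAt (fun s : ℝ ↦ s • h) h s := by
      simpa using (hasDerivAt_id s).smul_const h
    refine (dP.sub (hor.hA.clm_apply dj)).congr_deriv ?_
    have e1 : HasFDerivAt (fun z : ℝ × E ↦ Q z z.2) _ (s, w) :=
      aQ.differentiableAt.hasFDerivAt.clm_apply hasFDerivAt_snd
    rw [e1.fderiv]
    -- The derivative of ξ differs from η w by the torsion defect on the radial and transverse
    -- directions, which vanishes.
    have hTs := hT s hs ![w, s • h]
    simp only [defect, coordTorsion, Matrix.cons_val_zero, Matrix.cons_val_one, map_sub] at hTs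
    simp [η] at hTs ⊢
    linear_combination (norm := module) -hTs
  have hη : ∀ s ∈ Icc (0 : ℝ) 1, HasDerivAt η (η' s) s := by
    intro s hs
    obtain ⟨aP, aQ, hxΩ, hPΩ, -, -, hor⟩ := H s (hsub hs) w hw
    have dQ := hasDerivAt_fderiv_snd (g := fun z : ℝ × E ↦
        (Q z) ∘L (G (x₀ + z.1 • z.2) z.2) - (G' (P z) (Q z z.2)) ∘L (Q z)) aQ
      ((hnhds hs).mono fun z hz ↦ (H z.1 hz.1 z.2 hz.2).2.2.2.2.2.2.hA) h
    have dj : HasDerivAt (fun s : ℝ ↦ s • h) h s := by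
      simpa using (hasDerivAt_id s).smul_const h
    have dG := ((hG _ hxΩ).differentiableAt.hasFDerivAt.comp_hasDerivAt_of_eq s hor.hx rfl).clm_apply dj
    have dG' := ((hG' _ hPΩ).differentiableAt.hasFDerivAt.comp_hasDerivAt_of_eq s hor.hF
      rfl).clm_apply (hor.hA.clm_apply dj)
    refine (dQ.sub ((hor.hA.clm_comp dG).sub (dG'.clm_comp hor.hA))).congr_deriv ?_
    ext u
    -- What remains beyond the homogeneous part `η'` is the curvature defect, plus the torsion
    -- defect inserted into G'.
    have hTs := hT s hs ![w, s • h]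
    have hRs := hR s hs ![w, s • h, u]
    simp only [defect, coordTorsion, Matrix.cons_val_zero, Matrix.cons_val_one, map_sub] at hTs
    simp only [defect, coordCurvature, Matrix.cons_val_zero, Matrix.cons_val_one, Matrix.cons_val,
      map_sub, map_add] at hRs
    have hTs' := congrArg (fun y ↦ G' (P (s, w)) y (Q (s, w) u)) hTs
    simp only [sub_apply]
    rw [fderiv_radial_rhs aP.differentiableAt aQ.differentiableAt (hG _ hxΩ).differentiableAt
      (hG' _ hPΩ).differentiableAt]
    simp [η', η, ξ] at hTs' hRs ⊢
    linear_combination (norm := module) -hRs + hTs'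
  let κ : ℝ → ℝ := fun s ↦ ‖w‖ + (‖G (x₀ + s • w) w‖ + ‖G' (P (s, w)) (Q (s, w) w)‖
    + ‖fderiv ℝ G' (P (s, w))‖ * ‖Q (s, w) w‖ * ‖Q (s, w)‖ + ‖G' (P (s, w))‖ * ‖w‖ * ‖Q (s, w)‖)
  have hκ : ContinuousOn κ (Icc 0 1) := by
    intro s hs
    obtain ⟨aP, aQ, hxΩ, hPΩ, -, -, hor⟩ := H s (hsub hs) w hw
    have c1 : ContinuousAt (fun s : ℝ ↦ G (x₀ + s • w)) s :=
      ContinuousAt.comp (f := fun s : ℝ ↦ x₀ + s • w) (hG _ hxΩ).continuousAt (by fun_prop)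
    have c2 : ContinuousAt (fun s ↦ P (s, w)) s := hor.hF.continuousAt
    have c3 : ContinuousAt (fun s ↦ Q (s, w)) s := hor.hA.continuousAt
    have c4 : ContinuousAt (fun s : ℝ ↦ G' (P (s, w))) s :=
      ContinuousAt.comp (f := fun s : ℝ ↦ P (s, w)) (hG' _ hPΩ).continuousAt c2
    have c5 : ContinuousAt (fun s : ℝ ↦ fderiv ℝ G' (P (s, w))) s :=
      ContinuousAt.comp (f := fun s : ℝ ↦ P (s, w)) (hG' _ hPΩ).fderiv.continuousAt c2
    have c6 : ContinuousAt (fun s ↦ Q (s, w) w) s := c3.clm_apply continuousAt_const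
    refine ContinuousAt.continuousWithinAt ?_
    exact continuousAt_const.add (((((c1.clm_apply continuousAt_const).norm).add
      (c4.clm_apply c6).norm).add ((c5.norm.mul c6.norm).mul c3.norm)).add
      ((c4.norm.mul continuousAt_const).mul c3.norm))
  have hz : ∀ s ∈ Icc (0 : ℝ) 1, (ξ s, η s) = 0 := by
    refine eq_zero_of_hasDerivAt_of_norm_le (z' := fun s ↦ (η s w, η' s)) (κ := κ)
      (fun s hs ↦ (hξ s hs).prodMk (hη s hs)) hκ ?_ ?_
    · intro s hs
      set N := ‖(ξ s, η s)‖
      have n1 : ‖ξ s‖ ≤ N := norm_fst_le (ξ s, η s)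
      have n2 : ‖η s‖ ≤ N := norm_snd_le (ξ s, η s)
      have b0 : ‖η s w‖ ≤ N * ‖w‖ := (η s).le_of_opNorm_le n2 w
      have b1 : ‖(η s) ∘L (G (x₀ + s • w) w)‖ ≤ N * ‖G (x₀ + s • w) w‖ :=
        (ContinuousLinearMap.opNorm_comp_le _ _).trans (by gcongr)
      have b2 : ‖(G' (P (s, w)) (Q (s, w) w)) ∘L (η s)‖ ≤ ‖G' (P (s, w)) (Q (s, w) w)‖ * N :=
        (ContinuousLinearMap.opNorm_comp_le _ _).trans (by gcongr)
      have b3 : ‖(fderiv ℝ G' (P (s, w)) (ξ s) (Q (s, w) w)) ∘L (Q (s, w))‖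
          ≤ ‖fderiv ℝ G' (P (s, w))‖ * N * ‖Q (s, w) w‖ * ‖Q (s, w)‖ := by
        refine (ContinuousLinearMap.opNorm_comp_le _ _).trans ?_
        gcongr
        exact (ContinuousLinearMap.le_opNorm₂ _ _ _).trans (by gcongr)
      have b4 : ‖(G' (P (s, w)) (η s w)) ∘L (Q (s, w))‖
          ≤ ‖G' (P (s, w))‖ * (N * ‖w‖) * ‖Q (s, w)‖ := by
        refine (ContinuousLinearMap.opNorm_comp_le _ _).trans ?_
        gcongr
        exact (ContinuousLinearMap.le_opNorm _ _).trans (by gcongr)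
      have b5 : ‖η' s‖ ≤ (‖G (x₀ + s • w) w‖ + ‖G' (P (s, w)) (Q (s, w) w)‖
          + ‖fderiv ℝ G' (P (s, w))‖ * ‖Q (s, w) w‖ * ‖Q (s, w)‖
          + ‖G' (P (s, w))‖ * ‖w‖ * ‖Q (s, w)‖) * N := by
        refine (norm_sub_le _ _).trans ?_
        refine (add_le_add ((norm_sub_le _ _).trans (add_le_add (norm_sub_le _ _) le_rfl))
          le_rfl).trans ?_
        linarith
      have p1 : 0 ≤ N * ‖w‖ := by positivity
      have p2 : 0 ≤ (‖G (x₀ + s • w) w‖ + ‖G' (P (s, w)) (Q (s, w) w)‖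
          + ‖fderiv ℝ G' (P (s, w))‖ * ‖Q (s, w) w‖ * ‖Q (s, w)‖
          + ‖G' (P (s, w))‖ * ‖w‖ * ‖Q (s, w)‖) * N := by positivity
      refine max_le ?_ ?_
      · change ‖η s w‖ ≤ κ s * N
        simp only [κ, add_mul ‖w‖]
        linarith
      · change ‖η' s‖ ≤ κ s * N
        simp only [κ, add_mul ‖w‖]
        linarith
    -- At time 0 all rays share the same initial values, so the transverse derivatives vanish.
    · have h0 : (0 : ℝ) ∈ Ioo (-2 : ℝ) 2 := by norm_num
      have e0 : ∀ᶠ v in 𝓝 w, P (0, v) = y₀ ∧ Q (0, v) = A₀ := by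
        filter_upwards [Metric.isOpen_ball.mem_nhds hw] with v hv
        exact ⟨(H 0 h0 v hv).2.2.2.2.1, (H 0 h0 v hv).2.2.2.2.2.1⟩
      have hP0 : fderiv ℝ P (0, w) (0, h) = 0 := by
        have d1 : HasFDerivAt (fun v ↦ P (0, v)) _ w :=
          (H 0 h0 w hw).1.differentiableAt.hasFDerivAt.comp w (hasFDerivAt_prodMk_right (0 : ℝ) w)
        have d2 := d1.unique ((hasFDerivAt_const y₀ w).congr_of_eventuallyEq
          (e0.mono fun v hv ↦ hv.1))
        simpa using DFunLike.congr_fun d2 h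
      have hQ0 : fderiv ℝ Q (0, w) (0, h) = 0 := by
        have d1 : HasFDerivAt (fun v ↦ Q (0, v)) _ w :=
          (H 0 h0 w hw).2.1.differentiableAt.hasFDerivAt.comp w (hasFDerivAt_prodMk_right (0 : ℝ) w)
        have d2 := d1.unique ((hasFDerivAt_const A₀ w).congr_of_eventuallyEq
          (e0.mono fun v hv ↦ hv.2))
        simpa using DFunLike.congr_fun d2 h
      simp [ξ, η, hP0, hQ0]
  have := hz t ht
  rw [Prod.mk_eq_zero] at this
  exact ⟨sub_eq_zero.1 this.1, sub_eq_zero.1 this.2⟩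

/-- The local existence theorem: a linear map intertwining all covariant derivatives of torsion and
curvature at a point is the derivative of a local affine map. -/
theorem exists_affineEq (hΩ : IsOpen Ω) (hΩ' : IsOpen Ω')
    (hG : AnalyticOnNhd ℝ G Ω) (hG' : AnalyticOnNhd ℝ G' Ω') {x₀ y₀ : E} (hx₀ : x₀ ∈ Ω)
    (hy₀ : y₀ ∈ Ω') (A₀ : E →L[ℝ] E)
    (hT : ∀ r u, defect (iterCoordCovDeriv G (coordTorsion G) r)
      (iterCoordCovDeriv G' (coordTorsion G') r) x₀ y₀ A₀ u = 0)
    (hR : ∀ r u, defect (iterCoordCovDeriv G (coordCurvature G) r)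
      (iterCoordCovDeriv G' (coordCurvature G') r) x₀ y₀ A₀ u = 0) :
    ∃ f : E → E, AnalyticAt ℝ f x₀ ∧ f x₀ = y₀ ∧ fderiv ℝ f x₀ = A₀ ∧
      ∀ᶠ x in 𝓝 x₀, AffineEq G G' f x := by
  obtain ⟨P, Q, ρ, hρ, H⟩ := exists_radial_solution hΩ hΩ' hG hG' hx₀ hy₀ A₀
  have hm0 : (0 : ℝ) ∈ Ioo (-2 : ℝ) 2 := by norm_num
  have hm1 : (1 : ℝ) ∈ Ioo (-2 : ℝ) 2 := by norm_num
  have hsub : ∀ {s}, s ∈ Icc (0 : ℝ) 1 → s ∈ Ioo (-2 : ℝ) 2 := fun hs ↦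
    ⟨by linarith [hs.1], by linarith [hs.2]⟩
  -- The defect is zero near time 0 by infinite-order vanishing; the identity theorem carries this
  -- along the whole ray.
  have hdef : ∀ {k : ℕ} {τ τ' : E × (Fin k → E) → E}, IsTensorOn τ Ω → IsTensorOn τ' Ω' →
      (∀ r u, defect (iterCoordCovDeriv G τ r) (iterCoordCovDeriv G' τ' r) x₀ y₀ A₀ u = 0) →
      ∀ w ∈ Metric.ball (0 : E) ρ, ∀ t ∈ Icc (0 : ℝ) 1, ∀ u,
        defect τ τ' (x₀ + t • w) (P (t, w)) (Q (t, w)) u = 0 := by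
    intro k τ τ' hτ hτ' h0 w hw t ht u
    have a0 : ∀ t, AnalyticAt ℝ (fun s : ℝ ↦ (s, w)) t := fun t ↦
      analyticAt_id.prod analyticAt_const
    have ax : ∀ t, AnalyticAt ℝ (fun s : ℝ ↦ x₀ + s • w) t := fun t ↦
      analyticAt_const.add (analyticAt_id.smul analyticAt_const)
    have aP : ∀ t ∈ Ioo (-2 : ℝ) 2, AnalyticAt ℝ (fun s ↦ P (s, w)) t := fun t ht ↦
      AnalyticAt.fun_comp (f := fun s : ℝ ↦ (s, w)) (H t ht w hw).1 (a0 t)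
    have aQ : ∀ t ∈ Ioo (-2 : ℝ) 2, AnalyticAt ℝ (fun s ↦ Q (s, w)) t := fun t ht ↦
      AnalyticAt.fun_comp (f := fun s : ℝ ↦ (s, w)) (H t ht w hw).2.1 (a0 t)
    have ad : AnalyticOnNhd ℝ (fun s ↦ defect τ τ' (x₀ + s • w) (P (s, w)) (Q (s, w)) u)
        (Ioo (-2) 2) := fun t ht ↦ AnalyticAt.defect (ax t) (aP t ht) (aQ t ht) analyticAt_const
      (hτ.analytic (_, _) ⟨(H t ht w hw).2.2.1, mem_univ _⟩)
      (hτ'.analytic (_, _) ⟨(H t ht w hw).2.2.2.1, mem_univ _⟩)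
    obtain ⟨-, -, hx0, hP0Ω, hP0, hQ0, -⟩ := H 0 hm0 w hw
    have hev := eventually_defect_eq_zero hΩ hΩ' hG hG' (ax 0) (aP 0 hm0) (aQ 0 hm0) hx0 hP0Ω
      (by filter_upwards [isOpen_Ioo.mem_nhds hm0] with s hs using (H s hs w hw).2.2.2.2.2.2)
      hτ hτ' (by simpa [hP0, hQ0] using h0) u
    exact ad.eqOn_zero_of_preconnected_of_eventuallyEq_zero isPreconnected_Ioo hm0 hev (hsub ht)
  have hF := fun (w : E) (hw : w ∈ Metric.ball (0 : E) ρ) (h : E) ↦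
    fderiv_radial_eq hG hG' H hw (hdef (isTensorOn_coordTorsion hG) (isTensorOn_coordTorsion hG') hT w hw)
      (hdef (isTensorOn_coordCurvature hG) (isTensorOn_coordCurvature hG') hR w hw) h
      (t := 1) (by norm_num)
  have hball : ∀ᶠ x in 𝓝 x₀, x - x₀ ∈ Metric.ball (0 : E) ρ := by
    have : Tendsto (fun x : E ↦ x - x₀) (𝓝 x₀) (𝓝 0) := Continuous.tendsto' (by fun_prop) _ _ (by simp)
    exact this.eventually (Metric.ball_mem_nhds 0 hρ)
  have hshift : ∀ x : E, HasFDerivAt (fun x : E ↦ ((1 : ℝ), x - x₀))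
      (ContinuousLinearMap.inr ℝ ℝ E) x := fun x ↦
    ((hasFDerivAt_const (1 : ℝ) x).prodMk ((hasFDerivAt_id x).sub_const x₀)).congr_fderiv (by ext <;> simp)
  have hd1 : ∀ x, x - x₀ ∈ Metric.ball (0 : E) ρ →
      fderiv ℝ (fun x ↦ P (1, x - x₀)) x = Q (1, x - x₀) := by
    intro x hx
    have h1 : HasFDerivAt (fun x ↦ P (1, x - x₀)) _ x :=
      (H 1 hm1 _ hx).1.differentiableAt.hasFDerivAt.comp x (hshift x)
    rw [h1.fderiv]
    ext h
    simpa using (hF _ hx h).1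
  have h0ρ : (0 : E) ∈ Metric.ball (0 : E) ρ := Metric.mem_ball_self hρ
  have hP1 : P (1, 0) = y₀ := by
    have := eqOn_Ioo_of_hasDerivAt_eq (f := fun s ↦ P (s, 0)) (g := fun _ ↦ y₀) (f' := fun _ ↦ 0)
      (fun t ht ↦ ((H t ht 0 h0ρ).2.2.2.2.2.2.hF).congr_deriv (by simp))
      (fun t _ ↦ hasDerivAt_const t _) hm0 (H 0 hm0 0 h0ρ).2.2.2.2.1
    exact this 1 hm1
  have hQ1 : Q (1, 0) = A₀ := by
    have := eqOn_Ioo_of_hasDerivAt_eq (f := fun s ↦ Q (s, 0)) (g := fun _ ↦ A₀) (f' := fun _ ↦ 0)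
      (fun t ht ↦ ((H t ht 0 h0ρ).2.2.2.2.2.2.hA).congr_deriv (by simp))
      (fun t _ ↦ hasDerivAt_const t _) hm0 (H 0 hm0 0 h0ρ).2.2.2.2.2.1
    exact this 1 hm1
  -- The value at x is the time-one endpoint of the ray with velocity x - x₀. The first radial
  -- identity says that Q is its derivative, and the second then becomes the affine equation.
  refine ⟨fun x ↦ P (1, x - x₀), ?_, by simpa using hP1, ?_, ?_⟩
  · exact AnalyticAt.fun_comp (f := fun x : E ↦ ((1 : ℝ), x - x₀))
      (by simpa using (H 1 hm1 0 h0ρ).1) (analyticAt_const.prod (analyticAt_id.sub analyticAt_const))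
  · rw [hd1 x₀ (by simpa using h0ρ)]
    simpa using hQ1
  · filter_upwards [hball.eventually_nhds] with x hx u v
    have hx0 := hx.self_of_nhds
    have e1 : fderiv ℝ (fun x ↦ P (1, x - x₀)) =ᶠ[𝓝 x] fun x ↦ Q (1, x - x₀) := hx.mono hd1
    have h1 : HasFDerivAt (fun x ↦ Q (1, x - x₀)) _ x :=
      (H 1 hm1 _ hx0).2.1.differentiableAt.hasFDerivAt.comp x (hshift x)
    rw [e1.fderiv_eq, h1.fderiv, hd1 x hx0]
    have h2 := DFunLike.congr_fun (hF _ hx0 u).2 v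
    simp at h2 ⊢
    rw [h2]
    abel

/-- The parity condition yields a local affine symmetry. -/
theorem CoordParity.exists_affineEq (hΩ : IsOpen Ω) (hG : AnalyticOnNhd ℝ G Ω) {x₀ : E}
    (hx₀ : x₀ ∈ Ω) (h : CoordParity G x₀) :
    ∃ f : E → E, AnalyticAt ℝ f x₀ ∧ f x₀ = x₀ ∧ fderiv ℝ f x₀ = -ContinuousLinearMap.id ℝ E ∧
      ∀ᶠ x in 𝓝 x₀, AffineEq G G f x :=
  AffineSymmetry.exists_affineEq hΩ hΩ hG hG hx₀ hx₀ _
    (fun r ↦ (h.defect_eq_zero hΩ hG hx₀ r).1) (fun r ↦ (h.defect_eq_zero hΩ hG hx₀ r).2)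

end Existence

/-! ### Tangent coordinates and derivatives in charts. -/

section Charts
variable {E : Type*} [NormedAddCommGroup E] [NormedSpace ℝ E]
  {M : Type*} [TopologicalSpace M] [ChartedSpace E M] [IsManifold 𝓘(ℝ, E) ω M]
  {F : Type*} [NormedAddCommGroup F] [NormedSpace ℝ F]

/-- Coordinates of tangent vectors at `x`, in the chart around `c`. -/
def coord (c x : M) : TangentSpace 𝓘(ℝ, E) x →L[ℝ] E :=
  (trivializationAt E (TangentSpace 𝓘(ℝ, E) : M → Type _) c).continuousLinearMapAt ℝ x

/-- The tangent vector at `x` with the given coordinates in the chart around `c`. -/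
def coordSymm (c x : M) : E →L[ℝ] TangentSpace 𝓘(ℝ, E) x :=
  (trivializationAt E (TangentSpace 𝓘(ℝ, E) : M → Type _) c).symmL ℝ x

variable {c x : M}

lemma coord_apply (hx : x ∈ (chartAt E c).source) (v : TangentSpace 𝓘(ℝ, E) x) :
    coord c x v = (trivializationAt E (TangentSpace 𝓘(ℝ, E) : M → Type _) c
      (⟨x, v⟩ : TangentBundle 𝓘(ℝ, E) M)).2 :=
  Bundle.Trivialization.continuousLinearMapAt_apply_of_mem _ _ hx _

lemma coordSymm_apply (hx : x ∈ (chartAt E c).source) (v : E) :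
    (coordSymm c x v : TangentSpace 𝓘(ℝ, E) x) =
      (trivializationAt E (TangentSpace 𝓘(ℝ, E) : M → Type _) c).symm x v :=
  Bundle.Trivialization.symmL_apply _ hx v

lemma coordSymm_coord (hx : x ∈ (chartAt E c).source) (v : TangentSpace 𝓘(ℝ, E) x) :
    coordSymm c x (coord c x v) = v :=
  Bundle.Trivialization.symmL_continuousLinearMapAt _ hx v

lemma coord_coordSymm (hx : x ∈ (chartAt E c).source) (v : E) :
    coord c x (coordSymm c x v) = v :=
  Bundle.Trivialization.continuousLinearMapAt_symmL _ hx v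

lemma coord_injective (hx : x ∈ (chartAt E c).source) :
    Function.Injective (coord c x : TangentSpace 𝓘(ℝ, E) x → E) :=
  Function.LeftInverse.injective (coordSymm_coord hx)

lemma coord_eq_mfderiv (hx : x ∈ (chartAt E c).source) :
    (coord c x : TangentSpace 𝓘(ℝ, E) x →L[ℝ] E) = mfderiv 𝓘(ℝ, E) 𝓘(ℝ, E) (chartAt E c) x := by
  have := TangentBundle.continuousLinearMapAt_trivializationAt (𝕜 := ℝ) (I := 𝓘(ℝ, E)) hx
  rw [coord, this]
  simp
  rfl

lemma coordSymm_eq_mfderiv (hx : x ∈ (chartAt E c).source) :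
    (coordSymm c x : E →L[ℝ] TangentSpace 𝓘(ℝ, E) x) =
      mfderiv 𝓘(ℝ, E) 𝓘(ℝ, E) (chartAt E c).symm (chartAt E c x) := by
  have := TangentBundle.symmL_trivializationAt (𝕜 := ℝ) (I := 𝓘(ℝ, E)) hx
  rw [coordSymm, this]
  simp
  rfl

lemma contMDiffAt_chart {n : ℕ∞ω} (hx : x ∈ (chartAt E c).source) :
    ContMDiffAt 𝓘(ℝ, E) 𝓘(ℝ, E) n (chartAt E c) x :=
  (contMDiffAt_of_mem_maximalAtlas (IsManifold.chart_mem_maximalAtlas (n := ω) c) hx).of_le le_top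

lemma contMDiffAt_chart_symm {n : ℕ∞ω} {y : E} (hy : y ∈ (chartAt E c).target) :
    ContMDiffAt 𝓘(ℝ, E) 𝓘(ℝ, E) n (chartAt E c).symm y :=
  (contMDiffAt_symm_of_mem_maximalAtlas (IsManifold.chart_mem_maximalAtlas (n := ω) c) hy).of_le
    le_top

variable {n : ℕ∞ω} {g : M → F}
  {F' : Type*} [NormedAddCommGroup F'] [NormedSpace ℝ F']
  {N : Type*} [TopologicalSpace N] [ChartedSpace F' N]

lemma contMDiffAt_iff_contDiffAt_chart (hx : x ∈ (chartAt E c).source) :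
    ContMDiffAt 𝓘(ℝ, E) 𝓘(ℝ, F) n g x ↔ ContDiffAt ℝ n (g ∘ (chartAt E c).symm) (chartAt E c x) := by
  rw [← contMDiffAt_iff_contDiffAt]
  have hl := (chartAt E c).left_inv hx
  constructor
  · intro h
    refine ContMDiffAt.comp _ (by rwa [hl]) (contMDiffAt_chart_symm ((chartAt E c).map_source hx))
  · intro h
    have := h.comp x (contMDiffAt_chart hx)
    refine this.congr_of_eventuallyEq ?_
    filter_upwards [(chartAt E c).open_source.mem_nhds hx] with y hy
    simp [(chartAt E c).left_inv hy]

lemma mdifferentiableAt_iff_differentiableAt_chart (hx : x ∈ (chartAt E c).source) :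
    MDifferentiableAt 𝓘(ℝ, E) 𝓘(ℝ, F) g x ↔
      DifferentiableAt ℝ (g ∘ (chartAt E c).symm) (chartAt E c x) := by
  rw [← mdifferentiableAt_iff_differentiableAt]
  have hl := (chartAt E c).left_inv hx
  constructor
  · intro h
    exact MDifferentiableAt.comp _ (by rwa [hl])
      ((contMDiffAt_chart_symm (n := 1) ((chartAt E c).map_source hx)).mdifferentiableAt one_ne_zero)
  · intro h
    have := h.comp x ((contMDiffAt_chart (n := 1) hx).mdifferentiableAt one_ne_zero)
    refine this.congr_of_eventuallyEq ?_
    filter_upwards [(chartAt E c).open_source.mem_nhds hx] with y hy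
    simp [(chartAt E c).left_inv hy]

lemma mvfderiv_eq_fderiv_chart (hx : x ∈ (chartAt E c).source) (hg : MDifferentiableAt 𝓘(ℝ, E) 𝓘(ℝ, F) g x)
    (v : TangentSpace 𝓘(ℝ, E) x) :
    mvfderiv 𝓘(ℝ, E) g x v = fderiv ℝ (g ∘ (chartAt E c).symm) (chartAt E c x) (coord c x v) := by
  have h1 : MDifferentiableAt 𝓘(ℝ, E) 𝓘(ℝ, F) (g ∘ (chartAt E c).symm) (chartAt E c x) :=
    ((mdifferentiableAt_iff_differentiableAt_chart hx).1 hg).mdifferentiableAt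
  have h2 : g =ᶠ[𝓝 x] (g ∘ (chartAt E c).symm) ∘ (chartAt E c) := by
    filter_upwards [(chartAt E c).open_source.mem_nhds hx] with y hy
    simp [(chartAt E c).left_inv hy]
  have h3 := mfderiv_comp x h1 ((contMDiffAt_chart (n := 1) hx).mdifferentiableAt one_ne_zero)
  have h4 : mfderiv 𝓘(ℝ, E) 𝓘(ℝ, F) g x v =
      mfderiv 𝓘(ℝ, E) 𝓘(ℝ, F) ((g ∘ (chartAt E c).symm) ∘ (chartAt E c)) x v := by
    rw [h2.mfderiv_eq]
    rfl
  change mfderiv 𝓘(ℝ, E) 𝓘(ℝ, F) g x v = _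
  rw [h4, h3, coord_eq_mfderiv hx, mfderiv_eq_fderiv]
  rfl

lemma mvfderiv_chart_comp {f : N → M} {t : N} (hx : f t ∈ (chartAt E c).source)
    (hf : MDifferentiableAt 𝓘(ℝ, F') 𝓘(ℝ, E) f t) (v : TangentSpace 𝓘(ℝ, F') t) :
    mvfderiv 𝓘(ℝ, F') (chartAt E c ∘ f) t v = coord c (f t) (mfderiv 𝓘(ℝ, F') 𝓘(ℝ, E) f t v) := by
  have h3 := mfderiv_comp t ((contMDiffAt_chart (n := 1) hx).mdifferentiableAt one_ne_zero) hf
  change mfderiv 𝓘(ℝ, F') 𝓘(ℝ, E) (chartAt E c ∘ f) t v = _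
  rw [h3, coord_eq_mfderiv hx]
  rfl

end Charts

/-! ### Vector fields in charts. -/

section VectorFields
variable {E : Type*} [NormedAddCommGroup E] [NormedSpace ℝ E]
  {M : Type*} [TopologicalSpace M] [ChartedSpace E M] [IsManifold 𝓘(ℝ, E) ω M]
  {c x : M} {n : ℕ∞ω} {X Y : VField E M}

/-- A vector field read in the chart around `c`. -/
def localRep (c : M) (X : VField E M) : E → E := fun y ↦
  coord c ((chartAt E c).symm y) (X ((chartAt E c).symm y))

/-- The vector field on the chart domain around `c` with constant coordinates `v`. -/
def coordField (c : M) (v : E) : VField E M := fun x ↦ coordSymm c x v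

lemma localRep_chart (hx : x ∈ (chartAt E c).source) :
    localRep c X (chartAt E c x) = coord c x (X x) := by
  have key : ∀ y, y = x → coord c y (X y) = coord c x (X x) := by
    rintro _ rfl; rfl
  exact key _ ((chartAt E c).left_inv hx)

instance : ContMDiffVectorBundle ω E (TangentSpace 𝓘(ℝ, E) : M → Type _) 𝓘(ℝ, E) :=
  TangentBundle.contMDiffVectorBundle (n := ω)

lemma contMDiffAt_field_iff (hx : x ∈ (chartAt E c).source) :
    ContMDiffAt 𝓘(ℝ, E) (𝓘(ℝ, E).prod 𝓘(ℝ, E)) n (fun x ↦ (⟨x, X x⟩ : TangentBundle 𝓘(ℝ, E) M)) x ↔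
      ContDiffAt ℝ n (localRep c X) (chartAt E c x) := by
  have : ContMDiffVectorBundle n E (TangentSpace 𝓘(ℝ, E) : M → Type _) 𝓘(ℝ, E) :=
    ContMDiffVectorBundle.of_le (n := ω) le_top
  rw [Bundle.Trivialization.contMDiffAt_section_iff
    (e := trivializationAt E (TangentSpace 𝓘(ℝ, E) : M → Type _) c) (by exact hx),
    contMDiffAt_iff_contDiffAt_chart hx]
  have h : localRep c X =ᶠ[𝓝 (chartAt E c x)] ((fun x ↦ (trivializationAt E
      (TangentSpace 𝓘(ℝ, E) : M → Type _) c (⟨x, X x⟩ : TangentBundle 𝓘(ℝ, E) M)).2) ∘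
        (chartAt E c).symm) := by
    filter_upwards [(chartAt E c).open_target.mem_nhds ((chartAt E c).map_source hx)] with y hy
    exact coord_apply ((chartAt E c).map_target hy) _
  exact ⟨fun H ↦ H.congr_of_eventuallyEq h, fun H ↦ H.congr_of_eventuallyEq h.symm⟩

lemma mdifferentiableAt_field_iff (hx : x ∈ (chartAt E c).source) :
    MDifferentiableAt 𝓘(ℝ, E) (𝓘(ℝ, E).prod 𝓘(ℝ, E))
      (fun x ↦ (⟨x, X x⟩ : TangentBundle 𝓘(ℝ, E) M)) x ↔
      DifferentiableAt ℝ (localRep c X) (chartAt E c x) := by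
  have : ContMDiffVectorBundle 1 E (TangentSpace 𝓘(ℝ, E) : M → Type _) 𝓘(ℝ, E) :=
    ContMDiffVectorBundle.of_le (n := ω) le_top
  rw [Bundle.Trivialization.mdifferentiableAt_section_iff
    (e := trivializationAt E (TangentSpace 𝓘(ℝ, E) : M → Type _) c) _ _ (by exact hx),
    mdifferentiableAt_iff_differentiableAt_chart hx]
  refine Filter.EventuallyEq.differentiableAt_iff ?_
  filter_upwards [(chartAt E c).open_target.mem_nhds ((chartAt E c).map_source hx)] with y hy
  exact (coord_apply ((chartAt E c).map_target hy) _).symm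

lemma contDiffOn_field_iff {U : Set M} (hU : IsOpen U) (hUc : U ⊆ (chartAt E c).source) :
    X.ContDiffOn n U ↔ ∀ x ∈ U, ContDiffAt ℝ n (localRep c X) (chartAt E c x) := by
  refine ⟨fun h x hx ↦ (contMDiffAt_field_iff (hUc hx)).1 ((h x hx).contMDiffAt (hU.mem_nhds hx)),
    fun h x hx ↦ ((contMDiffAt_field_iff (hUc hx)).2 (h x hx)).contMDiffWithinAt⟩

lemma localRep_coordField (v : E) {y : E} (hy : y ∈ (chartAt E c).target) :
    localRep c (coordField c v) y = v :=
  coord_coordSymm ((chartAt E c).map_target hy) v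

lemma contDiffOn_coordField (v : E) : (coordField c v : VField E M).ContDiffOn n (chartAt E c).source := by
  refine (contDiffOn_field_iff (chartAt E c).open_source subset_rfl).2 fun x hx ↦ ?_
  refine (contDiffAt_const (c := v)).congr_of_eventuallyEq ?_
  filter_upwards [(chartAt E c).open_target.mem_nhds ((chartAt E c).map_source hx)] with y hy
  exact localRep_coordField v hy

end VectorFields

/-! ### Connections and Lie brackets in charts. -/

section Christoffel
variable {E : Type*} [NormedAddCommGroup E] [NormedSpace ℝ E] [FiniteDimensional ℝ E]
  {M : Type*} [TopologicalSpace M] [ChartedSpace E M] [IsManifold 𝓘(ℝ, E) ω M]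
  {cov : Connection E M} {c x : M} {n : ℕ∞ω} {X Y : VField E M}

/-- The derivative of a coordinate vector field of the chart around `c`, in coordinates. -/
def covCoordField (cov : Connection E M) (c : M) (w : E) (x : M) : E →L[ℝ] E :=
  (coord c x) ∘L (cov (coordField c w) x) ∘L (coordSymm c x)

/-- The Christoffel symbols of a connection in the chart around `c`. -/
def christoffel (cov : Connection E M) (c : M) (y : E) : E →L[ℝ] E →L[ℝ] E :=
  ∑ i, (ContinuousLinearMap.smulRightL ℝ E E
      (LinearMap.toContinuousLinearMap ((Module.finBasis ℝ E).coord i))) ∘L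
    (covCoordField cov c (Module.finBasis ℝ E i) ((chartAt E c).symm y))

lemma christoffel_apply (y v w : E) : christoffel cov c y v w =
    ∑ i, (Module.finBasis ℝ E).repr w i •
      covCoordField cov c (Module.finBasis ℝ E i) ((chartAt E c).symm y) v := by
  simp [christoffel]

/-- The symbols are a finite sum over covariant derivatives of constant coordinate fields, so the
hypothesis is applied to these fields on the chart domain and read in the Hom bundle. -/
lemma analyticOnNhd_christoffel (hcov : IsRealAnalytic cov) (c : M) :
    AnalyticOnNhd ℝ (christoffel cov c) (chartAt E c).target := by
  intro y hy
  have hx := (chartAt E c).map_target hy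
  suffices H : ∀ w, AnalyticAt ℝ (fun y ↦ covCoordField cov c w ((chartAt E c).symm y)) y by
    refine Finset.analyticAt_fun_sum _ fun i _ ↦ ?_
    have := ((contDiffAt_const (c := ContinuousLinearMap.smulRightL ℝ E E
      (LinearMap.toContinuousLinearMap ((Module.finBasis ℝ E).coord i)))).clm_comp
        ((H (Module.finBasis ℝ E i)).contDiffAt (n := ω)))
    exact this.analyticAt
  intro w
  have h1 := (hcov _ (chartAt E c).open_source).contMDiff (σ := coordField c w)
    (contDiffOn_coordField w)
  have h2 := (h1 _ hx).contMDiffAt ((chartAt E c).open_source.mem_nhds hx)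
  rw [Bundle.Trivialization.contMDiffAt_section_iff
    (e := trivializationAt (E →L[ℝ] E) (fun x : M ↦ TangentSpace 𝓘(ℝ, E) x →L[ℝ] TangentSpace 𝓘(ℝ, E) x) c)
    (by rw [hom_trivializationAt_baseSet]; exact ⟨hx, hx⟩), contMDiffAt_iff_contDiffAt_chart hx,
    (chartAt E c).right_inv hy] at h2
  exact h2.analyticAt

lemma IsCovariantDerivativeOn.sum_smul {ι : Type*} (s : Finset ι) (y : ι → M → ℝ) (e : ι → VField E M)
    (cov : Connection E M) {x : M} (hy : ∀ i, MDifferentiableAt 𝓘(ℝ, E) 𝓘(ℝ, ℝ) (y i) x)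
    (he : ∀ i, MDifferentiableAt 𝓘(ℝ, E) (𝓘(ℝ, E).prod 𝓘(ℝ, E))
      (fun x ↦ (⟨x, e i x⟩ : TangentBundle 𝓘(ℝ, E) M)) x) :
    cov (∑ i ∈ s, y i • e i) x = ∑ i ∈ s, (y i x • cov (e i) x + (mvfderiv 𝓘(ℝ, E) (y i) x).smulRight (e i x))
    ∧ MDifferentiableAt 𝓘(ℝ, E) (𝓘(ℝ, E).prod 𝓘(ℝ, E))
      (fun x ↦ (⟨x, (∑ i ∈ s, y i • e i : VField E M) x⟩ : TangentBundle 𝓘(ℝ, E) M)) x := by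
  classical
  induction s using Finset.induction_on with
  | empty =>
    simp only [Finset.sum_empty]
    exact ⟨cov.isCovariantDerivativeOnUniv.zero, Bundle.mdifferentiableAt_zeroSection ..⟩
  | insert i s hi ih =>
    simp only [Finset.sum_insert hi]
    have h1 := (hy i).smul_section (he i)
    refine ⟨?_, mdifferentiableAt_add_section h1 ih.2⟩
    rw [cov.isCovariantDerivativeOnUniv.add h1 ih.2, ih.1,
      cov.isCovariantDerivativeOnUniv.leibniz (he i) (hy i)]

lemma mdifferentiableAt_coordField (v : E) (hx : x ∈ (chartAt E c).source) :
    MDifferentiableAt 𝓘(ℝ, E) (𝓘(ℝ, E).prod 𝓘(ℝ, E))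
      (fun x ↦ (⟨x, coordField c v x⟩ : TangentBundle 𝓘(ℝ, E) M)) x :=
  ((contDiffOn_coordField (n := 1) v x hx).contMDiffAt
    ((chartAt E c).open_source.mem_nhds hx)).mdifferentiableAt one_ne_zero

/-- A covariant derivative in coordinates. -/
lemma coord_cov (hx : x ∈ (chartAt E c).source)
    (hY : MDifferentiableAt 𝓘(ℝ, E) (𝓘(ℝ, E).prod 𝓘(ℝ, E))
      (fun x ↦ (⟨x, Y x⟩ : TangentBundle 𝓘(ℝ, E) M)) x) (v : TangentSpace 𝓘(ℝ, E) x) :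
    coord c x (cov Y x v) = fderiv ℝ (localRep c Y) (chartAt E c x) (coord c x v)
      + christoffel cov c (chartAt E c x) (coord c x v) (coord c x (Y x)) := by
  set b := Module.finBasis ℝ E
  set y : Fin (Module.finrank ℝ E) → M → ℝ := fun i x ↦ b.repr (coord c x (Y x)) i
  have hYd := (mdifferentiableAt_field_iff hx).1 hY
  have hcoe : ∀ i, (y i ∘ (chartAt E c).symm) = fun p ↦
      LinearMap.toContinuousLinearMap (b.coord i) (localRep c Y p) := fun i ↦ rfl
  have hy' : ∀ i, HasFDerivAt (y i ∘ (chartAt E c).symm)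
      ((LinearMap.toContinuousLinearMap (b.coord i)) ∘L (fderiv ℝ (localRep c Y) (chartAt E c x)))
      (chartAt E c x) := fun i ↦ by
    rw [hcoe]
    exact (LinearMap.toContinuousLinearMap (b.coord i)).hasFDerivAt.comp _ hYd.hasFDerivAt
  have hy : ∀ i, MDifferentiableAt 𝓘(ℝ, E) 𝓘(ℝ, ℝ) (y i) x := fun i ↦
    (mdifferentiableAt_iff_differentiableAt_chart hx).2 (hy' i).differentiableAt
  obtain ⟨h1, h2⟩ := IsCovariantDerivativeOn.sum_smul Finset.univ y (fun i ↦ coordField c (b i)) cov hy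
    (fun i ↦ mdifferentiableAt_coordField (b i) hx)
  have h3 : cov Y x = cov (∑ i, y i • coordField c (b i)) x := by
    refine cov.isCovariantDerivativeOnUniv.congr_of_eventuallyEq hY h2 univ_mem ?_
    filter_upwards [(chartAt E c).open_source.mem_nhds hx] with p hp
    refine coord_injective hp ?_
    simp only [Finset.sum_apply, Pi.smul_apply', map_sum, map_smul, coordField, coord_coordSymm hp, y]
    exact (b.sum_repr _).symm
  rw [h3, h1, christoffel_apply, (chartAt E c).left_inv hx]
  simp only [_root_.sum_apply, add_apply, smul_apply,
    ContinuousLinearMap.smulRight_apply, map_sum, map_add, map_smul, coordField, coord_coordSymm hx,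
    Finset.sum_add_distrib, covCoordField, ContinuousLinearMap.comp_apply, coordSymm_coord hx]
  rw [add_comm]
  congr 1
  rw [← b.sum_repr (fderiv ℝ (localRep c Y) (chartAt E c x) (coord c x v))]
  refine Finset.sum_congr rfl fun i _ ↦ ?_
  rw [mvfderiv_eq_fderiv_chart hx (hy i), (hy' i).fderiv]
  rfl

lemma localRep_nabla {y : E} (hy : y ∈ (chartAt E c).target)
    (hY : DifferentiableAt ℝ (localRep c Y) y) :
    localRep c (nabla cov X Y) y = fderiv ℝ (localRep c Y) y (localRep c X y)
      + christoffel cov c y (localRep c X y) (localRep c Y y) := by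
  have hx := (chartAt E c).map_target hy
  have h := coord_cov (cov := cov) (Y := Y) hx ((mdifferentiableAt_field_iff hx).2
    (by rwa [(chartAt E c).right_inv hy])) (X ((chartAt E c).symm y))
  rw [(chartAt E c).right_inv hy] at h
  exact h

lemma localRep_sub (y : E) : localRep c (X - Y) y = localRep c X y - localRep c Y y := by
  simp [localRep]

lemma localRep_sum {ι : Type*} (s : Finset ι) (X : ι → VField E M) (y : E) :
    localRep c (∑ i ∈ s, X i) y = ∑ i ∈ s, localRep c (X i) y := by
  simp [localRep]

/-- Reading a field in a chart is pulling it back along the inverse chart, and brackets commute with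
pullback. -/
lemma localRep_mlieBracket {y : E} (hy : y ∈ (chartAt E c).target)
    (hX : DifferentiableAt ℝ (localRep c X) y) (hY : DifferentiableAt ℝ (localRep c Y) y) :
    localRep c (VectorField.mlieBracket 𝓘(ℝ, E) X Y) y =
      fderiv ℝ (localRep c Y) y (localRep c X y) - fderiv ℝ (localRep c X) y (localRep c Y y) := by
  have hx := (chartAt E c).map_target hy
  have hinv : ∀ (Z : VField E M) (p : E), p ∈ (chartAt E c).target →
      VectorField.mpullback 𝓘(ℝ, E) 𝓘(ℝ, E) (chartAt E c).symm Z p = localRep c Z p := by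
    intro Z p hp
    have hpx := (chartAt E c).map_target hp
    rw [VectorField.mpullback_apply]
    have h1 := coordSymm_eq_mfderiv hpx
    rw [(chartAt E c).right_inv hp] at h1
    rw [← h1]
    let L : E ≃L[ℝ] TangentSpace 𝓘(ℝ, E) ((chartAt E c).symm p) :=
      ContinuousLinearEquiv.equivOfInverse (coordSymm c ((chartAt E c).symm p))
        (coord c ((chartAt E c).symm p)) (coord_coordSymm hpx) (coordSymm_coord hpx)
    exact congrArg (fun T : TangentSpace 𝓘(ℝ, E) ((chartAt E c).symm p) →L[ℝ] E ↦
      T (Z ((chartAt E c).symm p))) (ContinuousLinearMap.inverse_equiv L)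
  have h := VectorField.mpullback_mlieBracket (I := 𝓘(ℝ, E)) (I' := 𝓘(ℝ, E))
    (f := (chartAt E c).symm) (V := X) (W := Y) (x₀ := y) (n := 2)
    ((mdifferentiableAt_field_iff hx).2 (by rwa [(chartAt E c).right_inv hy]))
    ((mdifferentiableAt_field_iff hx).2 (by rwa [(chartAt E c).right_inv hy]))
    (contMDiffAt_chart_symm hy) (by simp)
  rw [hinv _ y hy] at h
  have hb : ∀ V W : E → E, VectorField.mlieBracket 𝓘(ℝ, E) V W y = VectorField.lieBracket ℝ V W y := by
    intro V W
    have h1 := congrFun (VectorField.mlieBracketWithin_eq_lieBracketWithin (𝕜 := ℝ) (V := V) (W := W)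
      (s := univ)) y
    exact h1.trans (congrFun (VectorField.lieBracketWithin_univ (𝕜 := ℝ) (V := V) (W := W)) y)
  have hev : ∀ Z : VField E M, VectorField.mpullback 𝓘(ℝ, E) 𝓘(ℝ, E) (chartAt E c).symm Z =ᶠ[𝓝 y]
      localRep c Z := fun Z ↦ by
    filter_upwards [(chartAt E c).open_target.mem_nhds hy] with p hp using hinv Z p hp
  exact h.trans ((hb _ _).trans (Filter.EventuallyEq.lieBracket_vectorField_eq (𝕜 := ℝ) (E := E)
    (hev X) (hev Y)))

end Christoffel
-- Torsion, curvature and their covariant derivatives in charts.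
section Tensors
variable {E : Type*} [NormedAddCommGroup E] [NormedSpace ℝ E] [FiniteDimensional ℝ E]
  {M : Type*} [TopologicalSpace M] [ChartedSpace E M] [IsManifold 𝓘(ℝ, E) ω M]
  {cov : Connection E M} {c x : M} {n : ℕ∞ω} {X Y : VField E M}

lemma contDiffOn_localRep_nabla (hcov : IsRealAnalytic cov) {V : Set E} (hV : IsOpen V)
    (hVc : V ⊆ (chartAt E c).target) (hX : ContDiffOn ℝ ∞ (localRep c X) V)
    (hY : ContDiffOn ℝ ∞ (localRep c Y) V) : ContDiffOn ℝ ∞ (localRep c (nabla cov X Y)) V := by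
  have hΓ : ContDiffOn ℝ ∞ (christoffel cov c) V := fun y hy ↦
    ((analyticOnNhd_christoffel hcov c y (hVc hy)).contDiffAt).contDiffWithinAt
  refine ContDiffOn.congr (f := fun y ↦ fderiv ℝ (localRep c Y) y (localRep c X y)
      + christoffel cov c y (localRep c X y) (localRep c Y y)) ?_ fun y hy ↦
    localRep_nabla (hVc hy) ((hY.contDiffAt (hV.mem_nhds hy)).differentiableAt (by simp))
  exact ((hY.fderiv_of_isOpen hV (by simp)).clm_apply hX).add ((hΓ.clm_apply hX).clm_apply hY)

/-- The operation `T` is given by the tensor field `τ` in the chart around `c`. -/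
def IsRepresentedBy {k : ℕ} (c : M) (T : TensorOp E M k) (τ : E × (Fin k → E) → E) : Prop :=
  ∀ V : Set E, IsOpen V → V ⊆ (chartAt E c).target → ∀ X : Fin k → VField E M,
    (∀ i, ContDiffOn ℝ ∞ (localRep c (X i)) V) →
      ∀ y ∈ V, localRep c (T X) y = τ (y, fun i ↦ localRep c (X i) y)

lemma isRepresentedBy_torsionOp (cov : Connection E M) (c : M) :
    IsRepresentedBy c (torsionOp cov) (coordTorsion (christoffel cov c)) := by
  have : CompleteSpace E := FiniteDimensional.complete ℝ E
  intro V hV hVc X hX y hy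
  have hd : ∀ i, DifferentiableAt ℝ (localRep c (X i)) y := fun i ↦
    ((hX i).contDiffAt (hV.mem_nhds hy)).differentiableAt (by simp)
  have hx := (chartAt E c).map_target (hVc hy)
  have hm : ∀ i, MDifferentiableAt 𝓘(ℝ, E) (𝓘(ℝ, E).prod 𝓘(ℝ, E))
      (fun x ↦ (⟨x, X i x⟩ : TangentBundle 𝓘(ℝ, E) M)) ((chartAt E c).symm y) := fun i ↦
    (mdifferentiableAt_field_iff hx).2 (by rw [(chartAt E c).right_inv (hVc hy)]; exact hd i)
  have h1 : localRep c (torsionOp cov X) y =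
      localRep c (nabla cov (X 0) (X 1) - nabla cov (X 1) (X 0)
        - VectorField.mlieBracket 𝓘(ℝ, E) (X 0) (X 1)) y :=
    congrArg (coord c ((chartAt E c).symm y)) (cov.torsion_apply (hm 0) (hm 1))
  rw [h1, localRep_sub, localRep_sub, localRep_nabla (hVc hy) (hd 1), localRep_nabla (hVc hy) (hd 0),
    localRep_mlieBracket (hVc hy) (hd 0) (hd 1)]
  simp only [coordTorsion]
  abel

/-- Second derivatives of the third field cancel by symmetry, and the first derivatives of the other
two cancel against the bracket term. -/
lemma isRepresentedBy_curvatureOp (hcov : IsRealAnalytic cov) (c : M) :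
    IsRepresentedBy c (curvatureOp cov) (coordCurvature (christoffel cov c)) := by
  have : CompleteSpace E := FiniteDimensional.complete ℝ E
  intro V hV hVc X hX y hy
  have hc : ∀ i, ContDiffAt ℝ ∞ (localRep c (X i)) y := fun i ↦ (hX i).contDiffAt (hV.mem_nhds hy)
  have hd : ∀ i, DifferentiableAt ℝ (localRep c (X i)) y := fun i ↦ (hc i).differentiableAt (by simp)
  have hdd : ∀ i, DifferentiableAt ℝ (fderiv ℝ (localRep c (X i))) y := fun i ↦
    ((hc i).fderiv_right (m := 1) (by norm_cast)).differentiableAt (by simp)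
  have hΓ : DifferentiableAt ℝ (christoffel cov c) y :=
    (analyticOnNhd_christoffel hcov c y (hVc hy)).differentiableAt
  have hn : ∀ i j, DifferentiableAt ℝ (localRep c (nabla cov (X i) (X j))) y := fun i j ↦
    ((contDiffOn_localRep_nabla hcov hV hVc (hX i) (hX j)).contDiffAt
      (hV.mem_nhds hy)).differentiableAt (by simp)
  have hf : ∀ i j v, fderiv ℝ (localRep c (nabla cov (X i) (X j))) y v =
      fderiv ℝ (fderiv ℝ (localRep c (X j))) y v (localRep c (X i) y)
      + fderiv ℝ (localRep c (X j)) y (fderiv ℝ (localRep c (X i)) y v)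
      + (fderiv ℝ (christoffel cov c) y v (localRep c (X i) y) (localRep c (X j) y)
      + christoffel cov c y (fderiv ℝ (localRep c (X i)) y v) (localRep c (X j) y)
      + christoffel cov c y (localRep c (X i) y) (fderiv ℝ (localRep c (X j)) y v)) := by
    intro i j v
    have e : localRep c (nabla cov (X i) (X j)) =ᶠ[𝓝 y] fun y ↦
        fderiv ℝ (localRep c (X j)) y (localRep c (X i) y)
      + christoffel cov c y (localRep c (X i) y) (localRep c (X j) y) := by
      filter_upwards [hV.mem_nhds hy] with p hp
      exact localRep_nabla (hVc hp) (((hX j).contDiffAt (hV.mem_nhds hp)).differentiableAt (by simp))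
    have h1 : HasFDerivAt (fun y ↦ fderiv ℝ (localRep c (X j)) y (localRep c (X i) y)
      + christoffel cov c y (localRep c (X i) y) (localRep c (X j) y)) _ y :=
      ((hdd j).hasFDerivAt.clm_apply (hd i).hasFDerivAt).add
        ((hΓ.hasFDerivAt.clm_apply (hd i).hasFDerivAt).clm_apply (hd j).hasFDerivAt)
    rw [e.fderiv_eq, h1.fderiv]
    simp
    abel
  have hs := (hc 2).isSymmSndFDerivAt (by simp; norm_cast) (localRep c (X 0) y) (localRep c (X 1) y)
  simp only [curvatureOp]
  rw [localRep_sub, localRep_sub, localRep_nabla (hVc hy) (hn 1 2), localRep_nabla (hVc hy) (hn 0 2),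
    localRep_nabla (hVc hy) (hd 2), localRep_nabla (hVc hy) (hd 2), localRep_nabla (hVc hy) (hd 2),
    localRep_mlieBracket (hVc hy) (hd 0) (hd 1), hf, hf, hs]
  simp only [coordCurvature, map_sub, map_add, sub_apply]
  abel

/-- Differentiating the components of the arguments produces exactly the derivative parts of the
subtracted slot terms. The Christoffel parts survive, and are the fibre component in
`coordCovDeriv`. -/
lemma IsRepresentedBy.covDerivOp (hcov : IsRealAnalytic cov) {k : ℕ} {T : TensorOp E M k}
    {τ : E × (Fin k → E) → E} (h : IsRepresentedBy c T τ) (hτ : IsTensorOn τ (chartAt E c).target) :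
    IsRepresentedBy c (covDerivOp cov T) (coordCovDeriv (christoffel cov c) τ) := by
  have : CompleteSpace E := FiniteDimensional.complete ℝ E
  intro V hV hVc X hX y hy
  have ht : ∀ i, ContDiffOn ℝ ∞ (localRep c (Fin.tail X i)) V := fun i ↦ hX i.succ
  have hd : ∀ i, DifferentiableAt ℝ (localRep c (X i)) y := fun i ↦
    ((hX i).contDiffAt (hV.mem_nhds hy)).differentiableAt (by simp)
  have hdt : ∀ i, HasFDerivAt (localRep c (Fin.tail X i)) (fderiv ℝ (localRep c (Fin.tail X i)) y) y :=
    fun i ↦ (hd i.succ).hasFDerivAt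
  have hτd := (hτ.analytic (y, fun i ↦ localRep c (Fin.tail X i) y)
    ⟨hVc hy, mem_univ _⟩).differentiableAt.hasFDerivAt
  have e : localRep c (T (Fin.tail X)) =ᶠ[𝓝 y] fun p ↦ τ (p, fun i ↦ localRep c (Fin.tail X i) p) := by
    filter_upwards [hV.mem_nhds hy] with p hp using h V hV hVc _ ht p hp
  have h1 : HasFDerivAt (fun p ↦ τ (p, fun i ↦ localRep c (Fin.tail X i) p)) _ y :=
    HasFDerivAt.comp (f := fun p ↦ (p, fun i ↦ localRep c (Fin.tail X i) p)) y hτd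
      ((hasFDerivAt_id y).prodMk (hasFDerivAt_pi.2 hdt))
  have hsum : ∀ i, localRep c (T (Function.update (Fin.tail X) i (nabla cov (X 0) (Fin.tail X i)))) y =
      τ (y, Function.update (fun i ↦ localRep c (Fin.tail X i) y) i
        (fderiv ℝ (localRep c (Fin.tail X i)) y (localRep c (X 0) y)
          + christoffel cov c y (localRep c (X 0) y) (localRep c (Fin.tail X i) y))) := by
    intro i
    rw [h V hV hVc _ _ y hy]
    · congr 2
      ext j
      rcases eq_or_ne j i with rfl | hj
      · simp only [Function.update_self]
        exact localRep_nabla (hVc hy) (hdt j).differentiableAt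
      · simp [Function.update_of_ne hj]
    · intro j
      rcases eq_or_ne j i with rfl | hj
      · simp only [Function.update_self]
        exact contDiffOn_localRep_nabla hcov hV hVc (hX 0) (ht j)
      · simpa [Function.update_of_ne hj] using ht j
  simp only [AffineSymmetry.covDerivOp, coordCovDeriv]
  rw [localRep_sub, localRep_nabla (hVc hy) (h1.congr_of_eventuallyEq e).differentiableAt,
    e.self_of_nhds, e.fderiv_eq, h1.fderiv, localRep_sum]
  simp only [hsum]
  rw [← hτ.fderiv_apply_zero (hVc hy), add_sub_right_comm]
  congr 1
  rw [ContinuousLinearMap.comp_apply, ← map_sub]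
  congr 1
  ext i <;> simp [Fin.tail]

lemma IsRepresentedBy.iterCovDerivOp (hcov : IsRealAnalytic cov) {k : ℕ} {T : TensorOp E M k}
    {τ : E × (Fin k → E) → E} (h : IsRepresentedBy c T τ) (hτ : IsTensorOn τ (chartAt E c).target)
    (r : ℕ) : IsRepresentedBy c (iterCovDerivOp cov T r)
      (iterCoordCovDeriv (christoffel cov c) τ r) := by
  have : CompleteSpace E := FiniteDimensional.complete ℝ E
  induction r with
  | zero => exact h
  | succ r ih =>
    exact ih.covDerivOp hcov (hτ.iterCovDeriv (chartAt E c).open_target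
      (analyticOnNhd_christoffel hcov c) r)

/-- Constant coordinate fields realize every tuple of values; conversely, the representation sees
only the values of the fields at the point. -/
lemma IsRepresentedBy.vanishesAt_iff {k : ℕ} {T : TensorOp E M k}
    {τ : E × (Fin k → E) → E} (h : IsRepresentedBy c T τ) (hx : x ∈ (chartAt E c).source) :
    VanishesAt T x ↔ ∀ u, τ (chartAt E c x, u) = 0 := by
  constructor
  · intro H u
    have h1 := H _ (chartAt E c).open_source hx (fun i ↦ coordField c (u i))
      fun i ↦ contDiffOn_coordField _
    have h2 := h _ (chartAt E c).open_target subset_rfl (fun i ↦ coordField c (u i))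
      (fun i ↦ contDiffOn_const.congr fun y hy ↦ localRep_coordField (u i) hy) _
      ((chartAt E c).map_source hx)
    rw [localRep_chart hx, h1, map_zero] at h2
    rw [h2]
    congr 2
    ext i
    rw [localRep_coordField _ ((chartAt E c).map_source hx)]
  · intro H U hU hxU X hX
    refine coord_injective hx ?_
    have h2 := h ((chartAt E c).target ∩ (chartAt E c).symm ⁻¹' U)
      ((chartAt E c).isOpen_inter_preimage_symm hU) inter_subset_left X ?_ (chartAt E c x)
      ⟨(chartAt E c).map_source hx, by simpa [(chartAt E c).left_inv hx] using hxU⟩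
    · rw [localRep_chart hx, H] at h2
      rw [h2, map_zero]
    · rintro i y ⟨hy, hyU⟩
      have := (contMDiffAt_field_iff ((chartAt E c).map_target hy)).1
        ((hX i _ hyU).contMDiffAt (hU.mem_nhds hyU))
      rw [(chartAt E c).right_inv hy] at this
      exact this.contDiffWithinAt

/-- The parity condition in coordinates. -/
theorem parityCondition_iff (hcov : IsRealAnalytic cov) (hx : x ∈ (chartAt E c).source) :
    ParityCondition cov x ↔ CoordParity (christoffel cov c) (chartAt E c x) := by
  have : CompleteSpace E := FiniteDimensional.complete ℝ E
  have hΓ := analyticOnNhd_christoffel hcov c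
  refine forall_congr' fun r ↦ and_congr ?_ ?_
  · exact ((isRepresentedBy_torsionOp cov c).iterCovDerivOp hcov
      (isTensorOn_coordTorsion hΓ) _).vanishesAt_iff hx
  · exact ((isRepresentedBy_curvatureOp hcov c).iterCovDerivOp hcov
      (isTensorOn_coordCurvature hΓ) _).vanishesAt_iff hx

end Tensors

/-! ### Covariant derivatives along maps and the affine equation in charts. -/

section Along
variable {E : Type*} [NormedAddCommGroup E] [NormedSpace ℝ E] [FiniteDimensional ℝ E]
  {M : Type*} [TopologicalSpace M] [ChartedSpace E M] [IsManifold 𝓘(ℝ, E) ω M]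
  {cov : Connection E M} {c c' x : M} {X Y : VField E M}
  {F : Type*} [NormedAddCommGroup F] [NormedSpace ℝ F]
  {N : Type*} [TopologicalSpace N] [ChartedSpace F N]

lemma mvfderiv_congr {W : Type*} [NormedAddCommGroup W] [NormedSpace ℝ W] {g g' : N → W} {t : N}
    (h : g =ᶠ[𝓝 t] g') (v : TangentSpace 𝓘(ℝ, F) t) :
    mvfderiv 𝓘(ℝ, F) g t v = mvfderiv 𝓘(ℝ, F) g' t v := by
  change mfderiv 𝓘(ℝ, F) 𝓘(ℝ, W) g t v = mfderiv 𝓘(ℝ, F) 𝓘(ℝ, W) g' t v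
  rw [h.mfderiv_eq]
  rfl

lemma mvfderiv_clm_apply {W W' : Type*} [NormedAddCommGroup W] [NormedSpace ℝ W]
    [NormedAddCommGroup W'] [NormedSpace ℝ W'] {A : N → W →L[ℝ] W'} {ζ : N → W} {t : N}
    (hA : MDifferentiableAt 𝓘(ℝ, F) 𝓘(ℝ, W →L[ℝ] W') A t)
    (hζ : MDifferentiableAt 𝓘(ℝ, F) 𝓘(ℝ, W) ζ t) (v : TangentSpace 𝓘(ℝ, F) t) :
    mvfderiv 𝓘(ℝ, F) (fun s ↦ A s (ζ s)) t v =
      mvfderiv 𝓘(ℝ, F) A t v (ζ t) + A t (mvfderiv 𝓘(ℝ, F) ζ t v) := by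
  have hb : HasFDerivAt (fun p : (W →L[ℝ] W') × W ↦ p.1 p.2) _ (A t, ζ t) :=
    (hasFDerivAt_fst (p := (A t, ζ t))).clm_apply hasFDerivAt_snd
  have h1 : HasMFDerivAt 𝓘(ℝ, F) 𝓘(ℝ, (W →L[ℝ] W') × W) (fun s ↦ (A s, ζ s)) t
      ((mvfderiv 𝓘(ℝ, F) A t).prod (mvfderiv 𝓘(ℝ, F) ζ t)) :=
    ⟨hA.hasMFDerivAt.1.prodMk hζ.hasMFDerivAt.1, hA.hasMFDerivAt.2.prodMk hζ.hasMFDerivAt.2⟩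
  have h2 := (hb.hasMFDerivAt.comp t h1).mfderiv
  have h3 := DFunLike.congr_fun h2 v
  change mfderiv 𝓘(ℝ, F) 𝓘(ℝ, W') ((fun p : (W →L[ℝ] W') × W ↦ p.1 p.2) ∘ fun s ↦ (A s, ζ s)) t v = _
  refine h3.trans ?_
  exact add_comm _ _

/-- The change of coordinates of tangent vectors at `x`, from the chart around `c` to the chart
around `c'`. -/
def coordChange (c c' x : M) : E →L[ℝ] E := (coord c' x) ∘L (coordSymm c x)

lemma contMDiffAt_coordChange {n : ℕ∞ω} (hx : x ∈ (chartAt E c).source) (hx' : x ∈ (chartAt E c').source) :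
    ContMDiffAt 𝓘(ℝ, E) 𝓘(ℝ, E →L[ℝ] E) n (coordChange c c' : M → E →L[ℝ] E) x := by
  have h := contMDiffAt_coordChangeL (n := ω) (IB := 𝓘(ℝ, E))
    (e := trivializationAt E (TangentSpace 𝓘(ℝ, E) : M → Type _) c)
    (e' := trivializationAt E (TangentSpace 𝓘(ℝ, E) : M → Type _) c') (x := x) hx hx'
  refine (h.of_le le_top).congr_of_eventuallyEq ?_
  filter_upwards [(chartAt E c).open_source.mem_nhds hx, (chartAt E c').open_source.mem_nhds hx']
    with y hy hy'
  ext w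
  refine Eq.trans ?_ (Bundle.Trivialization.coordChangeL_apply (R := ℝ) _ _ ⟨hy, hy'⟩ w).symm
  rw [← coordSymm_apply hy, ← coord_apply hy']
  rfl

/-- The covariant derivative along a map, in the coordinates of any chart. -/
lemma coord_covDerivAlong {f : N → M} {Z : Π t : N, TangentSpace 𝓘(ℝ, E) (f t)} {t : N}
    (hx : f t ∈ (chartAt E c).source) (hf : MDifferentiableAt 𝓘(ℝ, F) 𝓘(ℝ, E) f t)
    (hZ : MDifferentiableAt 𝓘(ℝ, F) 𝓘(ℝ, E) (fun s ↦ coord c (f s) (Z s)) t)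
    (v : TangentSpace 𝓘(ℝ, F) t) :
    coord c (f t) (covDerivAlong cov f Z t v) = mvfderiv 𝓘(ℝ, F) (fun s ↦ coord c (f s) (Z s)) t v
      + christoffel cov c (chartAt E c (f t)) (coord c (f t) (mfderiv 𝓘(ℝ, F) 𝓘(ℝ, E) f t v))
        (coord c (f t) (Z t)) := by
  -- The definition uses the trivialization centred at f t, so the proof compares it with the chart
  -- at c through the transition matrices along f.
  set p := f t with hp
  have hpp : p ∈ (chartAt E p).source := mem_chart_source E p
  set ζ : N → E := fun s ↦ (trivializationAt E (TangentSpace 𝓘(ℝ, E) : M → Type _) p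
    (⟨f s, Z s⟩ : TangentBundle 𝓘(ℝ, E) M)).2 with hζdef
  have hfc : ContinuousAt f t := hf.continuousAt
  have hev : ∀ᶠ s in 𝓝 t, f s ∈ (chartAt E c).source ∧ f s ∈ (chartAt E p).source :=
    hfc.eventually (((chartAt E c).open_source.inter (chartAt E p).open_source).mem_nhds ⟨hx, hpp⟩)
  have hζ1 : ζ =ᶠ[𝓝 t] fun s ↦ coordChange c p (f s) (coord c (f s) (Z s)) := by
    filter_upwards [hev] with s hs
    simp only [hζdef]
    rw [← coord_apply hs.2]
    simp only [coordChange, ContinuousLinearMap.comp_apply, coordSymm_coord hs.1]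
  have hT1 : MDifferentiableAt 𝓘(ℝ, F) 𝓘(ℝ, E →L[ℝ] E) (fun s ↦ coordChange c p (f s)) t :=
    ((contMDiffAt_coordChange (n := 1) hx hpp).mdifferentiableAt one_ne_zero).comp t hf
  have hT2' := (contMDiffAt_coordChange (n := 1) hpp hx).mdifferentiableAt one_ne_zero
  have hT2 : MDifferentiableAt 𝓘(ℝ, F) 𝓘(ℝ, E →L[ℝ] E) (fun s ↦ coordChange p c (f s)) t :=
    hT2'.comp t hf
  have hζ : MDifferentiableAt 𝓘(ℝ, F) 𝓘(ℝ, E) ζ t :=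
    (hT1.clm_apply hZ).congr_of_eventuallyEq hζ1
  have hg : (fun s ↦ coord c (f s) (Z s)) =ᶠ[𝓝 t] fun s ↦ coordChange p c (f s) (ζ s) := by
    filter_upwards [hev] with s hs
    simp only [hζdef]
    rw [← coord_apply hs.2]
    simp only [coordChange, ContinuousLinearMap.comp_apply, coordSymm_coord hs.2]
  have hext : FiberBundle.extend (E := (TangentSpace 𝓘(ℝ, E) : M → Type _)) E (x := f t) (Z t)
      =ᶠ[𝓝 p] (coordField p (ζ t) : VField E M) := by
    filter_upwards [(chartAt E p).open_source.mem_nhds hpp] with y hy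
    exact (coordSymm_apply hy _).symm
  have hcf := mdifferentiableAt_coordField (c := p) (ζ t) hpp
  have hcovext : cov (FiberBundle.extend (E := (TangentSpace 𝓘(ℝ, E) : M → Type _)) E (x := f t) (Z t))
      (f t) = cov (coordField p (ζ t)) p := by
    refine cov.isCovariantDerivativeOnUniv.congr_of_eventuallyEq ?_ hcf univ_mem hext
    exact FiberBundle.mdifferentiableAt_extend _ _ _
  have hval : coordField p (ζ t) p = Z t := by
    simp only [coordField, hζdef]
    rw [← coord_apply hpp, coordSymm_coord hpp]
  have e1 : covDerivAlong cov f Z t v = coordSymm p p (mvfderiv 𝓘(ℝ, F) ζ t v)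
      + cov (coordField p (ζ t)) p (mfderiv 𝓘(ℝ, F) 𝓘(ℝ, E) f t v) := by
    rw [coordSymm_apply hpp, ← hcovext]
    rfl
  rw [e1, map_add, coord_cov hx hcf, hval, ← add_assoc]
  congr 1
  have e2 : mvfderiv 𝓘(ℝ, F) (fun s ↦ coord c (f s) (Z s)) t v =
      mvfderiv 𝓘(ℝ, F) (fun s ↦ coordChange p c (f s) (ζ s)) t v := mvfderiv_congr hg v
  -- The derivative of the transition matrix along f, applied to the frozen coordinates, is the
  -- derivative of the field with constant coordinates in the chart at f t, read in the chart at c.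
  have e3 : mvfderiv 𝓘(ℝ, F) (fun s ↦ coordChange p c (f s)) t v (ζ t) =
      fderiv ℝ (localRep c (coordField p (ζ t))) (chartAt E c p)
        (coord c p (mfderiv 𝓘(ℝ, F) 𝓘(ℝ, E) f t v)) := by
    have h1 := mfderiv_comp_apply t hT2' hf v
    have h2 := mvfderiv_clm_apply hT2' (mdifferentiableAt_const (c := ζ t))
      (mfderiv 𝓘(ℝ, F) 𝓘(ℝ, E) f t v)
    rw [mvfderiv_const] at h2
    have h3 := mvfderiv_eq_fderiv_chart hx (hT2'.clm_apply (mdifferentiableAt_const (c := ζ t)))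
      (mfderiv 𝓘(ℝ, F) 𝓘(ℝ, E) f t v)
    refine (congrArg (fun L : E →L[ℝ] E ↦ L (ζ t)) h1).trans ?_
    simp only [zero_apply, map_zero, add_zero] at h2
    exact h2.symm.trans h3
  rw [e2, mvfderiv_clm_apply hT2 hζ, e3, add_comm]
  rfl

variable [T2Space M] in
/-- A globally smooth vector field with a prescribed value at a point. -/
lemma exists_contMDiff_field (x : M) (v : TangentSpace 𝓘(ℝ, E) x) :
    ∃ X : VField E M, X.ContDiffOn ∞ univ ∧ X x = v := by
  obtain ⟨ψ⟩ : Nonempty (SmoothBumpFunction 𝓘(ℝ, E) x) := inferInstance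
  have : ContMDiffVectorBundle ∞ E (TangentSpace 𝓘(ℝ, E) : M → Type _) 𝓘(ℝ, E) :=
    ContMDiffVectorBundle.of_le (n := ω) le_top
  refine ⟨(ψ : M → ℝ) • coordField x (coord x x v), ?_, ?_⟩
  · exact (ContMDiffOn.smul_section_of_tsupport ψ.contMDiff.contMDiffOn (chartAt E x).open_source
      ψ.tsupport_subset_chartAt_source (contDiffOn_coordField _)).contMDiffOn
  · simp only [Pi.smul_apply', ψ.eq_one, one_smul, coordField]
    exact coordSymm_coord (mem_chart_source E x) v

/-- A map read in charts. -/
def chartRep (c c' : M) (f : M → M) : E → E := chartAt E c' ∘ f ∘ (chartAt E c).symm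

lemma contDiffAt_chartRep {n : ℕ∞ω} {f : M → M} (hx : x ∈ (chartAt E c).source)
    (hfx : f x ∈ (chartAt E c').source) (hf : ContMDiffAt 𝓘(ℝ, E) 𝓘(ℝ, E) n f x) :
    ContDiffAt ℝ n (chartRep c c' f) (chartAt E c x) :=
  (contMDiffAt_iff_contDiffAt_chart (g := chartAt E c' ∘ f) hx).1 ((contMDiffAt_chart hfx).comp x hf)

lemma fderiv_chartRep {f : M → M} (hx : x ∈ (chartAt E c).source)
    (hfx : f x ∈ (chartAt E c').source) (hf : MDifferentiableAt 𝓘(ℝ, E) 𝓘(ℝ, E) f x)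
    (v : TangentSpace 𝓘(ℝ, E) x) :
    fderiv ℝ (chartRep c c' f) (chartAt E c x) (coord c x v) =
      coord c' (f x) (mfderiv 𝓘(ℝ, E) 𝓘(ℝ, E) f x v) := by
  rw [← mvfderiv_chart_comp hfx hf]
  exact (mvfderiv_eq_fderiv_chart hx (((contMDiffAt_chart (n := 1) hfx).mdifferentiableAt
    one_ne_zero).comp x hf) v).symm

/-- The terms containing the derivative of X occur on both sides and cancel. Only the value of X at
the point remains, so the condition is pointwise and tensorial. -/
lemma map_cov_eq_covDerivAlong_iff {f : M → M} (hx : x ∈ (chartAt E c).source)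
    (hfx : f x ∈ (chartAt E c').source) (hf : ContMDiffAt 𝓘(ℝ, E) 𝓘(ℝ, E) ∞ f x)
    (hX : ContMDiffAt 𝓘(ℝ, E) (𝓘(ℝ, E).prod 𝓘(ℝ, E)) ∞
      (fun x ↦ (⟨x, X x⟩ : TangentBundle 𝓘(ℝ, E) M)) x) (v : TangentSpace 𝓘(ℝ, E) x) :
    mfderiv 𝓘(ℝ, E) 𝓘(ℝ, E) f x (cov X x v) =
        covDerivAlong cov f (fun y ↦ mfderiv 𝓘(ℝ, E) 𝓘(ℝ, E) f y (X y)) x v ↔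
      fderiv ℝ (fderiv ℝ (chartRep c c' f)) (chartAt E c x) (coord c x v) (coord c x (X x))
        + christoffel cov c' (chartRep c c' f (chartAt E c x))
          (fderiv ℝ (chartRep c c' f) (chartAt E c x) (coord c x v))
          (fderiv ℝ (chartRep c c' f) (chartAt E c x) (coord c x (X x)))
        = fderiv ℝ (chartRep c c' f) (chartAt E c x)
          (christoffel cov c (chartAt E c x) (coord c x v) (coord c x (X x))) := by
  have hfd : MDifferentiableAt 𝓘(ℝ, E) 𝓘(ℝ, E) f x := hf.mdifferentiableAt (by simp)
  have hfe : ∀ᶠ y in 𝓝 x, MDifferentiableAt 𝓘(ℝ, E) 𝓘(ℝ, E) f y := by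
    have h1 : ContMDiffAt 𝓘(ℝ, E) 𝓘(ℝ, E) 1 f x := hf.of_le (by norm_cast)
    filter_upwards [(contMDiffAt_iff_contMDiffAt_nhds (by simp)).1 h1] with y hy
      using hy.mdifferentiableAt one_ne_zero
  have hXd := hX.mdifferentiableAt (by simp)
  have hXr : DifferentiableAt ℝ (localRep c X) (chartAt E c x) := (mdifferentiableAt_field_iff hx).1 hXd
  have hF : ContDiffAt ℝ ∞ (chartRep c c' f) (chartAt E c x) := contDiffAt_chartRep hx hfx hf
  have hFd : DifferentiableAt ℝ (fderiv ℝ (chartRep c c' f)) (chartAt E c x) :=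
    (hF.fderiv_right (m := 1) (by norm_cast)).differentiableAt one_ne_zero
  have hl : (chartAt E c).symm (chartAt E c x) = x := (chartAt E c).left_inv hx
  have hz : (fun s ↦ coord c' (f s) (mfderiv 𝓘(ℝ, E) 𝓘(ℝ, E) f s (X s))) ∘ (chartAt E c).symm
      =ᶠ[𝓝 (chartAt E c x)]
      fun y ↦ fderiv ℝ (chartRep c c' f) y (localRep c X y) := by
    have ht : Tendsto (chartAt E c).symm (𝓝 (chartAt E c x)) (𝓝 x) := by
      have := (chartAt E c).continuousAt_symm ((chartAt E c).map_source hx)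
      rw [ContinuousAt, hl] at this
      exact this
    filter_upwards [(chartAt E c).open_target.mem_nhds ((chartAt E c).map_source hx), ht.eventually hfe,
      ht.eventually (hfd.continuousAt.eventually ((chartAt E c').open_source.mem_nhds hfx))] with y hy h1 h2
    have := fderiv_chartRep (c := c) ((chartAt E c).map_target hy) h2 h1 (X _)
    rw [(chartAt E c).right_inv hy] at this
    exact this.symm
  have hzd : HasFDerivAt (fun y ↦ fderiv ℝ (chartRep c c' f) y (localRep c X y)) _ (chartAt E c x) :=
    hFd.hasFDerivAt.clm_apply hXr.hasFDerivAt
  have hZ : MDifferentiableAt 𝓘(ℝ, E) 𝓘(ℝ, E)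
      (fun s ↦ coord c' (f s) (mfderiv 𝓘(ℝ, E) 𝓘(ℝ, E) f s (X s))) x :=
    (mdifferentiableAt_iff_differentiableAt_chart hx).2
      (hzd.congr_of_eventuallyEq hz).differentiableAt
  rw [← (coord_injective hfx).eq_iff, coord_covDerivAlong hfx hfd hZ,
    mvfderiv_eq_fderiv_chart hx hZ, hz.fderiv_eq, hzd.fderiv, ← fderiv_chartRep hx hfx hfd,
    ← fderiv_chartRep hx hfx hfd, ← fderiv_chartRep hx hfx hfd, coord_cov hx hXd]
  have hcr : chartRep c c' f (chartAt E c x) = chartAt E c' (f x) := by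
    simp [chartRep, hl]
  rw [hcr]
  simp only [map_add, add_apply, ContinuousLinearMap.comp_apply, ContinuousLinearMap.flip_apply,
    localRep_chart hx]
  constructor
  · intro h
    linear_combination (norm := module) -h
  · intro h
    linear_combination (norm := module) -h

variable [T2Space M] in
-- The definition tests against fields smooth on U; a globally smooth field with prescribed value at
-- x supplies each test vector.
lemma IsAffineOn.affineEq {f : M → M} {U : Set M} (hU : IsOpen U) (h : IsAffineOn cov cov f U)
    (hxU : x ∈ U) (hx : x ∈ (chartAt E c).source) (hfx : f x ∈ (chartAt E c').source) :
    AffineEq (christoffel cov c) (christoffel cov c') (chartRep c c' f) (chartAt E c x) := by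
  intro u v
  obtain ⟨X, hX, hXx⟩ := exists_contMDiff_field x (coordSymm c x v)
  have h1 := (map_cov_eq_covDerivAlong_iff hx hfx (h.1.contMDiffAt (hU.mem_nhds hxU))
    ((hX x (mem_univ _)).contMDiffAt univ_mem) (coordSymm c x u)).1
    (h.2 X (hX.mono (subset_univ _)) x hxU _)
  rwa [hXx, coord_coordSymm hx, coord_coordSymm hx] at h1

lemma isAffineOn_of_affineEq {f : M → M} {U : Set M} (hU : IsOpen U)
    (hf : ContMDiffOn 𝓘(ℝ, E) 𝓘(ℝ, E) ∞ f U)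
    (h : ∀ x ∈ U, ∃ c c' : M, x ∈ (chartAt E c).source ∧ f x ∈ (chartAt E c').source ∧
      AffineEq (christoffel cov c) (christoffel cov c') (chartRep c c' f) (chartAt E c x)) :
    IsAffineOn cov cov f U := by
  refine ⟨hf, fun X hX x hxU v ↦ ?_⟩
  obtain ⟨c, c', hx, hfx, haff⟩ := h x hxU
  exact (map_cov_eq_covDerivAlong_iff hx hfx (hf.contMDiffAt (hU.mem_nhds hxU))
    ((hX x hxU).contMDiffAt (hU.mem_nhds hxU)) v).2 (haff _ _)

end Along

/-! ### The local equivalence on the manifold. -/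

section Local
variable {E : Type*} [NormedAddCommGroup E] [NormedSpace ℝ E] [FiniteDimensional ℝ E]
  {M : Type*} [TopologicalSpace M] [ChartedSpace E M] [IsManifold 𝓘(ℝ, E) ω M]
  {cov : Connection E M} {c c' x x₀ : M}

lemma AffineEq.congr {G G' : E → E →L[ℝ] E →L[ℝ] E} {f g : E → E} {x : E}
    (h : AffineEq G G' f x) (hfg : g =ᶠ[𝓝 x] f) : AffineEq G G' g x := by
  intro u v
  rw [hfg.fderiv.fderiv_eq, hfg.fderiv_eq, hfg.self_of_nhds]
  exact h u v

lemma tendsto_chartAt_symm (hx : x ∈ (chartAt E c).source) :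
    Tendsto (chartAt E c).symm (𝓝 (chartAt E c x)) (𝓝 x) := by
  have := (chartAt E c).continuousAt_symm ((chartAt E c).map_source hx)
  rwa [ContinuousAt, (chartAt E c).left_inv hx] at this

variable [T2Space M] in
-- As the symmetry fixes the point, one chart serves as source and target, and the coordinate result
-- applies.
lemma IsAffineSymmetryOn.parityCondition (hcov : IsRealAnalytic cov) {U : Set M} {f : M → M}
    (h : IsAffineSymmetryOn cov x₀ U f) : ParityCondition cov x₀ := by
  have : CompleteSpace E := FiniteDimensional.complete ℝ E
  have hx : x₀ ∈ (chartAt E x₀).source := mem_chart_source E x₀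
  rw [parityCondition_iff hcov hx]
  have hfx : f x₀ = x₀ := congrArg Bundle.TotalSpace.proj (h.map_and_deriv 0)
  have hfs : f x₀ ∈ (chartAt E x₀).source := by rwa [hfx]
  have hUn := h.isOpen.mem_nhds h.mem
  have hf : ContMDiffAt 𝓘(ℝ, E) 𝓘(ℝ, E) ∞ f x₀ := h.affine.1.contMDiffAt hUn
  refine CoordParity.of_affineEq (chartAt E x₀).open_target (analyticOnNhd_christoffel hcov x₀)
    ((chartAt E x₀).map_source hx) (f := chartRep x₀ x₀ f)
    ((contDiffAt_chartRep hx hfs hf).of_le (by norm_cast)) ?_ ?_ ?_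
  · filter_upwards [(chartAt E x₀).open_target.mem_nhds ((chartAt E x₀).map_source hx),
      (tendsto_chartAt_symm hx).eventually hUn,
      (tendsto_chartAt_symm hx).eventually (hf.continuousAt.eventually
        ((chartAt E x₀).open_source.mem_nhds hfs))] with y hy hyU hfy
    have := h.affine.affineEq h.isOpen hyU ((chartAt E x₀).map_target hy) hfy
    rwa [(chartAt E x₀).right_inv hy] at this
  · simp [chartRep, (chartAt E x₀).left_inv hx, hfx]
  · ext v
    have h1 := fderiv_chartRep (c := x₀) (c' := x₀) hx hfs (hf.mdifferentiableAt (by simp)) (coordSymm x₀ x₀ v)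
    rw [coord_coordSymm hx] at h1
    have h2 := congrArg (fun p : TangentBundle 𝓘(ℝ, E) M ↦ coord x₀ p.1 p.2)
      (h.map_and_deriv (coordSymm x₀ x₀ v))
    refine h1.trans (h2.trans ?_)
    simp [map_neg, coord_coordSymm hx]

lemma eq_neg_of_chartRep {f : M → M} (hf : MDifferentiableAt 𝓘(ℝ, E) 𝓘(ℝ, E) f x₀) (hfx : f x₀ = x₀)
    (hd : fderiv ℝ (chartRep x₀ x₀ f) (chartAt E x₀ x₀) = -ContinuousLinearMap.id ℝ E)
    (v : TangentSpace 𝓘(ℝ, E) x₀) :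
    tangentMap 𝓘(ℝ, E) 𝓘(ℝ, E) f ⟨x₀, v⟩ = ⟨x₀, -v⟩ := by
  have hx : x₀ ∈ (chartAt E x₀).source := mem_chart_source E x₀
  have hfs : f x₀ ∈ (chartAt E x₀).source := by rwa [hfx]
  have h1 := fderiv_chartRep (c := x₀) (c' := x₀) hx hfs hf v
  rw [hd] at h1
  have key : ∀ (y : M) (hy : y = x₀) (w : TangentSpace 𝓘(ℝ, E) y),
      (-ContinuousLinearMap.id ℝ E) (coord x₀ x₀ v) = coord x₀ y w →
      (⟨y, w⟩ : TangentBundle 𝓘(ℝ, E) M) = ⟨x₀, -v⟩ := by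
    rintro y rfl w hw
    have : w = -v := coord_injective hx (by rw [← hw, map_neg]; simp)
    rw [this]
  exact key _ hfx _ h1

lemma ParityCondition.exists_isAffineSymmetryOn (hcov : IsRealAnalytic cov)
    (h : ParityCondition cov x₀) : ∃ (U : Set M) (f : M → M), IsAffineSymmetryOn cov x₀ U f := by
  have : CompleteSpace E := FiniteDimensional.complete ℝ E
  have hx : x₀ ∈ (chartAt E x₀).source := mem_chart_source E x₀
  have hxt := (chartAt E x₀).map_source hx
  rw [parityCondition_iff hcov hx] at h
  obtain ⟨F, hF, hFx, hdF, haff⟩ := h.exists_affineEq (chartAt E x₀).open_target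
    (analyticOnNhd_christoffel hcov x₀) hxt
  -- The coordinate solution transported by the chart; only its germ at `x₀` matters, so its values
  -- elsewhere are arbitrary.
  set f : M → M := (chartAt E x₀).symm ∘ F ∘ chartAt E x₀ with hfdef
  have hFt : ∀ᶠ y in 𝓝 (chartAt E x₀ x₀), F y ∈ (chartAt E x₀).target :=
    hF.continuousAt.eventually (by
      rw [hFx]; exact (chartAt E x₀).open_target.mem_nhds hxt)
  have hrep : ∀ y ∈ (chartAt E x₀).target, F y ∈ (chartAt E x₀).target →
      chartRep x₀ x₀ f y = F y := by
    intro y hy hFy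
    simp [chartRep, hfdef, (chartAt E x₀).right_inv hy, (chartAt E x₀).right_inv hFy]
  have hev : ∀ᶠ y in 𝓝 (chartAt E x₀ x₀), F y ∈ (chartAt E x₀).target ∧ AnalyticAt ℝ F y ∧
      AffineEq (christoffel cov x₀) (christoffel cov x₀) F y ∧ chartRep x₀ x₀ f =ᶠ[𝓝 y] F := by
    filter_upwards [hFt, hF.eventually_analyticAt, haff, hFt.eventually_nhds,
      (chartAt E x₀).open_target.eventually_mem hxt] with y h1 h2 h3 h4 h5
    refine ⟨h1, h2, h3, ?_⟩
    filter_upwards [h4, (chartAt E x₀).open_target.mem_nhds h5] with z hz hz'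
    exact hrep z hz' hz
  have hfx : f x₀ = x₀ := by simp [hfdef, hFx, (chartAt E x₀).left_inv hx]
  obtain ⟨U, hU, hUo, hxU⟩ := eventually_nhds_iff.1
    ((((chartAt E x₀).continuousAt hx).eventually hev).and
      ((chartAt E x₀).open_source.mem_nhds hx))
  have hfU : ContMDiffOn 𝓘(ℝ, E) 𝓘(ℝ, E) ∞ f U := fun y hy ↦ by
    refine ContMDiffAt.contMDiffWithinAt ?_
    refine (contMDiffAt_chart_symm (hU y hy).1.1).comp y ?_
    exact ContMDiffAt.comp y ((hU y hy).1.2.1.contDiffAt (n := ∞)).contMDiffAt (contMDiffAt_chart (hU y hy).2)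
  refine ⟨U, f, hUo, hxU, isAffineOn_of_affineEq hUo hfU fun y hy ↦ ⟨x₀, x₀, (hU y hy).2, ?_, ?_⟩, ?_⟩
  · exact (chartAt E x₀).map_target (hU y hy).1.1
  · exact (hU y hy).1.2.2.1.congr (hU y hy).1.2.2.2
  · refine eq_neg_of_chartRep ((hfU.contMDiffAt (hUo.mem_nhds hxU)).mdifferentiableAt (by simp)) hfx ?_
    rw [← hdF]
    exact ((hU x₀ hxU).1.2.2.2).fderiv_eq

end Local

/-! ### The geodesic equation in charts and uniqueness. -/

section Geodesics
variable {E : Type*} [NormedAddCommGroup E] [NormedSpace ℝ E] [FiniteDimensional ℝ E]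
  {M : Type*} [TopologicalSpace M] [ChartedSpace E M] [IsManifold 𝓘(ℝ, E) ω M]
  {cov : Connection E M} {c c' x x₀ : M} {γ δ : ℝ → M} {t : ℝ}

variable (E) in
/-- The velocity of a curve, in the coordinates of the chart around `c`. -/
def chartVel (c : M) (γ : ℝ → M) (t : ℝ) : E :=
  coord c (γ t) (mfderiv 𝓘(ℝ, ℝ) 𝓘(ℝ, E) γ t (1 : ℝ))

variable (E) in
/-- The position and the velocity of a curve, in the chart around `c`. -/
def chartState (c : M) (γ : ℝ → M) (t : ℝ) : E × E := (chartAt E c (γ t), chartVel E c γ t)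

/-- The geodesic spray in the chart around `c`. -/
def spray (cov : Connection E M) (c : M) (p : E × E) : E × E :=
  (p.2, -christoffel cov c p.1 p.2 p.2)

/-- The curve `γ` satisfies the geodesic equation at `t`. -/
def IsGeodesicAt (cov : Connection E M) (γ : ℝ → M) (t : ℝ) : Prop :=
  ContMDiffAt 𝓘(ℝ, ℝ) 𝓘(ℝ, E) ∞ γ t ∧
    covDerivAlong cov γ (fun s ↦ mfderiv 𝓘(ℝ, ℝ) 𝓘(ℝ, E) γ s (1 : ℝ)) t (1 : ℝ) = 0

lemma IsGeodesic.isGeodesicAt (h : IsGeodesic cov γ) (t : ℝ) : IsGeodesicAt cov γ t :=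
  ⟨h.1 t, h.2 t⟩

lemma analyticAt_spray (hcov : IsRealAnalytic cov) {p : E × E} (hp : p.1 ∈ (chartAt E c).target) :
    AnalyticAt ℝ (spray cov c) p := by
  have : CompleteSpace E := FiniteDimensional.complete ℝ E
  have h1 : AnalyticAt ℝ (fun p : E × E ↦ christoffel cov c p.1) p :=
    AnalyticAt.fun_comp (f := Prod.fst) (analyticOnNhd_christoffel hcov c _ hp) analyticAt_fst
  exact analyticAt_snd.prod ((h1.clm_apply_of_complete analyticAt_snd).clm_apply_of_complete
    analyticAt_snd).neg

lemma chartVel_congr (h : γ =ᶠ[𝓝 t] δ) : chartVel E c γ t = chartVel E c δ t := by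
  have key : ∀ (y y' : M) (hy : y = y') (w : TangentSpace 𝓘(ℝ, E) y) (w' : TangentSpace 𝓘(ℝ, E) y'),
      (w : E) = w' → coord c y w = coord c y' w' := by
    rintro y _ rfl w w' h
    exact congrArg _ h
  refine key _ _ h.self_of_nhds _ _ ?_
  rw [h.mfderiv_eq]
  rfl

lemma chartState_congr (h : γ =ᶠ[𝓝 t] δ) : chartState E c γ t = chartState E c δ t := by
  rw [chartState, chartState, chartVel_congr h, h.self_of_nhds]

lemma hasDerivAt_chart_comp (hγ : MDifferentiableAt 𝓘(ℝ, ℝ) 𝓘(ℝ, E) γ t)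
    (hx : γ t ∈ (chartAt E c).source) : HasDerivAt (chartAt E c ∘ γ) (chartVel E c γ t) t := by
  have h1 : MDifferentiableAt 𝓘(ℝ, ℝ) 𝓘(ℝ, E) (chartAt E c ∘ γ) t :=
    ((contMDiffAt_chart (n := 1) hx).mdifferentiableAt one_ne_zero).comp t hγ
  have h2 := mvfderiv_chart_comp hx hγ (1 : ℝ)
  have h3 := (mdifferentiableAt_iff_differentiableAt.1 h1).hasFDerivAt.hasDerivAt
  refine h3.congr_deriv ?_
  rw [chartVel, ← h2]
  change _ = mfderiv 𝓘(ℝ, ℝ) 𝓘(ℝ, E) (chartAt E c ∘ γ) t (1 : ℝ)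
  rw [mfderiv_eq_fderiv]
  rfl

lemma eventually_mdifferentiableAt (hγ : ContMDiffAt 𝓘(ℝ, ℝ) 𝓘(ℝ, E) ∞ γ t) :
    ∀ᶠ s in 𝓝 t, MDifferentiableAt 𝓘(ℝ, ℝ) 𝓘(ℝ, E) γ s := by
  have h1 : ContMDiffAt 𝓘(ℝ, ℝ) 𝓘(ℝ, E) 1 γ t := hγ.of_le (by norm_cast)
  filter_upwards [(contMDiffAt_iff_contMDiffAt_nhds (by simp)).1 h1] with y hy
    using hy.mdifferentiableAt one_ne_zero

lemma contDiffAt_chart_comp (hγ : ContMDiffAt 𝓘(ℝ, ℝ) 𝓘(ℝ, E) ∞ γ t)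
    (hx : γ t ∈ (chartAt E c).source) : ContDiffAt ℝ ∞ (chartAt E c ∘ γ) t :=
  ((contMDiffAt_chart hx).comp t hγ).contDiffAt

lemma chartVel_eventuallyEq_deriv (hγ : ContMDiffAt 𝓘(ℝ, ℝ) 𝓘(ℝ, E) ∞ γ t)
    (hx : γ t ∈ (chartAt E c).source) : chartVel E c γ =ᶠ[𝓝 t] deriv (chartAt E c ∘ γ) := by
  filter_upwards [eventually_mdifferentiableAt hγ,
    hγ.continuousAt.eventually ((chartAt E c).open_source.mem_nhds hx)] with s h1 h2
  exact (hasDerivAt_chart_comp h1 h2).deriv.symm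

lemma differentiableAt_chartVel (hγ : ContMDiffAt 𝓘(ℝ, ℝ) 𝓘(ℝ, E) ∞ γ t)
    (hx : γ t ∈ (chartAt E c).source) : DifferentiableAt ℝ (chartVel E c γ) t := by
  refine DifferentiableAt.congr_of_eventuallyEq ?_ (chartVel_eventuallyEq_deriv hγ hx)
  have h1 : DifferentiableAt ℝ (fderiv ℝ (chartAt E c ∘ γ)) t :=
    ((contDiffAt_chart_comp hγ hx).fderiv_right (m := 1) (by norm_cast)).differentiableAt one_ne_zero
  exact h1.clm_apply (differentiableAt_const (1 : ℝ))

/-- The velocity is a field along the curve, so its covariant derivative in a chart is the usual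
second-order expression. -/
lemma isGeodesicAt_iff (hγ : ContMDiffAt 𝓘(ℝ, ℝ) 𝓘(ℝ, E) ∞ γ t) (hx : γ t ∈ (chartAt E c).source) :
    IsGeodesicAt cov γ t ↔ HasDerivAt (chartVel E c γ)
      (-christoffel cov c (chartAt E c (γ t)) (chartVel E c γ t) (chartVel E c γ t)) t := by
  have hd := differentiableAt_chartVel hγ hx
  have hZ : MDifferentiableAt 𝓘(ℝ, ℝ) 𝓘(ℝ, E)
      (fun s ↦ coord c (γ s) (mfderiv 𝓘(ℝ, ℝ) 𝓘(ℝ, E) γ s (1 : ℝ))) t := hd.mdifferentiableAt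
  have h1 := coord_covDerivAlong (cov := cov) (Z := fun s ↦ mfderiv 𝓘(ℝ, ℝ) 𝓘(ℝ, E) γ s (1 : ℝ)) hx
    (hγ.mdifferentiableAt (by simp)) hZ (1 : ℝ)
  have h2 : mvfderiv 𝓘(ℝ, ℝ) (fun s ↦ coord c (γ s) (mfderiv 𝓘(ℝ, ℝ) 𝓘(ℝ, E) γ s (1 : ℝ))) t (1 : ℝ)
      = deriv (chartVel E c γ) t := by
    change mfderiv 𝓘(ℝ, ℝ) 𝓘(ℝ, E) (chartVel E c γ) t (1 : ℝ) = _
    rw [mfderiv_eq_fderiv]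
    rfl
  rw [h2] at h1
  have h3 : IsGeodesicAt cov γ t ↔ deriv (chartVel E c γ) t +
      christoffel cov c (chartAt E c (γ t)) (chartVel E c γ t) (chartVel E c γ t) = 0 := by
    rw [IsGeodesicAt, and_iff_right hγ, ← (coord_injective hx).eq_iff, h1, map_zero]
    rfl
  rw [h3, add_eq_zero_iff_eq_neg]
  exact ⟨fun h ↦ h ▸ hd.hasDerivAt, fun h ↦ h.deriv⟩

lemma IsGeodesicAt.hasDerivAt_chartState (h : IsGeodesicAt cov γ t)
    (hx : γ t ∈ (chartAt E c).source) :
    HasDerivAt (chartState E c γ) (spray cov c (chartState E c γ t)) t :=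
  (hasDerivAt_chart_comp (h.1.mdifferentiableAt (by simp)) hx).prodMk ((isGeodesicAt_iff h.1 hx).1 h)

/-- Position and velocity satisfy a first-order system whose right-hand side is analytic, hence
locally Lipschitz. -/
lemma eventuallyEq_of_isGeodesicAt (hcov : IsRealAnalytic cov) (hγ : ∀ᶠ s in 𝓝 t, IsGeodesicAt cov γ s)
    (hδ : ∀ᶠ s in 𝓝 t, IsGeodesicAt cov δ s) (hx : γ t ∈ (chartAt E c).source)
    (hx' : δ t ∈ (chartAt E c).source) (h : chartState E c γ t = chartState E c δ t) : γ =ᶠ[𝓝 t] δ := by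
  have : CompleteSpace E := FiniteDimensional.complete ℝ E
  obtain ⟨K, s, hs, hK⟩ := ((analyticAt_spray (cov := cov) (c := c) (p := chartState E c γ t) hcov
    ((chartAt E c).map_source hx)).contDiffAt (n := 1)).exists_lipschitzOnWith
  have e1 := hγ.self_of_nhds.1.continuousAt.eventually ((chartAt E c).open_source.mem_nhds hx)
  have e2 := hδ.self_of_nhds.1.continuousAt.eventually ((chartAt E c).open_source.mem_nhds hx')
  have d1 := (hγ.self_of_nhds.hasDerivAt_chartState hx).continuousAt
  have d2 := (hδ.self_of_nhds.hasDerivAt_chartState hx').continuousAt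
  have h1 := ODE_solution_unique_of_eventually (v := fun _ ↦ spray cov c) (s := fun _ ↦ s) (K := K)
    (t₀ := t) (f := chartState E c γ) (g := chartState E c δ) (.of_forall fun _ ↦ hK)
    (by filter_upwards [hγ, e1, d1.eventually hs] with s h1 h2 h3
        exact ⟨h1.hasDerivAt_chartState h2, h3⟩)
    (by filter_upwards [hδ, e2, d2.eventually (h ▸ hs)] with s h1 h2 h3
        exact ⟨h1.hasDerivAt_chartState h2, h3⟩) h
  filter_upwards [h1, e1, e2] with s h1 h2 h3
  exact (chartAt E c).injOn h2 h3 (congrArg Prod.fst h1)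

variable [T2Space M] in
/-- Uniqueness of geodesics. -/
lemma eqOn_of_isGeodesicAt (hcov : IsRealAnalytic cov) {J : Set ℝ} (hJ : IsOpen J)
    (hJc : IsPreconnected J) (hγ : ∀ s ∈ J, IsGeodesicAt cov γ s) (hδ : ∀ s ∈ J, IsGeodesicAt cov δ s)
    (ht : t ∈ J) (hx : γ t ∈ (chartAt E c).source) (hx' : δ t ∈ (chartAt E c).source)
    (h : chartState E c γ t = chartState E c δ t) : EqOn γ δ J := by
  have hγe : ∀ s ∈ J, ∀ᶠ r in 𝓝 s, IsGeodesicAt cov γ r := fun s hs ↦ by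
    filter_upwards [hJ.mem_nhds hs] with r hr using hγ r hr
  have hδe : ∀ s ∈ J, ∀ᶠ r in 𝓝 s, IsGeodesicAt cov δ r := fun s hs ↦ by
    filter_upwards [hJ.mem_nhds hs] with r hr using hδ r hr
  -- The times at which the germs agree form an open set. At a limit time positions and velocities
  -- agree by continuity, and local uniqueness applies again.
  have hsub : J ⊆ {s | γ =ᶠ[𝓝 s] δ} := by
    refine hJc.subset_of_closure_inter_subset isOpen_setOfPred_eventually_nhds
      ⟨t, ht, eventuallyEq_of_isGeodesicAt hcov (hγe t ht) (hδe t ht) hx hx' h⟩ ?_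
    rintro s ⟨hs, hsJ⟩
    have hfr : ∃ᶠ r in 𝓝 s, γ =ᶠ[𝓝 r] δ := mem_closure_iff_frequently.1 hs
    have he : γ s = δ s := tendsto_nhds_unique_of_frequently_eq (hγ s hsJ).1.continuousAt
      (hδ s hsJ).1.continuousAt (hfr.mono fun r hr ↦ hr.self_of_nhds)
    have hs1 : γ s ∈ (chartAt E (γ s)).source := mem_chart_source E (γ s)
    have hs2 : δ s ∈ (chartAt E (γ s)).source := he ▸ hs1
    refine eventuallyEq_of_isGeodesicAt hcov (hγe s hsJ) (hδe s hsJ) hs1 hs2 ?_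
    exact tendsto_nhds_unique_of_frequently_eq
      ((hγ s hsJ).hasDerivAt_chartState hs1).continuousAt
      ((hδ s hsJ).hasDerivAt_chartState hs2).continuousAt (hfr.mono fun r hr ↦ chartState_congr hr)
  exact fun s hs ↦ (hsub hs).self_of_nhds

end Geodesics

/-! ### Pointwise affine maps. -/

section AffineAt
variable {E : Type*} [NormedAddCommGroup E] [NormedSpace ℝ E] [FiniteDimensional ℝ E]
  {M : Type*} [TopologicalSpace M] [ChartedSpace E M] [IsManifold 𝓘(ℝ, E) ω M]
  {cov : Connection E M} {c c' x x₀ : M} {γ δ : ℝ → M} {t : ℝ} {f g : M → M}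

/-- The map `f` is smooth near `x` and its second fundamental form vanishes at `x`. -/
def IsAffineAt (cov : Connection E M) (f : M → M) (x : M) : Prop :=
  ContMDiffAt 𝓘(ℝ, E) 𝓘(ℝ, E) ∞ f x ∧
    AffineEq (christoffel cov x) (christoffel cov (f x)) (chartRep x (f x) f) (chartAt E x x)

variable [T2Space M] in
-- In any pair of charts the equation is equivalent to the same chart-free condition on test fields,
-- which gives independence of the charts.
lemma isAffineAt_iff (hx : x ∈ (chartAt E c).source) (hfx : f x ∈ (chartAt E c').source)
    (hf : ContMDiffAt 𝓘(ℝ, E) 𝓘(ℝ, E) ∞ f x) :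
    IsAffineAt cov f x ↔
      AffineEq (christoffel cov c) (christoffel cov c') (chartRep c c' f) (chartAt E c x) := by
  have key : ∀ c c' : M, x ∈ (chartAt E c).source → f x ∈ (chartAt E c').source →
      (AffineEq (christoffel cov c) (christoffel cov c') (chartRep c c' f) (chartAt E c x) ↔
      ∀ X : VField E M, X.ContDiffOn ∞ univ → ∀ v : TangentSpace 𝓘(ℝ, E) x,
        mfderiv 𝓘(ℝ, E) 𝓘(ℝ, E) f x (cov X x v) =
        covDerivAlong cov f (fun y ↦ mfderiv 𝓘(ℝ, E) 𝓘(ℝ, E) f y (X y)) x v) := by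
    intro c c' hx hfx
    constructor
    · intro h X hX v
      exact (map_cov_eq_covDerivAlong_iff hx hfx hf ((hX x (mem_univ _)).contMDiffAt univ_mem) v).2
        (h _ _)
    · intro h u v
      obtain ⟨X, hX, hXx⟩ := exists_contMDiff_field x (coordSymm c x v)
      have h1 := (map_cov_eq_covDerivAlong_iff hx hfx hf
        ((hX x (mem_univ _)).contMDiffAt univ_mem) (coordSymm c x u)).1 (h X hX _)
      rwa [hXx, coord_coordSymm hx, coord_coordSymm hx] at h1
  rw [IsAffineAt, and_iff_right hf, key c c' hx hfx, key x (f x) (mem_chart_source E x)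
    (mem_chart_source E (f x))]

variable [T2Space M] in
lemma isAffineOn_iff {U : Set M} (hU : IsOpen U) :
    IsAffineOn cov cov f U ↔ ∀ x ∈ U, IsAffineAt cov f x := by
  constructor
  · intro h x hx
    exact ⟨h.1.contMDiffAt (hU.mem_nhds hx),
      h.affineEq hU hx (mem_chart_source E x) (mem_chart_source E (f x))⟩
  · intro h
    exact isAffineOn_of_affineEq hU (fun x hx ↦ (h x hx).1.contMDiffWithinAt) fun x hx ↦
      ⟨x, f x, mem_chart_source E x, mem_chart_source E (f x), (h x hx).2⟩

lemma eventuallyEq_chartRep (hx : x ∈ (chartAt E c).source) (h : f =ᶠ[𝓝 x] g) :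
    chartRep c c' f =ᶠ[𝓝 (chartAt E c x)] chartRep c c' g := by
  filter_upwards [(tendsto_chartAt_symm hx).eventually h] with y hy
  simp [chartRep, hy]

lemma IsAffineAt.congr (hf : IsAffineAt cov f x) (h : g =ᶠ[𝓝 x] f) : IsAffineAt cov g x := by
  refine ⟨hf.1.congr_of_eventuallyEq h, ?_⟩
  rw [h.self_of_nhds]
  exact hf.2.congr (eventuallyEq_chartRep (mem_chart_source E x) h)

lemma chartVel_comp (hf : MDifferentiableAt 𝓘(ℝ, E) 𝓘(ℝ, E) f (γ t))
    (hγ : MDifferentiableAt 𝓘(ℝ, ℝ) 𝓘(ℝ, E) γ t) (hx : γ t ∈ (chartAt E c).source)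
    (hfx : f (γ t) ∈ (chartAt E c').source) :
    chartVel E c' (f ∘ γ) t = fderiv ℝ (chartRep c c' f) (chartAt E c (γ t)) (chartVel E c γ t) := by
  rw [chartVel, chartVel, fderiv_chartRep hx hfx hf]
  exact congrArg (coord c' (f (γ t))) (mfderiv_comp_apply t hf hγ (1 : ℝ))

lemma eventually_mdifferentiableAt_map {x : M} (hf : ContMDiffAt 𝓘(ℝ, E) 𝓘(ℝ, E) ∞ f x) :
    ∀ᶠ y in 𝓝 x, MDifferentiableAt 𝓘(ℝ, E) 𝓘(ℝ, E) f y := by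
  have h1 : ContMDiffAt 𝓘(ℝ, E) 𝓘(ℝ, E) 1 f x := hf.of_le (by norm_cast)
  filter_upwards [(contMDiffAt_iff_contMDiffAt_nhds (by simp)).1 h1] with y hy
    using hy.mdifferentiableAt one_ne_zero

lemma chartVel_comp_eventuallyEq (hx : γ t ∈ (chartAt E c).source)
    (hfx : f (γ t) ∈ (chartAt E c').source) (hf : ContMDiffAt 𝓘(ℝ, E) 𝓘(ℝ, E) ∞ f (γ t))
    (hγ : ContMDiffAt 𝓘(ℝ, ℝ) 𝓘(ℝ, E) ∞ γ t) :
    chartVel E c' (f ∘ γ) =ᶠ[𝓝 t] fun s ↦ fderiv ℝ (chartRep c c' f) (chartAt E c (γ s))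
      (chartVel E c γ s) := by
  filter_upwards [hγ.continuousAt.eventually (eventually_mdifferentiableAt_map hf),
    eventually_mdifferentiableAt hγ,
    hγ.continuousAt.eventually ((chartAt E c).open_source.mem_nhds hx),
    (ContMDiffAt.comp t hf hγ).continuousAt.eventually
      ((chartAt E c').open_source.mem_nhds hfx)] with s h1 h2 h3 h4
  exact chartVel_comp h1 h2 h3 h4

/-- Affine maps send geodesics to geodesics. -/
lemma isGeodesicAt_comp (hx : γ t ∈ (chartAt E c).source) (hfx : f (γ t) ∈ (chartAt E c').source)
    (hf : ContMDiffAt 𝓘(ℝ, E) 𝓘(ℝ, E) ∞ f (γ t))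
    (haff : AffineEq (christoffel cov c) (christoffel cov c') (chartRep c c' f) (chartAt E c (γ t)))
    (hγ : IsGeodesicAt cov γ t) : IsGeodesicAt cov (f ∘ γ) t := by
  rw [isGeodesicAt_iff (c := c') (ContMDiffAt.comp t hf hγ.1) hfx]
  have h1 := chartVel_comp_eventuallyEq hx hfx hf hγ.1
  have hF2 : HasFDerivAt (fderiv ℝ (chartRep c c' f))
      (fderiv ℝ (fderiv ℝ (chartRep c c' f)) (chartAt E c (γ t))) (chartAt E c (γ t)) :=
    (((contDiffAt_chartRep hx hfx hf).fderiv_right (m := 1)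
      (by norm_cast)).differentiableAt one_ne_zero).hasFDerivAt
  have hst1 : HasDerivAt (fun s ↦ chartAt E c (γ s)) (chartVel E c γ t) t :=
    hasDerivAt_chart_comp (hγ.1.mdifferentiableAt (by simp)) hx
  have hst2 := (isGeodesicAt_iff hγ.1 hx).1 hγ
  have h4 : chartAt E c' ((f ∘ γ) t) = chartRep c c' f (chartAt E c (γ t)) := by
    simp [chartRep, (chartAt E c).left_inv hx]
  have h5 := h1.self_of_nhds
  have h3 := haff (chartVel E c γ t) (chartVel E c γ t)
  rw [h4, h5]
  refine HasDerivAt.congr_of_eventuallyEq (f := fun s ↦ fderiv ℝ (chartRep c c' f) (chartAt E c (γ s))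
      (chartVel E c γ s)) ?_ h1
  generalize (chartRep c c' f : E → E) = F at *
  have h6 : HasDerivAt (fun s ↦ fderiv ℝ F (chartAt E c (γ s))) _ t := hF2.comp_hasDerivAt t hst1
  refine (h6.clm_apply hst2).congr_deriv ?_
  rw [map_neg, ← h3]
  abel

lemma IsAffineAt.comp_isGeodesicAt (hf : IsAffineAt cov f (γ t)) (hγ : IsGeodesicAt cov γ t) :
    IsGeodesicAt cov (f ∘ γ) t :=
  isGeodesicAt_comp (mem_chart_source E _) (mem_chart_source E _) hf.1 hf.2 hγ

end AffineAt

/-! ### Analyticity of the exponential map. -/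

section GeodesicFlow
variable {E : Type*} [NormedAddCommGroup E] [NormedSpace ℝ E] [FiniteDimensional ℝ E]
  {M : Type*} [TopologicalSpace M] [ChartedSpace E M] [IsManifold 𝓘(ℝ, E) ω M]
  {cov : Connection E M} {c c' x x₀ z : M} {γ δ : ℝ → M} {t : ℝ} {f g : M → M}

/-- Integral curves of the geodesic spray in a chart are geodesics. -/
lemma isGeodesicAt_of_hasDerivAt {s : ℝ → E × E} (hs : ContDiffAt ℝ ∞ s t)
    (hd : ∀ᶠ r in 𝓝 t, HasDerivAt s (spray cov c (s r)) r) (ht : (s t).1 ∈ (chartAt E c).target) :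
    IsGeodesicAt cov (fun r ↦ (chartAt E c).symm (s r).1) t ∧
      (chartState E c (fun r ↦ (chartAt E c).symm (s r).1) t) = s t := by
  set γ : ℝ → M := fun r ↦ (chartAt E c).symm (s r).1 with hγdef
  have hγ : ContMDiffAt 𝓘(ℝ, ℝ) 𝓘(ℝ, E) ∞ γ t :=
    (contMDiffAt_chart_symm ht).comp t (contDiffAt_fst.comp t hs).contMDiffAt
  have hx : γ t ∈ (chartAt E c).source := (chartAt E c).map_target ht
  have hev : chartAt E c ∘ γ =ᶠ[𝓝 t] fun r ↦ (s r).1 := by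
    filter_upwards [(continuousAt_fst.comp hs.continuousAt).eventually
      ((chartAt E c).open_target.mem_nhds ht)] with r hr
    exact (chartAt E c).right_inv hr
  have hv : chartVel E c γ =ᶠ[𝓝 t] fun r ↦ (s r).2 := by
    filter_upwards [chartVel_eventuallyEq_deriv hγ hx, hev.eventuallyEq_nhds, hd] with r h1 h2 h3
    rw [h1, h2.deriv_eq]
    exact (HasFDerivAt.comp_hasDerivAt r hasFDerivAt_fst h3).deriv
  have e1 : chartAt E c (γ t) = (s t).1 := hev.self_of_nhds
  have e2 : chartVel E c γ t = (s t).2 := hv.self_of_nhds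
  refine ⟨(isGeodesicAt_iff hγ hx).2 ?_, Prod.ext e1 e2⟩
  rw [e1, e2]
  exact (HasFDerivAt.comp_hasDerivAt t hasFDerivAt_snd hd.self_of_nhds).congr_of_eventuallyEq hv

/-- A chosen geodesic with initial velocity `w` at `z`, in the coordinates of the chart at `z`. -/
def completeGeodesic (hc : IsGeodesicallyComplete cov) (z : M) (w : E) : ℝ → M :=
  (hc z (coordSymm z z w)).choose

variable {hc : IsGeodesicallyComplete cov} {w w₀ : E}

lemma isGeodesicAt_completeGeodesic (t : ℝ) : IsGeodesicAt cov (completeGeodesic hc z w) t :=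
  (hc z (coordSymm z z w)).choose_spec.1.isGeodesicAt t

lemma completeGeodesic_zero : completeGeodesic hc z w 0 = z :=
  congrArg Bundle.TotalSpace.proj (hc z (coordSymm z z w)).choose_spec.2

lemma chartState_completeGeodesic_zero :
    chartState E z (completeGeodesic hc z w) 0 = (chartAt E z z, w) := by
  refine Prod.ext (congrArg (chartAt E z) completeGeodesic_zero) ?_
  refine (congrArg (fun p : TangentBundle 𝓘(ℝ, E) M ↦ coord z p.1 p.2)
    (hc z (coordSymm z z w)).choose_spec.2).trans ?_
  exact coord_coordSymm (mem_chart_source E z) w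

/-- The state at time `t` of the geodesics from `z` depends analytically on the velocity near `w₀`. -/
def AnalyticState (hc : IsGeodesicallyComplete cov) (z : M) (w₀ : E) (c : M) (t : ℝ) : Prop :=
  (∀ᶠ w in 𝓝 w₀, completeGeodesic hc z w t ∈ (chartAt E c).source) ∧
    AnalyticAt ℝ (fun w ↦ chartState E c (completeGeodesic hc z w) t) w₀

/-- The transition map between tangent charts. -/
def stateChange (c c' : M) (p : E × E) : E × E :=
  (chartAt E c' ((chartAt E c).symm p.1), coordChange c c' ((chartAt E c).symm p.1) p.2)

lemma chartState_eq_stateChange (hx : γ t ∈ (chartAt E c).source) :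
    chartState E c' γ t = stateChange c c' (chartState E c γ t) := by
  have key : ∀ y (hy : y = γ t), coordChange c c' y (chartVel E c γ t) = chartVel E c' γ t := by
    rintro y rfl
    simp only [coordChange, chartVel, ContinuousLinearMap.comp_apply]
    rw [coordSymm_coord hx]
  refine Prod.ext ?_ (key _ ((chartAt E c).left_inv hx)).symm
  simp [chartState, stateChange, (chartAt E c).left_inv hx]

lemma analyticAt_stateChange {p : E × E} (hp : p.1 ∈ (chartAt E c).target)
    (hp' : (chartAt E c).symm p.1 ∈ (chartAt E c').source) : AnalyticAt ℝ (stateChange c c') p := by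
  have : CompleteSpace E := FiniteDimensional.complete ℝ E
  have h1 : AnalyticAt ℝ (fun y ↦ chartAt E c' ((chartAt E c).symm y)) p.1 :=
    (((contMDiffAt_chart (n := ω) hp').comp _ (contMDiffAt_chart_symm hp)).contDiffAt).analyticAt
  have h2 : AnalyticAt ℝ (fun y ↦ (coordChange c c' ((chartAt E c).symm y) : E →L[ℝ] E)) p.1 :=
    (((contMDiffAt_coordChange (n := ω) ((chartAt E c).map_target hp) hp').comp _
      (contMDiffAt_chart_symm hp)).contDiffAt).analyticAt
  exact (AnalyticAt.fun_comp (f := Prod.fst) h1 analyticAt_fst).prod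
    ((AnalyticAt.fun_comp (f := Prod.fst) h2 analyticAt_fst).clm_apply_of_complete analyticAt_snd)

/-- Transition maps of the tangent bundle are analytic. -/
lemma AnalyticState.change (h : AnalyticState hc z w₀ c t)
    (hx : completeGeodesic hc z w₀ t ∈ (chartAt E c').source) : AnalyticState hc z w₀ c' t := by
  have h0 := h.1.self_of_nhds
  have hl := (chartAt E c).left_inv h0
  have h1 : AnalyticAt ℝ (stateChange c c') (chartState E c (completeGeodesic hc z w₀) t) :=
    analyticAt_stateChange ((chartAt E c).map_source h0) (by simpa [chartState, hl] using hx)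
  constructor
  · have h2 : ContinuousAt (fun w ↦ (chartAt E c).symm
        (chartState E c (completeGeodesic hc z w) t).1) w₀ :=
      ContinuousAt.comp (f := fun w ↦ (chartState E c (completeGeodesic hc z w) t).1)
        ((chartAt E c).continuousAt_symm ((chartAt E c).map_source h0))
        (continuousAt_fst.comp h.2.continuousAt)
    filter_upwards [h.1, h2.eventually ((chartAt E c').open_source.mem_nhds
      (by simpa [chartState, hl] using hx))] with w hw hw'
    change (chartAt E c).symm (chartAt E c _) ∈ (chartAt E c').source at hw'
    rwa [(chartAt E c).left_inv hw] at hw'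
  · refine (AnalyticAt.fun_comp (f := fun w ↦ chartState E c (completeGeodesic hc z w) t)
      h1 h.2).congr ?_
    filter_upwards [h.1] with w hw
    exact (chartState_eq_stateChange hw).symm

variable [T2Space M] in
-- By uniqueness the state at `t₂` is the local spray flow, for time `t₂ - t₁`, of the state at
-- `t₁`. The roles of `t₁` and `t₂` are symmetric in the neighbourhood, so this yields both openness
-- and closedness of the set of good times.
lemma AnalyticState.eventually (hcov : IsRealAnalytic cov) (z : M) (w₀ : E) (t : ℝ) :
    ∃ N ∈ 𝓝 t, ∀ t₁ ∈ N, ∀ c₁, AnalyticState hc z w₀ c₁ t₁ → ∀ t₂ ∈ N, ∃ c₂,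
      AnalyticState hc z w₀ c₂ t₂ := by
  have : CompleteSpace E := FiniteDimensional.complete ℝ E
  set c := completeGeodesic hc z w₀ t with hcdef
  have hx : completeGeodesic hc z w₀ t ∈ (chartAt E c).source := mem_chart_source E _
  set p₀ := chartState E c (completeGeodesic hc z w₀) t with hp₀
  have hp₀t : p₀.1 ∈ (chartAt E c).target := (chartAt E c).map_source hx
  obtain ⟨Φ, hΦ, hΦ0, hΦd⟩ := exists_analytic_flow (analyticAt_spray hcov hp₀t)
  have e1 : ∀ᶠ y in 𝓝 ((0 : ℝ), p₀), (Φ y).1 ∈ (chartAt E c).target :=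
    (continuousAt_fst.comp hΦ.continuousAt).eventually ((chartAt E c).open_target.mem_nhds (by
      simpa [hΦ0.self_of_nhds] using hp₀t))
  have e2 : ∀ᶠ y in 𝓝 ((0 : ℝ), p₀), Φ (0, y.2) = y.2 :=
    (continuous_snd.tendsto ((0 : ℝ), p₀)).eventually hΦ0
  obtain ⟨ε, hε, hball⟩ := Metric.eventually_nhds_iff_ball.1
    (((hΦ.eventually_analyticAt.and hΦd).and e1).and e2)
  have hmem : ∀ r ∈ Ioo (-ε) ε, ∀ p ∈ Metric.ball p₀ ε, (r, p) ∈ Metric.ball ((0 : ℝ), p₀) ε := by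
    intro r hr p hp
    rw [← ball_prod_same]
    exact ⟨by simpa [abs_lt] using hr, hp⟩
  have hc1 := (isGeodesicAt_completeGeodesic (hc := hc) (z := z) (w := w₀) t)
  -- Half the radius, so that differences of two such times lie in the domain of the flow.
  have hIoo : ∀ᶠ s in 𝓝 t, s ∈ Ioo (t - ε / 2) (t + ε / 2) :=
    Ioo_mem_nhds (by linarith) (by linarith)
  refine ⟨_, (hIoo.and
    ((hc1.1.continuousAt.eventually ((chartAt E c).open_source.mem_nhds hx)).and
    ((hc1.hasDerivAt_chartState hx).continuousAt.eventually (Metric.ball_mem_nhds p₀ hε)))),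
    fun t₁ ht₁ c₁ hP t₂ ht₂ ↦ ⟨c, ?_⟩⟩
  obtain ⟨ht₁, hs₁, hb₁⟩ := ht₁
  obtain ⟨ht₂, -, -⟩ := ht₂
  replace hP := hP.change hs₁
  have hr : t₂ - t₁ ∈ Ioo (-ε) ε := ⟨by linarith [ht₁.2, ht₂.1], by linarith [ht₁.1, ht₂.2]⟩
  have hmain : ∀ᶠ w in 𝓝 w₀, completeGeodesic hc z w t₂ ∈ (chartAt E c).source ∧
      chartState E c (completeGeodesic hc z w) t₂ =
        Φ (t₂ - t₁, chartState E c (completeGeodesic hc z w) t₁) := by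
    filter_upwards [hP.1, hP.2.continuousAt.eventually (Metric.isOpen_ball.mem_nhds hb₁)] with w hw hw'
    set q := chartState E c (completeGeodesic hc z w) t₁
    set J := Ioo (t₁ - ε) (t₁ + ε)
    have hJ : ∀ s ∈ J, s - t₁ ∈ Ioo (-ε) ε := fun s hs ↦ ⟨by linarith [hs.1], by linarith [hs.2]⟩
    have hgeo : ∀ s ∈ J, IsGeodesicAt cov (fun r ↦ (chartAt E c).symm (Φ (r - t₁, q)).1) s ∧
        chartState E c (fun r ↦ (chartAt E c).symm (Φ (r - t₁, q)).1) s = Φ (s - t₁, q) := by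
      intro s hs
      refine isGeodesicAt_of_hasDerivAt (s := fun r ↦ Φ (r - t₁, q)) ?_ ?_ ?_
      · refine AnalyticAt.contDiffAt ?_
        exact AnalyticAt.fun_comp (f := fun r : ℝ ↦ (r - t₁, q)) (hball _ (hmem _ (hJ s hs) q hw')).1.1.1
          ((analyticAt_id.sub analyticAt_const).prod analyticAt_const)
      · filter_upwards [isOpen_Ioo.mem_nhds hs] with r hr
        have := (hball _ (hmem _ (hJ r hr) q hw')).1.1.2
        exact HasDerivAt.comp_sub_const (f := fun r ↦ Φ (r, q)) r t₁ this
      · exact (hball _ (hmem _ (hJ s hs) q hw')).1.2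
    have ht₁J : t₁ ∈ J := ⟨by linarith, by linarith⟩
    have ht₂J : t₂ ∈ J := ⟨by linarith [hr.1], by linarith [hr.2]⟩
    have h0 : Φ (t₁ - t₁, q) = q := by
      rw [sub_self]
      exact (hball _ (hmem 0 (by constructor <;> linarith) q hw')).2
    have heq := eqOn_of_isGeodesicAt hcov isOpen_Ioo isPreconnected_Ioo (fun s hs ↦ (hgeo s hs).1)
      (fun s _ ↦ isGeodesicAt_completeGeodesic (hc := hc) (z := z) (w := w) s) ht₁J
      ((chartAt E c).map_target (hball _ (hmem _ (hJ t₁ ht₁J) q hw')).1.2) hw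
      ((hgeo t₁ ht₁J).2.trans h0)
    refine ⟨?_, ?_⟩
    · rw [← heq ht₂J]
      exact (chartAt E c).map_target (hball _ (hmem _ hr q hw')).1.2
    · rw [← (hgeo t₂ ht₂J).2]
      refine (chartState_congr ?_).symm
      filter_upwards [isOpen_Ioo.mem_nhds ht₂J] with s hs using heq hs
  refine ⟨hmain.mono fun w hw ↦ hw.1, ?_⟩
  have hΦa := (hball _ (hmem _ hr _ hb₁)).1.1.1
  refine (AnalyticAt.fun_comp (f := fun w ↦ (t₂ - t₁, chartState E c (completeGeodesic hc z w) t₁))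
    hΦa (analyticAt_const.prod hP.2)).congr ?_
  exact hmain.mono fun w hw ↦ hw.2.symm

variable [T2Space M] in
-- The good times form a clopen subset of the line. It contains 0, where the state depends affinely
-- on the velocity.
lemma exists_analyticState (hcov : IsRealAnalytic cov) (z : M) (w₀ : E) (t : ℝ) :
    ∃ c, AnalyticState hc z w₀ c t := by
  have hclopen : IsClopen {t | ∃ c, AnalyticState hc z w₀ c t} := by
    refine ⟨⟨isOpen_iff_mem_nhds.2 fun t ht ↦ ?_⟩, isOpen_iff_mem_nhds.2 fun t ht ↦ ?_⟩
    · obtain ⟨N, hN, h⟩ := AnalyticState.eventually (hc := hc) hcov z w₀ t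
      filter_upwards [hN] with t₁ ht₁
      rintro ⟨c, hP⟩
      exact ht (h t₁ ht₁ c hP t (mem_of_mem_nhds hN))
    · obtain ⟨N, hN, h⟩ := AnalyticState.eventually (hc := hc) hcov z w₀ t
      obtain ⟨c, hP⟩ := ht
      filter_upwards [hN] with t₁ ht₁
      exact h t (mem_of_mem_nhds hN) c hP t₁ ht₁
  have hne : ({t | ∃ c, AnalyticState hc z w₀ c t} : Set ℝ).Nonempty := by
    refine ⟨0, z, .of_forall fun w ↦ ?_, ?_⟩
    · rw [completeGeodesic_zero]
      exact mem_chart_source E z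
    · simp only [chartState_completeGeodesic_zero]
      exact analyticAt_const.prod analyticAt_id
  have h := mem_univ t
  rwa [← hclopen.eq_univ hne] at h

variable [T2Space M] in
/-- The exponential map is analytic. -/
lemma contMDiffAt_completeGeodesic (hcov : IsRealAnalytic cov) (z : M) (w₀ : E) (t : ℝ) :
    ContMDiffAt 𝓘(ℝ, E) 𝓘(ℝ, E) ω (fun w ↦ completeGeodesic hc z w t) w₀ := by
  have : CompleteSpace E := FiniteDimensional.complete ℝ E
  obtain ⟨c, h⟩ := exists_analyticState (hc := hc) hcov z w₀ t
  have h1 : AnalyticAt ℝ (fun w ↦ (chartState E c (completeGeodesic hc z w) t).1) w₀ :=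
    AnalyticAt.fun_comp (g := Prod.fst) analyticAt_fst h.2
  have h2 := (contMDiffAt_chart_symm (n := ω) ((chartAt E c).map_source h.1.self_of_nhds)).comp w₀
    (h1.contDiffAt (n := ω)).contMDiffAt
  refine h2.congr_of_eventuallyEq ?_
  filter_upwards [h.1] with w hw
  exact ((chartAt E c).left_inv hw).symm

end GeodesicFlow

/-! ### Normal coordinates with moving centre. -/

section NormalCoordinates
variable {E : Type*} [NormedAddCommGroup E] [NormedSpace ℝ E] [CompleteSpace E]
  {G : E → E →L[ℝ] E →L[ℝ] E} {p : E} {Ω : Set E}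

/-- The geodesic flow for short initial velocities, in coordinates. -/
def IsRadialFlow (G : E → E →L[ℝ] E →L[ℝ] E) (Ω : Set E) (χ : (ℝ × E) × E → E × E) (p : E)
    (ρ : ℝ) : Prop :=
  ∀ t ∈ Ioo (-2 : ℝ) 2, ∀ w ∈ Metric.ball (0 : E) ρ, ∀ q ∈ Metric.ball p ρ,
    AnalyticAt ℝ χ ((t, w), q) ∧ (χ ((t, w), q)).1 ∈ Ω ∧ χ ((0, w), q) = (q, w) ∧
    χ ((t, 0), q) = (q, 0) ∧
    HasDerivAt (fun s ↦ χ ((s, w), q)) ((χ ((t, w), q)).2,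
      -G (χ ((t, w), q)).1 (χ ((t, w), q)).2 (χ ((t, w), q)).2) t

/-- The final clause says that the exponential map at p has derivative the identity at 0, as needed
for the inverse function theorem. -/
lemma exists_isRadialFlow (hG : AnalyticAt ℝ G p) (hΩ : Ω ∈ 𝓝 p) :
    ∃ χ ρ, 0 < ρ ∧ IsRadialFlow G Ω χ p ρ ∧
      ∀ h, fderiv ℝ (fun z : ℝ × E ↦ (χ (z, p)).1) (1, 0) (0, h) = h := by
  -- The geodesic velocity is written as A w, with A the parallel transport along the curve. This
  -- makes the system linear in w, as the rescaled flow requires.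
  let B : E × (E →L[ℝ] E) → E →L[ℝ] E × (E →L[ℝ] E) := fun y ↦
    (ContinuousLinearMap.inl ℝ E (E →L[ℝ] E)).comp y.2
    - (ContinuousLinearMap.inr ℝ E (E →L[ℝ] E)).comp
      (((ContinuousLinearMap.compL ℝ E E E).flip y.2).comp ((G y.1).comp y.2))
  have hB : AnalyticAt ℝ B (p, ContinuousLinearMap.id ℝ E) := by
    have h1 : ContDiffAt ℝ ω (fun y : E × (E →L[ℝ] E) ↦ G y.1) (p, ContinuousLinearMap.id ℝ E) :=
      ContDiffAt.comp (g := G) _ hG.contDiffAt contDiffAt_fst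
    have h4 : ContDiffAt ℝ ω (fun y : E × (E →L[ℝ] E) ↦
        (ContinuousLinearMap.compL ℝ E E E).flip y.2) (p, ContinuousLinearMap.id ℝ E) :=
      (ContinuousLinearMap.contDiff _).contDiffAt.comp _ (by fun_prop)
    have h5 : ContDiffAt ℝ ω (fun y : E × (E →L[ℝ] E) ↦ y.2) (p, ContinuousLinearMap.id ℝ E) := by
      fun_prop
    exact ((contDiffAt_const.clm_comp h5).sub
      (contDiffAt_const.clm_comp (h4.clm_comp (h1.clm_comp h5)))).analyticAt
  have hB1 : ∀ y w, (B y w).1 = y.2 w := fun y w ↦ by simp [B]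
  have hB2 : ∀ y w, (B y w).2 = -(G y.1 (y.2 w)).comp y.2 := fun y w ↦ by simp [B]
  obtain ⟨Ψ, ρ, hρ, hΨ⟩ := exists_rescaled_flow hB (S := Ω ×ˢ univ) (prod_mem_nhds hΩ univ_mem)
  have hmem : ∀ q ∈ Metric.ball p ρ,
      (q, ContinuousLinearMap.id ℝ E) ∈ Metric.ball (p, ContinuousLinearMap.id ℝ E) ρ := by
    intro q hq
    rw [← ball_prod_same]
    exact ⟨hq, Metric.mem_ball_self hρ⟩
  have h0 : ∀ t ∈ Ioo (-2 : ℝ) 2, ∀ q ∈ Metric.ball p ρ,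
      Ψ ((t, 0), (q, ContinuousLinearMap.id ℝ E)) = (q, ContinuousLinearMap.id ℝ E) := by
    intro t ht q hq
    refine eqOn_Ioo_of_hasDerivAt_eq (f := fun t ↦ Ψ ((t, 0), (q, ContinuousLinearMap.id ℝ E)))
      (g := fun _ ↦ (q, ContinuousLinearMap.id ℝ E)) (f' := fun _ ↦ 0)
      (t₀ := 0) (fun s hs ↦ ?_) (fun s _ ↦ hasDerivAt_const _ _) (by simp) ?_ t ht
    · simpa using (hΨ s hs 0 (Metric.mem_ball_self hρ) _ (hmem q hq)).2.2.2
    · exact (hΨ 0 (by simp) 0 (Metric.mem_ball_self hρ) _ (hmem q hq)).2.2.1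
  have hd1 : ∀ t ∈ Ioo (-2 : ℝ) 2, ∀ w ∈ Metric.ball (0 : E) ρ, ∀ q ∈ Metric.ball p ρ,
      HasDerivAt (fun s ↦ (Ψ ((s, w), (q, ContinuousLinearMap.id ℝ E))).1)
        ((Ψ ((t, w), (q, ContinuousLinearMap.id ℝ E))).2 w) t := by
    intro t ht w hw q hq
    rw [← hB1]
    exact (hΨ t ht w hw _ (hmem q hq)).2.2.2.hasFDerivAt.fst.hasDerivAt.congr_deriv (by simp)
  have hd2 : ∀ t ∈ Ioo (-2 : ℝ) 2, ∀ w ∈ Metric.ball (0 : E) ρ, ∀ q ∈ Metric.ball p ρ,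
      HasDerivAt (fun s ↦ (Ψ ((s, w), (q, ContinuousLinearMap.id ℝ E))).2)
        (B (Ψ ((t, w), (q, ContinuousLinearMap.id ℝ E))) w).2 t := by
    intro t ht w hw q hq
    exact (hΨ t ht w hw _ (hmem q hq)).2.2.2.hasFDerivAt.snd.hasDerivAt.congr_deriv (by simp)
  refine ⟨fun z ↦ ((Ψ (z.1, (z.2, ContinuousLinearMap.id ℝ E))).1,
    (Ψ (z.1, (z.2, ContinuousLinearMap.id ℝ E))).2 z.1.2), ρ, hρ, ?_, ?_⟩
  · intro t ht w hw q hq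
    obtain ⟨ha, hS, hz, -⟩ := hΨ t ht w hw _ (hmem q hq)
    have ha' : AnalyticAt ℝ (fun z : (ℝ × E) × E ↦ Ψ (z.1, (z.2, ContinuousLinearMap.id ℝ E)))
        ((t, w), q) :=
      AnalyticAt.fun_comp (f := fun z : (ℝ × E) × E ↦ (z.1, (z.2, ContinuousLinearMap.id ℝ E)))
        ha (analyticAt_fst.prod (analyticAt_snd.prod analyticAt_const))
    refine ⟨?_, hS.1, by simp [hz], by simp [h0 t ht q hq], ?_⟩
    · exact (AnalyticAt.fun_comp analyticAt_fst ha').prod ((AnalyticAt.fun_comp analyticAt_snd ha'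
        ).clm_apply_of_complete (AnalyticAt.fun_comp analyticAt_snd analyticAt_fst))
    · refine (hd1 t ht w hw q hq).prodMk (((hd2 t ht w hw q hq).clm_apply
        (hasDerivAt_const t w)).congr_deriv ?_)
      simp [hB2]
  · intro h
    have hp : p ∈ Metric.ball p ρ := Metric.mem_ball_self hρ
    have hw0 : (0 : E) ∈ Metric.ball (0 : E) ρ := Metric.mem_ball_self hρ
    have ha : ∀ t ∈ Ioo (-2 : ℝ) 2, AnalyticAt ℝ
        (fun z : ℝ × E ↦ Ψ (z, (p, ContinuousLinearMap.id ℝ E))) (t, 0) := fun t ht ↦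
      AnalyticAt.fun_comp (f := fun z : ℝ × E ↦ (z, (p, ContinuousLinearMap.id ℝ E)))
        (hΨ t ht 0 hw0 _ (hmem p hp)).1 (analyticAt_id.prod analyticAt_const)
    -- For w = 0 the transport A is constantly the identity, so the variational equation reads d/dt
    -- (∂_h x) = h.
    have key : ∀ t ∈ Ioo (-2 : ℝ) 2, HasDerivAt
        (fun s ↦ fderiv ℝ (fun z : ℝ × E ↦ (Ψ (z, (p, ContinuousLinearMap.id ℝ E))).1) (s, 0) (0, h))
        h t := by
      intro t ht
      have h1 := hasDerivAt_fderiv_snd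
        (f := fun z : ℝ × E ↦ (Ψ (z, (p, ContinuousLinearMap.id ℝ E))).1)
        (g := fun z : ℝ × E ↦ (Ψ (z, (p, ContinuousLinearMap.id ℝ E))).2 z.2) (t := t) (w := 0)
        (AnalyticAt.fun_comp analyticAt_fst (ha t ht)) (by
          filter_upwards [prod_mem_nhds (isOpen_Ioo.mem_nhds ht) (Metric.isOpen_ball.mem_nhds hw0)]
            with z hz using hd1 z.1 hz.1 z.2 hz.2 p hp) h
      refine h1.congr_deriv ?_
      have h2 : HasFDerivAt (fun z : ℝ × E ↦ (Ψ (z, (p, ContinuousLinearMap.id ℝ E))).2) _ (t, 0) :=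
        (AnalyticAt.fun_comp analyticAt_snd (ha t ht)).differentiableAt.hasFDerivAt
      rw [(h2.clm_apply hasFDerivAt_snd).fderiv]
      simp [h0 t ht p hp]
    have h2 := eqOn_Ioo_of_hasDerivAt_eq key
      (g := fun s ↦ s • h) (fun s _ ↦ by simpa using (hasDerivAt_id s).smul_const h)
      (t₀ := 0) (by simp) (by
        have h3 : HasFDerivAt (fun z : ℝ × E ↦ (Ψ (z, (p, ContinuousLinearMap.id ℝ E))).1) _ (0, 0) :=
          (AnalyticAt.fun_comp (g := Prod.fst) analyticAt_fst
            (ha 0 (by simp))).differentiableAt.hasFDerivAt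
        have h4 := h3.comp (0 : E) (hasFDerivAt_prodMk_right (𝕜 := ℝ) (0 : ℝ) (0 : E))
        have h5 : (fun z : ℝ × E ↦ (Ψ (z, (p, ContinuousLinearMap.id ℝ E))).1) ∘
            (fun w : E ↦ ((0 : ℝ), w)) =ᶠ[𝓝 0] fun _ ↦ p := by
          filter_upwards [Metric.isOpen_ball.mem_nhds hw0] with w hw
          simp [(hΨ 0 (by simp) w hw _ (hmem p hp)).2.2.1]
        have h6 := h4.unique ((hasFDerivAt_const p (0 : E)).congr_of_eventuallyEq h5)
        simpa using DFunLike.congr_fun h6 h) 1 (by norm_num)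
    simpa using h2

/-- Any two points near `p` are joined by a unique short geodesic, which depends analytically on
them. -/
lemma exists_normal_coordinates (hG : AnalyticAt ℝ G p) (hΩ : Ω ∈ 𝓝 p) :
    ∃ (χ : (ℝ × E) × E → E × E) (ρ : ℝ) (v : E × E → E) (r : ℝ), 0 < r ∧ r ≤ ρ ∧
      IsRadialFlow G Ω χ p ρ ∧ ∀ q ∈ Metric.ball p r, ∀ x ∈ Metric.ball p r,
        AnalyticAt ℝ v (q, x) ∧ v (q, x) ∈ Metric.ball 0 ρ ∧ v (q, q) = 0 ∧
        (χ ((1, v (q, x)), q)).1 = x := by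
  obtain ⟨χ, ρ, hρ, hχ, hD⟩ := exists_isRadialFlow hG hΩ
  have hp : p ∈ Metric.ball p ρ := Metric.mem_ball_self hρ
  have hw0 : (0 : E) ∈ Metric.ball (0 : E) ρ := Metric.mem_ball_self hρ
  have h1 : (1 : ℝ) ∈ Ioo (-2 : ℝ) 2 := by norm_num
  set Θ : E × E → E × E := fun z ↦ (z.1, (χ ((1, z.2), z.1)).1) with hΘdef
  have hχa := (hχ 1 h1 0 hw0 p hp).1
  have hΘ2 : AnalyticAt ℝ (fun z : E × E ↦ (χ ((1, z.2), z.1)).1) (p, 0) := by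
    have : AnalyticAt ℝ (fun z : E × E ↦ χ ((1, z.2), z.1)) (p, 0) :=
      AnalyticAt.fun_comp (f := fun z : E × E ↦ (((1 : ℝ), z.2), z.1)) hχa
        ((analyticAt_const.prod analyticAt_snd).prod analyticAt_fst)
    exact AnalyticAt.fun_comp (g := Prod.fst) analyticAt_fst this
  have hΘ : ContDiffAt ℝ ω Θ (p, 0) := (analyticAt_fst.prod hΘ2).contDiffAt
  have hΘp : Θ (p, 0) = (p, p) := by simp [hΘdef, (hχ 1 h1 0 hw0 p hp).2.2.2.1]
  -- The derivative at (p, 0) of (q, w) ↦ (q, exp_q w), namely (h, k) ↦ (h, h + k).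
  let L : (E × E) ≃L[ℝ] E × E := ContinuousLinearEquiv.equivOfInverse
    ((ContinuousLinearMap.fst ℝ E E).prod (ContinuousLinearMap.fst ℝ E E + ContinuousLinearMap.snd ℝ E E))
    ((ContinuousLinearMap.fst ℝ E E).prod (ContinuousLinearMap.snd ℝ E E - ContinuousLinearMap.fst ℝ E E))
    (fun z ↦ by simp) (fun z ↦ by simp)
  have hL : HasFDerivAt Θ (L : E × E →L[ℝ] E × E) (p, 0) := by
    have hd := hΘ2.differentiableAt.hasFDerivAt
    refine (hasFDerivAt_fst.prodMk hd).congr_fderiv ?_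
    have e1 : ∀ h, fderiv ℝ (fun z : E × E ↦ (χ ((1, z.2), z.1)).1) (p, 0) (h, 0) = h := by
      intro h
      have h4 := hd.comp p (hasFDerivAt_prodMk_left (𝕜 := ℝ) p (0 : E))
      have h5 : (fun z : E × E ↦ (χ ((1, z.2), z.1)).1) ∘ (fun q : E ↦ (q, (0 : E))) =ᶠ[𝓝 p] id := by
        filter_upwards [Metric.isOpen_ball.mem_nhds hp] with q hq
        simp [(hχ 1 h1 0 hw0 q hq).2.2.2.1]
      have h6 := h4.unique ((hasFDerivAt_id (𝕜 := ℝ) p).congr_of_eventuallyEq h5)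
      simpa using DFunLike.congr_fun h6 h
    have e2 : ∀ h, fderiv ℝ (fun z : E × E ↦ (χ ((1, z.2), z.1)).1) (p, 0) (0, h) = h := by
      intro h
      have h4 := hd.comp (0 : E) (hasFDerivAt_prodMk_right (𝕜 := ℝ) p (0 : E))
      have h5 : HasFDerivAt (fun z : ℝ × E ↦ (χ (z, p)).1)
          (fderiv ℝ (fun z : ℝ × E ↦ (χ (z, p)).1) (1, 0)) (1, 0) := by
        have : AnalyticAt ℝ (fun z : ℝ × E ↦ χ (z, p)) (1, 0) :=
          AnalyticAt.fun_comp (f := fun z : ℝ × E ↦ (z, p)) hχa (analyticAt_id.prod analyticAt_const)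
        exact (AnalyticAt.fun_comp (g := Prod.fst) analyticAt_fst this).differentiableAt.hasFDerivAt
      have h6 := h4.unique (h5.comp (0 : E) (hasFDerivAt_prodMk_right (𝕜 := ℝ) (1 : ℝ) (0 : E)))
      have h7 := DFunLike.congr_fun h6 h
      simp only [ContinuousLinearMap.comp_apply, ContinuousLinearMap.inr_apply] at h7
      rw [h7, hD]
    ext h
    · simp [L]
    · simp [L, e1]
    · simp [L]
    · simp [L, e2]
  have hω : (ω : ℕ∞ω) ≠ 0 := by simp
  have hs := hΘ.hasStrictFDerivAt' hL hω
  set g := hΘ.localInverse hL hω with hgdef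
  have hg : ContDiffAt ℝ ω g (p, p) := hΘp ▸ hΘ.to_localInverse hL hω
  have hr : ∀ᶠ y in 𝓝 (p, p), Θ (g y) = y := hΘp ▸ hs.eventually_right_inverse
  have hl : ∀ᶠ y in 𝓝 (p, (0 : E)), g (Θ y) = y := hs.eventually_left_inverse
  have hgp : g (p, p) = (p, 0) := by rw [← hΘp]; exact hl.self_of_nhds
  have hl' : ∀ᶠ q in 𝓝 p, g (q, q) = (q, 0) := by
    have : Tendsto (fun q : E ↦ (q, (0 : E))) (𝓝 p) (𝓝 (p, 0)) :=
      Continuous.tendsto (by fun_prop) p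
    filter_upwards [this.eventually hl, Metric.isOpen_ball.mem_nhds hp] with q h2 hq
    simpa [hΘdef, (hχ 1 h1 0 hw0 q hq).2.2.2.1] using h2
  have hl'' : ∀ᶠ y in 𝓝 (p, p), g (y.1, y.1) = (y.1, 0) := (continuous_fst.tendsto (p, p)).eventually hl'
  have hb : ∀ᶠ y in 𝓝 (p, p), (g y).2 ∈ Metric.ball (0 : E) ρ :=
    (continuousAt_snd.comp hg.continuousAt).eventually (Metric.isOpen_ball.mem_nhds (by
      simpa [hgp] using hρ))
  obtain ⟨r, hr0, hball⟩ := Metric.eventually_nhds_iff_ball.1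
    (((hg.analyticAt.eventually_analyticAt.and hr).and hl'').and hb)
  refine ⟨χ, ρ, fun y ↦ (g y).2, min r ρ, lt_min hr0 hρ, min_le_right _ _, hχ, fun q hq x hx ↦ ?_⟩
  have hm : (q, x) ∈ Metric.ball (p, p) r := by
    rw [← ball_prod_same]
    exact ⟨Metric.ball_subset_ball (min_le_left _ _) hq, Metric.ball_subset_ball (min_le_left _ _) hx⟩
  obtain ⟨⟨⟨ha, hri⟩, hli⟩, hbb⟩ := hball _ hm
  have hg1 : (g (q, x)).1 = q := congrArg Prod.fst hri
  refine ⟨AnalyticAt.fun_comp analyticAt_snd ha, hbb, by simp [hli], ?_⟩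
  have := congrArg Prod.snd hri
  simpa [hΘdef, hg1] using this

end NormalCoordinates

/-! ### Analytic continuation of affine maps along normal neighbourhoods. -/

section Continuation
variable {E : Type*} [NormedAddCommGroup E] [NormedSpace ℝ E] [FiniteDimensional ℝ E]
  {M : Type*} [TopologicalSpace M] [ChartedSpace E M] [IsManifold 𝓘(ℝ, E) ω M]
  {cov : Connection E M} {c c' x q z : M} {t : ℝ} {f g : M → M} {W : Set M}

/-- A chart ball around `x` on which the chart representation of an analytic map is analytic. -/
lemma exists_ball_analyticAt_chartRep (hf : ContMDiffAt 𝓘(ℝ, E) 𝓘(ℝ, E) ω f x)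
    (hfx : f x ∈ (chartAt E c').source) :
    ∀ᶠ y in 𝓝 (chartAt E x x), y ∈ (chartAt E x).target ∧
      AnalyticAt ℝ (chartRep x c' f) y ∧ f ((chartAt E x).symm y) ∈ (chartAt E c').source := by
  have : CompleteSpace E := FiniteDimensional.complete ℝ E
  have hx := mem_chart_source E x
  have h1 : AnalyticAt ℝ (chartRep x c' f) (chartAt E x x) := (contDiffAt_chartRep hx hfx hf).analyticAt
  exact ((chartAt E x).open_target.eventually_mem ((chartAt E x).map_source hx)).and
    (h1.eventually_analyticAt.and ((tendsto_chartAt_symm hx).eventually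
      (hf.continuousAt.eventually ((chartAt E c').open_source.mem_nhds hfx))))

variable [T2Space M] in
/-- Analytic maps which agree near a point of a preconnected set agree on this set. -/
lemma eventuallyEq_of_contMDiffAt (hW : IsPreconnected W)
    (hf : ∀ x ∈ W, ContMDiffAt 𝓘(ℝ, E) 𝓘(ℝ, E) ω f x)
    (hg : ∀ x ∈ W, ContMDiffAt 𝓘(ℝ, E) 𝓘(ℝ, E) ω g x) (hq : q ∈ W) (h : f =ᶠ[𝓝 q] g) :
    ∀ x ∈ W, f =ᶠ[𝓝 x] g := by
  refine hW.subset_of_closure_inter_subset isOpen_setOfPred_eventually_nhds ⟨q, hq, h⟩ ?_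
  rintro x ⟨hxc, hxW⟩
  have hfr : ∃ᶠ r in 𝓝 x, f =ᶠ[𝓝 r] g := mem_closure_iff_frequently.1 hxc
  have he : f x = g x := tendsto_nhds_unique_of_frequently_eq (hf x hxW).continuousAt
    (hg x hxW).continuousAt (hfr.mono fun r hr ↦ hr.self_of_nhds)
  have hx := mem_chart_source E x
  have hfx : f x ∈ (chartAt E (f x)).source := mem_chart_source E _
  have hgx : g x ∈ (chartAt E (f x)).source := he ▸ hfx
  obtain ⟨r, hr, hball⟩ := Metric.eventually_nhds_iff_ball.1
    ((exists_ball_analyticAt_chartRep (hf x hxW) hfx).and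
      (exists_ball_analyticAt_chartRep (hg x hxW) hgx))
  have hn : ∀ᶠ y in 𝓝 x, y ∈ (chartAt E x).source ∧ chartAt E x y ∈ Metric.ball (chartAt E x x) r :=
    ((chartAt E x).open_source.eventually_mem hx).and
      (((chartAt E x).continuousAt hx).eventually (Metric.ball_mem_nhds _ hr))
  -- Germs agree at some s inside a chart ball around the limit point; the identity theorem on the
  -- ball reaches the centre.
  obtain ⟨s, hs, hsx, hsb⟩ := (hfr.and_eventually hn).exists
  have heq := AnalyticOnNhd.eqOn_of_preconnected_of_eventuallyEq
    (fun y hy ↦ (hball y hy).1.2.1) (fun y hy ↦ (hball y hy).2.2.1)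
    (convex_ball _ _).isPreconnected hsb (eventuallyEq_chartRep hsx hs)
  filter_upwards [hn] with y hy
  have h1 := heq hy.2
  have h2 := (hball _ hy.2).1.2.2
  have h3 := (hball _ hy.2).2.2.2
  simp only [chartRep, Function.comp_apply, (chartAt E x).left_inv hy.1] at h1 h2 h3
  exact (chartAt E (f x)).injOn h2 h3 h1

variable [T2Space M] in
/-- An analytic map which is affine near a point of a preconnected set is affine on this set. -/
lemma isAffineAt_of_contMDiffAt (hcov : IsRealAnalytic cov) (hW : IsPreconnected W)
    (hf : ∀ x ∈ W, ContMDiffAt 𝓘(ℝ, E) 𝓘(ℝ, E) ω f x) (hq : q ∈ W)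
    (h : ∀ᶠ y in 𝓝 q, IsAffineAt cov f y) : ∀ x ∈ W, ∀ᶠ y in 𝓝 x, IsAffineAt cov f y := by
  have : CompleteSpace E := FiniteDimensional.complete ℝ E
  refine hW.subset_of_closure_inter_subset isOpen_setOfPred_eventually_nhds ⟨q, hq, h⟩ ?_
  rintro x ⟨hxc, hxW⟩
  have hfr : ∃ᶠ r in 𝓝 x, ∀ᶠ y in 𝓝 r, IsAffineAt cov f y := mem_closure_iff_frequently.1 hxc
  have hx := mem_chart_source E x
  have hfx : f x ∈ (chartAt E (f x)).source := mem_chart_source E _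
  obtain ⟨r, hr, hball⟩ := Metric.eventually_nhds_iff_ball.1
    (exists_ball_analyticAt_chartRep (hf x hxW) hfx)
  have hn : ∀ᶠ y in 𝓝 x, y ∈ (chartAt E x).source ∧ chartAt E x y ∈ Metric.ball (chartAt E x x) r :=
    ((chartAt E x).open_source.eventually_mem hx).and
      (((chartAt E x).continuousAt hx).eventually (Metric.ball_mem_nhds _ hr))
  obtain ⟨s, hs, hsx, hsb⟩ := (hfr.and_eventually hn).exists
  set R : E → E := chartRep x (f x) f with hR
  have haff : ∀ y ∈ Metric.ball (chartAt E x x) r,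
      AffineEq (christoffel cov x) (christoffel cov (f x)) R y := by
    -- For fixed u and v both sides of the affine equation are analytic on the ball, and they agree
    -- near s.
    have key : ∀ u v, EqOn (fun y ↦ fderiv ℝ (fderiv ℝ R) y u v
        + christoffel cov (f x) (R y) (fderiv ℝ R y u) (fderiv ℝ R y v))
        (fun y ↦ fderiv ℝ R y (christoffel cov x y u v)) (Metric.ball (chartAt E x x) r) := by
      intro u v
      have hs' : ∀ᶠ y in 𝓝 (chartAt E x s), AffineEq (christoffel cov x) (christoffel cov (f x)) R y := by
        filter_upwards [(tendsto_chartAt_symm hsx).eventually hs, Metric.isOpen_ball.mem_nhds hsb]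
          with y hy hyb
        have hyt := (hball y hyb).1
        have := (isAffineAt_iff ((chartAt E x).map_target hyt) (hball y hyb).2.2 hy.1).1 hy
        rwa [(chartAt E x).right_inv hyt] at this
      refine AnalyticOnNhd.eqOn_of_preconnected_of_eventuallyEq (𝕜 := ℝ) (fun y hy ↦ ?_) (fun y hy ↦ ?_)
        (convex_ball (chartAt E x x) r).isPreconnected hsb (hs'.mono fun y hy ↦ hy u v)
      · have hRa := (hball y hy).2.1
        have hG : AnalyticAt ℝ (fun y ↦ christoffel cov (f x) (R y)) y := by
          refine AnalyticAt.fun_comp (f := R) (analyticOnNhd_christoffel hcov (f x) _ ?_) hRa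
          exact (chartAt E (f x)).map_source (hball y hy).2.2
        exact ((hRa.fderiv.fderiv.clm_apply_of_complete analyticAt_const).clm_apply_of_complete
          analyticAt_const).add ((hG.clm_apply_of_complete
            (hRa.fderiv.clm_apply_of_complete analyticAt_const)).clm_apply_of_complete
            (hRa.fderiv.clm_apply_of_complete analyticAt_const))
      · exact (hball y hy).2.1.fderiv.clm_apply_of_complete
          (((analyticOnNhd_christoffel hcov x _ (hball y hy).1).clm_apply_of_complete
            analyticAt_const).clm_apply_of_complete analyticAt_const)
    intro y hy u v
    exact key u v hy
  filter_upwards [hn, (contMDiffAt_iff_contMDiffAt_nhds (by simp)).1 (hf x hxW),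
    (hf x hxW).continuousAt.eventually ((chartAt E (f x)).open_source.mem_nhds hfx)] with y hy h1 h2
  exact (isAffineAt_iff hy.1 h2 (h1.of_le le_top)).2 (haff _ hy.2)

/-- A neighbourhood any two points of which are joined by a short geodesic, depending analytically
on the points. -/
lemma exists_normal_nhds (hcov : IsRealAnalytic cov) (p : M) :
    ∃ W : Set M, IsOpen W ∧ p ∈ W ∧ IsPreconnected W ∧ W ⊆ (chartAt E p).source ∧
      ∃ (v : E × E → E) (β : M → M → ℝ → M), ∀ q ∈ W,
        (∀ x ∈ W, AnalyticAt ℝ v (chartAt E p q, chartAt E p x) ∧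
          (∀ t ∈ Ioo (-2 : ℝ) 2, IsGeodesicAt cov (β q x) t) ∧ β q x 0 = q ∧
          chartVel E p (β q x) 0 = v (chartAt E p q, chartAt E p x) ∧ β q x 1 = x) ∧
        ∀ V ∈ 𝓝 q, ∀ᶠ x in 𝓝 q, ∀ t ∈ Icc (-1 : ℝ) (3 / 2), β q x t ∈ V := by
  have : CompleteSpace E := FiniteDimensional.complete ℝ E
  have hp := mem_chart_source E p
  have hpt := (chartAt E p).map_source hp
  obtain ⟨χ, ρ, v, r, hr, hrρ, hχ, hv⟩ := exists_normal_coordinates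
    (analyticOnNhd_christoffel hcov p _ hpt) ((chartAt E p).open_target.mem_nhds hpt)
  have hw0 : (0 : E) ∈ Metric.ball (0 : E) ρ := Metric.mem_ball_self (hr.trans_le hrρ)
  have hm0 : (0 : ℝ) ∈ Ioo (-2 : ℝ) 2 := by norm_num
  have hm1 : (1 : ℝ) ∈ Ioo (-2 : ℝ) 2 := by norm_num
  have hsub : Metric.ball (chartAt E p p) r ⊆ (chartAt E p).target := by
    intro y hy
    have h1 := hχ 0 hm0 0 hw0 y (Metric.ball_subset_ball hrρ hy)
    simpa [h1.2.2.1] using h1.2.1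
  refine ⟨(chartAt E p).symm '' Metric.ball (chartAt E p p) r,
    (chartAt E p).symm.isOpen_image_of_subset_source Metric.isOpen_ball hsub,
    ⟨_, Metric.mem_ball_self hr, (chartAt E p).left_inv hp⟩,
    (convex_ball _ _).isPreconnected.image _ ((chartAt E p).continuousOn_symm.mono hsub), ?_, v,
    fun q x t ↦ (chartAt E p).symm (χ ((t, v (chartAt E p q, chartAt E p x)), chartAt E p q)).1, ?_⟩
  · rintro _ ⟨y, hy, rfl⟩
    exact (chartAt E p).map_target (hsub hy)
  rintro _ ⟨q, hq, rfl⟩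
  have hqρ := Metric.ball_subset_ball hrρ hq
  have hqt := hsub hq
  simp only [(chartAt E p).right_inv hqt]
  have hcont : ∀ t ∈ Ioo (-2 : ℝ) 2, ∀ w ∈ Metric.ball (0 : E) ρ,
      AnalyticAt ℝ (fun z : ℝ × E ↦ χ (z, q)) (t, w) := fun t ht w hw ↦
    AnalyticAt.fun_comp (f := fun z : ℝ × E ↦ (z, q)) (hχ t ht w hw q hqρ).1
      (analyticAt_id.prod analyticAt_const)
  constructor
  · rintro _ ⟨x, hx, rfl⟩
    simp only [(chartAt E p).right_inv (hsub hx)]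
    obtain ⟨hva, hvb, -, hvx⟩ := hv q hq x hx
    have hgeo : ∀ t ∈ Ioo (-2 : ℝ) 2,
        IsGeodesicAt cov (fun t ↦ (chartAt E p).symm (χ ((t, v (q, x)), q)).1) t ∧
        chartState E p (fun t ↦ (chartAt E p).symm (χ ((t, v (q, x)), q)).1) t =
          χ ((t, v (q, x)), q) := by
      intro t ht
      refine isGeodesicAt_of_hasDerivAt (s := fun t ↦ χ ((t, v (q, x)), q)) ?_ ?_ ?_
      · exact (AnalyticAt.fun_comp (f := fun s : ℝ ↦ (s, v (q, x))) (hcont t ht _ hvb)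
          (analyticAt_id.prod analyticAt_const)).contDiffAt
      · filter_upwards [isOpen_Ioo.mem_nhds ht] with s hs
        exact (hχ s hs _ hvb q hqρ).2.2.2.2
      · exact (hχ t ht _ hvb q hqρ).2.1
    have h0 := (hχ 0 hm0 _ hvb q hqρ).2.2.1
    refine ⟨hva, fun t ht ↦ (hgeo t ht).1, by simp [h0], ?_, by simp [hvx]⟩
    exact (congrArg Prod.snd (hgeo 0 hm0).2).trans (by rw [h0])
  · intro V hV
    have hxs := (chartAt E p).map_target hqt
    have hKey : ∀ᶠ x in 𝓝 ((chartAt E p).symm q), ∀ t ∈ Icc (-1 : ℝ) (3 / 2),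
        (chartAt E p).symm (χ ((t, v (q, chartAt E p x)), q)).1 ∈ V := by
      -- At x = q the geodesic is constant; compactness of the time interval makes the smallness for
      -- nearby x uniform in time.
      refine isCompact_Icc.eventually_forall_of_forall_eventually fun t ht ↦ ?_
      have ht' : t ∈ Ioo (-2 : ℝ) 2 := ⟨by linarith [ht.1], by linarith [ht.2]⟩
      have hv0 : v (q, chartAt E p ((chartAt E p).symm q)) = 0 := by
        rw [(chartAt E p).right_inv hqt]
        exact (hv q hq q hq).2.2.1
      have c1 : ContinuousAt (fun y : M × ℝ ↦ v (q, chartAt E p y.1)) ((chartAt E p).symm q, t) := by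
        refine ContinuousAt.comp (f := fun y : M × ℝ ↦ (q, chartAt E p y.1)) (g := v) ?_ ?_
        · rw [(chartAt E p).right_inv hqt]
          exact (hv q hq q hq).1.continuousAt
        · exact continuousAt_const.prodMk
            (ContinuousAt.comp (f := Prod.fst) ((chartAt E p).continuousAt hxs) continuousAt_fst)
      have c2 : ContinuousAt (fun y : M × ℝ ↦ χ ((y.2, v (q, chartAt E p y.1)), q))
          ((chartAt E p).symm q, t) := by
        refine ContinuousAt.comp (f := fun y : M × ℝ ↦ (y.2, v (q, chartAt E p y.1)))
          (g := fun z ↦ χ (z, q)) ?_ (continuousAt_snd.prodMk c1)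
        rw [hv0]
        exact (hcont t ht' 0 hw0).continuousAt
      have e0 : χ ((t, v (q, chartAt E p ((chartAt E p).symm q))), q) = (q, 0) := by
        rw [hv0]
        exact (hχ t ht' 0 hw0 q hqρ).2.2.2.1
      have c3 : ContinuousAt (fun y : M × ℝ ↦
          (chartAt E p).symm (χ ((y.2, v (q, chartAt E p y.1)), q)).1) ((chartAt E p).symm q, t) := by
        refine ContinuousAt.comp (f := fun y : M × ℝ ↦ (χ ((y.2, v (q, chartAt E p y.1)), q)).1) ?_
          (continuousAt_fst.comp c2)
        rw [e0]
        exact (chartAt E p).continuousAt_symm hqt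
      refine c3.eventually ?_
      simp only [e0]
      exact hV
    exact hKey

variable [T2Space M] in
/-- Every point of a complete manifold has a connected neighbourhood over which all affine germs
extend. -/
lemma exists_affine_extension (hcov : IsRealAnalytic cov) (hc : IsGeodesicallyComplete cov) (p : M) :
    ∃ W : Set M, IsOpen W ∧ p ∈ W ∧ IsPreconnected W ∧ ∀ q ∈ W, ∀ f : M → M,
      (∀ᶠ y in 𝓝 q, IsAffineAt cov f y) → ∃ F : M → M, (∀ x ∈ W, IsAffineAt cov F x) ∧
        (∀ x ∈ W, ContMDiffAt 𝓘(ℝ, E) 𝓘(ℝ, E) ω F x) ∧ F =ᶠ[𝓝 q] f := by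
  have : CompleteSpace E := FiniteDimensional.complete ℝ E
  obtain ⟨W, hWo, hpW, hWc, hWs, v, β, hβ⟩ := exists_normal_nhds hcov p
  refine ⟨W, hWo, hpW, hWc, fun q hq f hf ↦ ?_⟩
  set A := fderiv ℝ (chartRep p (f q) f) (chartAt E p q) with hA
  -- The map exp ∘ df ∘ exp⁻¹ with centres q and f q. Completeness defines it on all of W, whatever
  -- the germ f.
  set F : M → M := fun x ↦ completeGeodesic hc (f q) (A (v (chartAt E p q, chartAt E p x))) 1 with hF
  have hfq : f q ∈ (chartAt E (f q)).source := mem_chart_source E _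
  have hFω : ∀ x ∈ W, ContMDiffAt 𝓘(ℝ, E) 𝓘(ℝ, E) ω F x := by
    intro x hx
    have h1 : AnalyticAt ℝ (fun y ↦ A (v (chartAt E p q, y))) (chartAt E p x) :=
      (A.analyticAt _).comp (AnalyticAt.fun_comp (f := fun y ↦ (chartAt E p q, y)) ((hβ q hq).1 x hx).1
        (analyticAt_const.prod analyticAt_id))
    exact (contMDiffAt_completeGeodesic (hc := hc) hcov (f q) _ 1).comp x
      ((h1.contDiffAt (n := ω)).contMDiffAt.comp x (contMDiffAt_chart (hWs hx)))
  have hFf : F =ᶠ[𝓝 q] f := by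
    -- For x near q the short geodesic stays where f is affine, so f maps it to a geodesic with the
    -- same initial state as the one defining F.
    filter_upwards [(hβ q hq).2 _ hf, hWo.mem_nhds hq] with x hx hxW
    obtain ⟨-, hgeo, h0, hv0, h1⟩ := (hβ q hq).1 x hxW
    set γ := β q x
    have hqs : γ 0 ∈ (chartAt E p).source := h0 ▸ hWs hq
    have hm0 : (0 : ℝ) ∈ Ioo (-1 : ℝ) (3 / 2) := by norm_num
    have hJ : ∀ t ∈ Ioo (-1 : ℝ) (3 / 2), IsGeodesicAt cov γ t ∧ IsAffineAt cov f (γ t) := fun t ht ↦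
      ⟨hgeo t ⟨by linarith [ht.1], by linarith [ht.2]⟩, hx t ⟨ht.1.le, ht.2.le⟩⟩
    have hst : chartState E (f q) (f ∘ γ) 0 = chartState E (f q)
        (completeGeodesic hc (f q) (A (v (chartAt E p q, chartAt E p x)))) 0 := by
      rw [chartState_completeGeodesic_zero]
      refine Prod.ext ?_ ?_
      · simp [chartState, h0]
      · refine (chartVel_comp ((hJ 0 hm0).2.1.mdifferentiableAt (by simp))
          ((hJ 0 hm0).1.1.mdifferentiableAt (by simp)) hqs (by rw [h0]; exact hfq)).trans ?_
        rw [hv0, h0]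
    have := eqOn_of_isGeodesicAt hcov isOpen_Ioo isPreconnected_Ioo
      (fun s hs ↦ (hJ s hs).2.comp_isGeodesicAt (hJ s hs).1)
      (fun s _ ↦ isGeodesicAt_completeGeodesic (hc := hc) (z := f q)
        (w := A (v (chartAt E p q, chartAt E p x))) s) hm0 (c := f q)
      (by simp [h0]) (by rw [completeGeodesic_zero]; exact hfq) hst
    have h2 := this (x := 1) (by norm_num)
    simp only [Function.comp_apply, h1] at h2
    exact h2.symm
  -- F inherits affinity near q from f, and analyticity spreads it over W.
  have haff : ∀ᶠ y in 𝓝 q, IsAffineAt cov F y := by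
    filter_upwards [hf, hFf.eventuallyEq_nhds] with y h1 h2 using h1.congr h2
  exact ⟨F, fun x hx ↦ (isAffineAt_of_contMDiffAt hcov hWc hFω hq haff x hx).self_of_nhds, hFω, hFf⟩

end Continuation

/-! ### Global sections from unique local extension. -/

section Germs
open CategoryTheory TopologicalSpace Opposite
universe u
variable {X Y : Type u} [TopologicalSpace X] {P : (X → Y) → X → Prop}

/-- The presheaf of maps whose germs all satisfy `P`. -/
def germPredicate (P : (X → Y) → X → Prop) :
    TopCat.PrelocalPredicate (X := TopCat.of X) (fun _ ↦ Y) where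
  pred {U} f := ∃ F : X → Y, (∀ x ∈ U, P F x) ∧ ∀ x : U, f x = F x
  res {U V} i f h := by
    obtain ⟨F, hF, hf⟩ := h
    exact ⟨F, fun x hx ↦ hF x (i.le hx), fun x ↦ hf ⟨x, i.le x.2⟩⟩

/-- The presheaf of maps whose germs all satisfy `P`. -/
def germPresheaf (P : (X → Y) → X → Prop) : TopCat.Presheaf (Type u) (TopCat.of X) :=
  TopCat.subpresheafToTypes (germPredicate P)

/-- The section of `germPresheaf P` given by a map. -/
def germSection (U : Opens (TopCat.of X)) (F : X → Y) (hF : ∀ x ∈ U, P F x) :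
    ToType ((germPresheaf P).obj (op U)) := (⟨fun x ↦ F x, F, hF, fun _ ↦ rfl⟩ :
      { f : ∀ _ : U, Y // (germPredicate P).pred f })

lemma exists_eq_germSection {U : Opens (TopCat.of X)} (s : ToType ((germPresheaf P).obj (op U))) :
    ∃ F, ∃ hF : ∀ x ∈ U, P F x, s = germSection U F hF := by
  obtain ⟨f, F, hF, h⟩ : { f : ∀ _ : U, Y // (germPredicate P).pred f } := s
  exact ⟨F, hF, Subtype.ext (funext h)⟩

lemma germSection_eq_iff {U : Opens (TopCat.of X)} {F F' : X → Y} {hF : ∀ x ∈ U, P F x}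
    {hF' : ∀ x ∈ U, P F' x} : germSection U F hF = germSection U F' hF' ↔ EqOn F F' U := by
  constructor
  · intro h x hx
    exact congrFun (congrArg Subtype.val h) ⟨x, hx⟩
  · intro h
    exact Subtype.ext (funext fun x ↦ h x.2)

lemma map_germSection {U V : Opens (TopCat.of X)} (i : U ⟶ V) {F : X → Y} (hF : ∀ x ∈ V, P F x) :
    (germPresheaf P).map i.op (germSection V F hF) = germSection U F fun x hx ↦ hF x (i.le hx) :=
  rfl

lemma germ_germSection_eq_iff {U V : Opens (TopCat.of X)} {F F' : X → Y} {hF : ∀ x ∈ U, P F x}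
    {hF' : ∀ x ∈ V, P F' x} {x : X} (hx : x ∈ U) (hx' : x ∈ V) :
    (germPresheaf P).germ U x hx (germSection U F hF) = (germPresheaf P).germ V x hx' (germSection V F' hF')
      ↔ F =ᶠ[𝓝 x] F' := by
  constructor
  · intro h
    obtain ⟨W, hxW, iU, iV, hW⟩ := (germPresheaf P).germ_eq x hx hx' _ _ h
    rw [map_germSection, map_germSection, germSection_eq_iff] at hW
    filter_upwards [W.isOpen.mem_nhds hxW] with y hy using hW hy
  · intro h
    obtain ⟨O, hO, hOo, hxO⟩ := eventually_nhds_iff.1 h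
    let W : Opens (TopCat.of X) := ⟨O, hOo⟩ ⊓ (U ⊓ V)
    refine (germPresheaf P).germ_ext W ⟨hxO, hx, hx'⟩ (homOfLE (inf_le_right.trans inf_le_left))
      (homOfLE (inf_le_right.trans inf_le_right)) ?_
    rw [map_germSection, map_germSection, germSection_eq_iff]
    exact fun y hy ↦ hO y hy.1

/-- Uniqueness of continuation gives injectivity and extension of germs gives surjectivity: W is
evenly covered by the étalé space. -/
lemma bijective_germ (W : Opens (TopCat.of X))
    (hext : ∀ q ∈ W, ∀ f, P f q → ∃ F, (∀ x ∈ W, P F x) ∧ F =ᶠ[𝓝 q] f)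
    (huniq : ∀ q ∈ W, ∀ f g, (∀ x ∈ W, P f x) → (∀ x ∈ W, P g x) → f =ᶠ[𝓝 q] g → EqOn f g W)
    (y : TopCat.of X) (hy : y ∈ W) : Function.Bijective ((germPresheaf P).germ W y hy) := by
  constructor
  · intro s t h
    obtain ⟨F, hF, rfl⟩ := exists_eq_germSection s
    obtain ⟨G, hG, rfl⟩ := exists_eq_germSection t
    rw [germSection_eq_iff]
    exact huniq y hy F G hF hG ((germ_germSection_eq_iff hy hy).1 h)
  · intro t
    obtain ⟨V, hyV, s, rfl⟩ := (germPresheaf P).exists_germ_eq t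
    obtain ⟨F, hF, rfl⟩ := exists_eq_germSection s
    obtain ⟨G, hG, hGF⟩ := hext y hy F (hF y hyV)
    exact ⟨germSection W G hG, (germ_germSection_eq_iff hy hyV).2 hGF⟩

/-- Analytic continuation: if germs extend uniquely over small open sets, then over a simply
connected space every germ extends globally. -/
theorem exists_global_extension [SimplyConnectedSpace X] [LocallyPathConnectedSpace X]
    (hcongr : ∀ {f g x}, P f x → g =ᶠ[𝓝 x] f → P g x)
    (hopen : ∀ {f x}, P f x → ∀ᶠ y in 𝓝 x, P f y)
    (hloc : ∀ p : X, ∃ W : Set X, IsOpen W ∧ p ∈ W ∧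
      (∀ q ∈ W, ∀ f, P f q → ∃ F, (∀ x ∈ W, P F x) ∧ F =ᶠ[𝓝 q] f) ∧
      ∀ q ∈ W, ∀ f g, (∀ x ∈ W, P f x) → (∀ x ∈ W, P g x) → f =ᶠ[𝓝 q] g → EqOn f g W)
    {f₀ : X → Y} {x₀ : X} (h₀ : P f₀ x₀) : ∃ F, (∀ x, P F x) ∧ F =ᶠ[𝓝 x₀] f₀ := by
  -- Each germ over W belongs to exactly one section over W, so the étalé space is a product with a
  -- discrete fibre there.
  have hcov : IsCoveringMap (TopCat.Presheaf.EtaleSpace.base (F := germPresheaf P)) := by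
    refine TopCat.Presheaf.EtaleSpace.isCoveringMap_base fun p ↦ ?_
    obtain ⟨W, hWo, hpW, h1, h2⟩ := hloc p
    exact ⟨⟨W, hWo⟩, hpW, fun y hy ↦ bijective_germ ⟨W, hWo⟩ h1 h2 y hy⟩
  obtain ⟨O, hO, hOo, hxO⟩ := eventually_nhds_iff.1 (hopen h₀)
  let U : Opens (TopCat.of X) := ⟨O, hOo⟩
  let g₀ : (germPresheaf P).EtaleSpace := ⟨x₀, (germPresheaf P).germ U x₀ hxO (germSection U f₀ hO)⟩
  -- Lifting the identity through the covering gives a continuous choice of germs; this is where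
  -- simple connectedness is used.
  obtain ⟨σ, ⟨hσ₀, hσ⟩, -⟩ := hcov.existsUnique_continuousMap_lifts (A := X)
    (ContinuousMap.id X) x₀ g₀ rfl
  have hbase : ∀ x, (σ x).base = x := fun x ↦ congrFun hσ x
  have hrep : ∀ g : (germPresheaf P).EtaleSpace, ∃ F : X → Y, ∃ (V : Opens (TopCat.of X))
      (hV : g.base ∈ V) (hF : ∀ x ∈ V, P F x), g.germ = (germPresheaf P).germ V g.base hV (germSection V F hF) := by
    intro g
    obtain ⟨V, hV, s, hs⟩ := (germPresheaf P).exists_germ_eq g.germ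
    obtain ⟨F, hF, rfl⟩ := exists_eq_germSection s
    exact ⟨F, V, hV, hF, hs.symm⟩
  -- Representatives are chosen independently at each point. The value at the base point depends
  -- only on the germ, and continuity of the lift makes these values locally those of a single map.
  choose R V hV hR hgerm using hrep
  have hval : ∀ (g : (germPresheaf P).EtaleSpace) (V : Opens (TopCat.of X)) (hV : g.base ∈ V) (F : X → Y)
      (hF : ∀ x ∈ V, P F x), g.germ = (germPresheaf P).germ V g.base hV (germSection V F hF) →
      R g g.base = F g.base := by
    intro g V hV F hF h
    exact ((germ_germSection_eq_iff _ _).1 ((hgerm g).symm.trans h)).self_of_nhds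
  have hF : ∀ x, ∀ (V : Opens (TopCat.of X)) (hV : (σ x).base ∈ V) (G : X → Y) (hG : ∀ x ∈ V, P G x),
      (germPresheaf P).germ V (σ x).base hV (germSection V G hG) = (σ x).germ →
      (fun y ↦ R (σ y) y) =ᶠ[𝓝 x] G := by
    intro x V hV G hG h
    filter_upwards [σ.continuous.continuousAt.eventually ((σ x).eventually_nhds hV _ h)] with y hy
    obtain ⟨hyV, hy⟩ := hy
    have := hval (σ y) V hyV G hG hy
    rwa [hbase] at this
  refine ⟨fun y ↦ R (σ y) y, fun x ↦ ?_, ?_⟩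
  · refine hcongr ?_ (hF x (V (σ x)) (hV _) (R (σ x)) (hR _) (hgerm _).symm)
    have := hR (σ x) _ (hV (σ x))
    rwa [hbase] at this
  · have key : ∀ g, g = g₀ → ∀ h : g.base ∈ U,
        (germPresheaf P).germ U g.base h (germSection U f₀ hO) = g.germ := by
      rintro _ rfl _
      rfl
    exact hF x₀ U (by rw [hbase]; exact hxO) f₀ hO (key _ hσ₀ _)

end Germs

/-! ### The global symmetry. -/

section Global
variable {E : Type*} [NormedAddCommGroup E] [NormedSpace ℝ E] [FiniteDimensional ℝ E]
  {M : Type*} [TopologicalSpace M] [T2Space M] [ChartedSpace E M] [IsManifold 𝓘(ℝ, E) ω M]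
  {cov : Connection E M} {x₀ : M}

/-- Affine germs on a simply connected complete manifold extend globally. -/
theorem exists_isAffineAt_extension [SimplyConnectedSpace M] (hcov : IsRealAnalytic cov)
    (hc : IsGeodesicallyComplete cov) {f₀ : M → M} (h₀ : ∀ᶠ y in 𝓝 x₀, IsAffineAt cov f₀ y) :
    ∃ F : M → M, (∀ x, IsAffineAt cov F x) ∧ F =ᶠ[𝓝 x₀] f₀ := by
  have : LocallyPathConnectedSpace M := ChartedSpace.locallyPathConnectedSpace E M
  -- Affine germs, required only to be smooth, are automatically analytic, because near q they
  -- coincide with the exponential formula. Hence the identity theorem applies to them.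
  have hω : ∀ {f : M → M} {q : M}, (∀ᶠ y in 𝓝 q, IsAffineAt cov f y) →
      ContMDiffAt 𝓘(ℝ, E) 𝓘(ℝ, E) ω f q := by
    intro f q hf
    obtain ⟨W, -, hq, -, h⟩ := exists_affine_extension hcov hc q
    obtain ⟨F, -, hF, hFf⟩ := h q hq f hf
    exact (hF q hq).congr_of_eventuallyEq hFf.symm
  obtain ⟨F, hF, hFf⟩ := exists_global_extension (X := M) (Y := M)
    (P := fun f x ↦ ∀ᶠ y in 𝓝 x, IsAffineAt cov f y)
    (fun h h' ↦ by filter_upwards [h, h'.eventuallyEq_nhds] with y h1 h2 using h1.congr h2)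
    (fun h ↦ h.eventually_nhds) (fun p ↦ by
      obtain ⟨W, hWo, hp, hWc, h⟩ := exists_affine_extension hcov hc p
      refine ⟨W, hWo, hp, fun q hq f hf ↦ ?_, fun q hq f g hf hg hfg x hx ↦ ?_⟩
      · obtain ⟨F, hF, -, hFf⟩ := h q hq f hf
        exact ⟨F, fun x hx ↦ by filter_upwards [hWo.mem_nhds hx] with y hy using hF y hy, hFf⟩
      · exact (eventuallyEq_of_contMDiffAt hWc (fun x hx ↦ hω (hf x hx)) (fun x hx ↦ hω (hg x hx))
          hq hfg x hx).self_of_nhds) h₀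
  exact ⟨F, fun x ↦ (hF x).self_of_nhds, hFf⟩

/-- The local symmetry is a germ to be continued; the fixed point and the derivative -Id are read
off from that germ. -/
lemma ParityCondition.exists_isAffineSymmetryOn_univ [SimplyConnectedSpace M]
    (hcov : IsRealAnalytic cov) (hc : IsGeodesicallyComplete cov) (h : ParityCondition cov x₀) :
    ∃ f : M → M, IsAffineSymmetryOn cov x₀ univ f := by
  obtain ⟨U, f, hf⟩ := h.exists_isAffineSymmetryOn hcov
  have h1 : ∀ᶠ y in 𝓝 x₀, IsAffineAt cov f y := by
    filter_upwards [hf.isOpen.mem_nhds hf.mem] with y hy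
      using (isAffineOn_iff hf.isOpen).1 hf.affine y hy
  obtain ⟨F, hF, hFf⟩ := exists_isAffineAt_extension hcov hc h1
  refine ⟨F, isOpen_univ, mem_univ _, (isAffineOn_iff isOpen_univ).2 fun x _ ↦ hF x, fun v ↦ ?_⟩
  rw [← hf.map_and_deriv v]
  have key : ∀ (y y' : M) (_ : y = y') (w : TangentSpace 𝓘(ℝ, E) y) (w' : TangentSpace 𝓘(ℝ, E) y'),
      (w : E) = w' → (⟨y, w⟩ : TangentBundle 𝓘(ℝ, E) M) = ⟨y', w'⟩ := by
    rintro y _ rfl w w' h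
    exact congrArg _ h
  refine key _ _ hFf.self_of_nhds _ _ ?_
  change mfderiv 𝓘(ℝ, E) 𝓘(ℝ, E) F x₀ v = mfderiv 𝓘(ℝ, E) 𝓘(ℝ, E) f x₀ v
  rw [hFf.mfderiv_eq]
  rfl

end Global

end AffineSymmetry

end

theorem corollary5p19 {E : Type*} [NormedAddCommGroup E] [NormedSpace ℝ E] [FiniteDimensional ℝ E]
    {M : Type*} [TopologicalSpace M] [T2Space M] [ChartedSpace E M] [IsManifold 𝓘(ℝ, E) ω M]
    (cov : AffineSymmetry.Connection E M) (hcov : AffineSymmetry.IsRealAnalytic cov) (x₀ : M) :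
    ((∃ (U : Set M) (f : M → M), AffineSymmetry.IsAffineSymmetryOn cov x₀ U f) ↔
      AffineSymmetry.ParityCondition cov x₀) ∧
    (SimplyConnectedSpace M → AffineSymmetry.IsGeodesicallyComplete cov →
      (AffineSymmetry.ParityCondition cov x₀ ↔
        ∃ f : M → M, AffineSymmetry.IsAffineSymmetryOn cov x₀ Set.univ f)) :=
  ⟨⟨fun ⟨_, _, h⟩ ↦ h.parityCondition hcov, fun h ↦ h.exists_isAffineSymmetryOn hcov⟩,
    fun _ hc ↦ ⟨fun h ↦ h.exists_isAffineSymmetryOn_univ hcov hc,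
      fun ⟨_, h⟩ ↦ h.parityCondition hcov⟩⟩
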